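/- **Expressions.** Ring expressions are built from variables and the constants $0,1$ by addition and multiplication. The degree of an expression is $1$ for a variable, $0$ for a constant, $\max(\deg a,\deg b)$ for $a+b$, and $\deg a+\deg b$ for $ab$. A *ring identity* $L=R$ is a pair of expressions that can be transformed into each other by commutativity, associativity, distributivity and the laws $0+a=a$, $1\cdot a=a$, $0\cdot a=0$, applied to subexpressions. It is a *degree two* identity if $\deg L\le 2$ and $\deg R\le 2$. **Circuits.** Fix $n\ge 1$. Each ring variable is represented by a bit-vector of $n$ Boolean variables (shared by $L$ and $R$), and the constants $0,1$ by constant bit-vectors of length $n$. Each occurrence of an addition or multiplication in $L$ or $R$ gets a circuit of its own, with fresh variables, which takes the outputs of its operands as inputs; if the operands have different lengths, the shorter one is padded with constants $0$ to the common length $w$, and variables that do not exist are replaced by the constant $0$. An *adder* with inputs $a_0,a_1,a_2$ has a carry bit $c=\mathrm{MAJ}(a_0,a_1,a_2)$ and a sum bit $d=a_0\oplus a_1\oplus a_2$. * An addition of $x_{w-1}\dots x_0$ and $y_{w-1}\dots y_0$ is implemented by a *ripple-carry adder*: for $0\le i\le w$ an adder with inputs $x_i,y_i,c_{i-1}$,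 carry bit $c_i$ and sum bit $o_i$. Its output is $o_w\dots o_0$. * A multiplication is implemented by an *array multiplier*: tableau variables $t_{i,j}=x_i\wedge y_j$ for $0\le i,j<w$; for $0\le i\le w$, $0\le j<w$ an adder with inputs $t_{i,j},\,d_{i+1,j-1},\,c_{i-1,j}$, carry bit $c_{i,j}$ and sum bit $d_{i,j}$; and output bits $o_0,\dots,o_{2w-1}$ equated with $d_{0,0},\dots,d_{0,w-1},d_{1,w-1},\dots,d_{w,w-1}$. **The formula.** Let $o^L_i,o^R_i$ be the output bits of the circuits of $L$ and $R$, for $i<m$ where $m$ is the larger of their two lengths (with missing bits $0$). The formula $\phi^{\mathrm{Array}}_{L=R}(n)$ consists of all the constraints of the two circuits and the constraints $e_i=(\neg o^L_i\wedge o^R_i)\vee(o^L_i\wedge\neg o^R_i)$ for $i<m$ and $e_0\vee\dots\vee e_{m-1}$. Each constraint is encoded as a set of clauses: for each assignment to its variables that violates it, the clause in these variables that forbids this assignment. **Resolution.** A *resolution refutation* of $\phi$ is a sequence of clauses ending with the empty clause, each of which is a clause of $\phi$ or follows from two earlier clauses $C\vee x$ and $D\vee\bar x$ as $C\vee D$ (a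 resolution on $x$). Its *size* is the number of its clauses. It is *regular* if on every path of its proof DAG each variable is resolved on at most once. **Theorem.** For every degree two ring identity $L=R$ there are constants $A,d\in\mathbb N$ such that for every $n\ge 1$ the formula $\phi^{\mathrm{Array}}_{L=R}(n)$ has a regular resolution refutation of size at most $A\,n^d$. -/

import Mathlib

namespace ArrayMul

/-! ### Ring expressions and ring identities -/

/-- Expressions in the language of commutative rings, without subtraction: the expressions that are
implemented by adders and multipliers. -/
inductive RingExpr : Type
  | var (v : ℕ) : RingExpr
  | zero : RingExpr
  | one : RingExpr
  | add (a b : RingExpr) : RingExpr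
  | mul (a b : RingExpr) : RingExpr

/-- The degree of an expression. -/
def RingExpr.degree : RingExpr → ℕ
  | .var _ => 1
  | .zero => 0
  | .one => 0
  | .add a b => max a.degree b.degree
  | .mul a b => a.degree + b.degree

/-- `RingIdentity L R`: the expressions `L` and `R` can be transformed into each other, rewriting
subexpressions by commutativity, associativity, distributivity and the laws of the constants
`0` and `1`. -/
inductive RingIdentity : RingExpr → RingExpr → Prop
  | refl (a : RingExpr) : RingIdentity a a
  | symm {a b : RingExpr} : RingIdentity a b → RingIdentity b a
  | trans {a b c : RingExpr} : RingIdentity a b → RingIdentity b c → RingIdentity a c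
  | add_congr {a a' b b' : RingExpr} :
      RingIdentity a a' → RingIdentity b b' → RingIdentity (.add a b) (.add a' b')
  | mul_congr {a a' b b' : RingExpr} :
      RingIdentity a a' → RingIdentity b b' → RingIdentity (.mul a b) (.mul a' b')
  | add_comm (a b : RingExpr) : RingIdentity (.add a b) (.add b a)
  | add_assoc (a b c : RingExpr) : RingIdentity (.add (.add a b) c) (.add a (.add b c))
  | mul_comm (a b : RingExpr) : RingIdentity (.mul a b) (.mul b a)
  | mul_assoc (a b c : RingExpr) : RingIdentity (.mul (.mul a b) c) (.mul a (.mul b c))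
  | mul_add (a b c : RingExpr) :
      RingIdentity (.mul a (.add b c)) (.add (.mul a b) (.mul a c))
  | zero_add (a : RingExpr) : RingIdentity (.add .zero a) a
  | one_mul (a : RingExpr) : RingIdentity (.mul .one a) a
  | zero_mul (a : RingExpr) : RingIdentity (.mul .zero a) .zero

/-! ### Clauses and regular resolution -/

/-- The literal `(x, true)` is `x`, the literal `(x, false)` is the negation of `x`; a clause is a
finite set of literals. -/
abbrev Clause (V : Type) : Type := Finset (V × Bool)

/-- How a line of a resolution proof is obtained: it is a clause of the input formula, or it is the
result of resolving the earlier lines `j` and `k` on the variable `x`. -/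
inductive Inference (V : Type) : Type
  | input : Inference V
  | resolve (x : V) (j k : ℕ) : Inference V

/-- The variable that an inference resolves on. -/
def Inference.pivot {V : Type} : Inference V → Option V
  | .input => none
  | .resolve x _ _ => some x

/-- `r.HasPremise j`: line `j` is one of the two premises of the inference `r`. -/
def Inference.HasPremise {V : Type} : Inference V → ℕ → Prop
  | .input, _ => False
  | .resolve _ j k, l => l = j ∨ l = k

/-- A resolution refutation of `φ`: a sequence of `size` clauses (lines `0, …, size - 1`; the
values of `clause` and `inference` at later indices play no role) that ends in the empty clause.
Each line is a clause of `φ` or is `C ∪ D` for two earlier lines `C ∪ {x}` and `D ∪ {¬x}`. -/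
structure Refutation {V : Type} [DecidableEq V] (φ : Set (Clause V)) where
  size : ℕ
  clause : ℕ → Clause V
  inference : ℕ → Inference V
  input_mem : ∀ i < size, inference i = .input → clause i ∈ φ
  resolve_valid : ∀ i < size, ∀ (x : V) (j k : ℕ), inference i = .resolve x j k →
    j < i ∧ k < i ∧ (x, true) ∈ clause j ∧ (x, false) ∈ clause k ∧
      clause i = (clause j).erase (x, true) ∪ (clause k).erase (x, false)
  size_pos : 0 < size
  last_empty : clause (size - 1) = ∅

/-- The edges of the proof DAG: line `j` is a premise of line `i`. -/
def Refutation.Edge {V : Type} [DecidableEq V] {φ : Set (Clause V)} (P : Refutation φ)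
    (j i : ℕ) : Prop :=
  i < P.size ∧ (P.inference i).HasPremise j

/-- A refutation is regular if no two different inferences on a path of its DAG resolve on the same
variable. -/
def Refutation.IsRegular {V : Type} [DecidableEq V] {φ : Set (Clause V)} (P : Refutation φ) :
    Prop :=
  ∀ (j i : ℕ) (x : V), Relation.TransGen P.Edge j i →
    (P.inference i).pivot = some x → (P.inference j).pivot ≠ some x

/-! ### Constraints and their clauses -/

/-- A Boolean constraint with the finite set of variables it is about. -/
structure Constraint (V : Type) : Type where
  vars : Finset V
  holds : (V → Bool) → Prop

/-- The clauses that encode a constraint: for every assignment that violates it, the clause in the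
variables of the constraint that forbids this assignment. -/
def Constraint.clauses {V : Type} [DecidableEq V] (c : Constraint V) : Set (Clause V) :=
  {C | ∃ σ : V → Bool, ¬ c.holds σ ∧ C = c.vars.image fun v => (v, !σ v)}

/-! ### Circuits -/

/-- The position of a subexpression: the root is `[false]` for the left-hand side and `[true]` for
the right-hand side of the identity, the two operands of the node at `p` are at `false :: p` and
`true :: p`. -/
abbrev Addr : Type := List Bool

/-- The Boolean variables. -/
inductive BVar : Type
  /-- bit `i` of the input bit-vector of the ring variable `v` -/
  | inp (v i : ℕ) : BVar
  /-- output bit `i` of the adder or multiplier at `p` -/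
  | out (p : Addr) (i : ℕ) : BVar
  /-- carry bit `i` of the ripple-carry adder at `p` -/
  | rcarry (p : Addr) (i : ℕ) : BVar
  /-- tableau variable `t i j` of the multiplier at `p` -/
  | tab (p : Addr) (i j : ℕ) : BVar
  /-- carry bit `c i j` of the multiplier at `p` -/
  | car (p : Addr) (i j : ℕ) : BVar
  /-- sum bit `d i j` of the multiplier at `p` -/
  | sum (p : Addr) (i j : ℕ) : BVar
  /-- bit `i` of the comparison of the two sides -/
  | neq (i : ℕ) : BVar
  deriving DecidableEq

/-- A wire carries a variable or a constant. -/
inductive Signal : Type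
  | const (b : Bool) : Signal
  | var (x : BVar) : Signal

def Signal.val (σ : BVar → Bool) : Signal → Bool
  | .const b => b
  | .var x => σ x

def Signal.vars : Signal → Finset BVar
  | .const _ => ∅
  | .var x => {x}

/-- `z = x ∧ y` -/
def andGate (x y : Signal) (z : BVar) : Constraint BVar where
  vars := x.vars ∪ y.vars ∪ {z}
  holds σ := σ z = (x.val σ && y.val σ)

/-- `z = x` -/
def eqGate (x : Signal) (z : BVar) : Constraint BVar where
  vars := x.vars ∪ {z}
  holds σ := σ z = x.val σ

/-- `d = a₀ ⊕ a₁ ⊕ a₂` -/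
def sumGate (a₀ a₁ a₂ : Signal) (d : BVar) : Constraint BVar where
  vars := a₀.vars ∪ a₁.vars ∪ a₂.vars ∪ {d}
  holds σ := σ d = ((a₀.val σ ^^ a₁.val σ) ^^ a₂.val σ)

/-- `c = MAJ(a₀, a₁, a₂)` -/
def majGate (a₀ a₁ a₂ : Signal) (c : BVar) : Constraint BVar where
  vars := a₀.vars ∪ a₁.vars ∪ a₂.vars ∪ {c}
  holds σ := σ c =
    ((a₀.val σ && a₁.val σ) || (a₀.val σ && a₂.val σ) || (a₁.val σ && a₂.val σ))

/-- An adder with inputs `a₀, a₁, a₂`, carry bit `c` and sum bit `d`. -/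
def adder (a₀ a₁ a₂ : Signal) (c d : BVar) : Set (Constraint BVar) :=
  {majGate a₀ a₁ a₂ c, sumGate a₀ a₁ a₂ d}

/-- A bit-vector: its length, and its bits by weight. Only the bits below the length exist; the
bits above it are the constant `0` in all the bit-vectors below. -/
structure BitVector : Type where
  length : ℕ
  bit : ℕ → Signal

/-- The output bit-vector of length `w` of the circuit at `p`. -/
def outputs (p : Addr) (w : ℕ) : BitVector where
  length := w
  bit i := if i < w then .var (.out p i) else .const false

/-- The incoming carry of column `i` of the ripple-carry adder at `p`. -/
def rippleCarryIn (p : Addr) : ℕ → Signal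
  | 0 => .const false
  | i + 1 => .var (.rcarry p i)

/-- The ripple-carry adder at `p` for bit-vectors of length at most `w`: in each of the columns
`0, …, w` an adder; the adder in column `w` has two constant inputs `0` and is the wire from the last
carry bit to the output bit `w`. -/
def rippleCarryAdder (p : Addr) (w : ℕ) (x y : BitVector) : Set (Constraint BVar) :=
  {c | ∃ i ≤ w, c ∈ adder (x.bit i) (y.bit i) (rippleCarryIn p i) (.rcarry p i) (.out p i)}

/-- The tableau input of the adder `A i j`; there is no tableau variable with `i = w`. -/
def tabIn (p : Addr) (w i j : ℕ) : Signal :=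
  if i < w then .var (.tab p i j) else .const false

/-- The sum input `d (i+1) (j-1)` of the adder `A i j`. -/
def sumIn (p : Addr) (w i : ℕ) : ℕ → Signal
  | 0 => .const false
  | j + 1 => if i < w then .var (.sum p (i + 1) j) else .const false

/-- The carry input `c (i-1) j` of the adder `A i j`. -/
def carIn (p : Addr) : ℕ → ℕ → Signal
  | 0, _ => .const false
  | i + 1, j => .var (.car p i j)

/-- The sum bit that is the output bit of weight `k` of the array multiplier: the outputs are
`d 0 0, …, d 0 (w-1), d 1 (w-1), …, d w (w-1)`. -/
def arrayOut (p : Addr) (w k : ℕ) : BVar :=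
  if k < w then .sum p 0 k else .sum p (k - (w - 1)) (w - 1)

/-- The array multiplier at `p` for bit-vectors of length at most `w`: the tableau
`t i j = x i ∧ y j`, the grid of adders `A i j` (row `j < w`, position `i ≤ w` in the row, column
`i + j`), where the adder with `i = w` is the wire that takes the last carry bit of the row, and the
`2 w` output bits. -/
def arrayMultiplier (p : Addr) (w : ℕ) (x y : BitVector) : Set (Constraint BVar) :=
  {c | ∃ i < w, ∃ j < w, c = andGate (x.bit i) (y.bit j) (.tab p i j)} ∪
  {c | ∃ i ≤ w, ∃ j < w,
    c ∈ adder (tabIn p w i j) (sumIn p w i j) (carIn p i j) (.car p i j) (.sum p i j)} ∪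
  {c | ∃ k < 2 * w, c = eqGate (.var (arrayOut p w k)) (.out p k)}

/-- The bit-vector that the circuit for an expression at `p` outputs, when the input bit-vectors and
the constants have length `n`. -/
def RingExpr.output (n : ℕ) : Addr → RingExpr → BitVector
  | _, .var v => ⟨n, fun i => if i < n then .var (.inp v i) else .const false⟩
  | _, .zero => ⟨n, fun _ => .const false⟩
  | _, .one => ⟨n, fun i => .const (decide (i = 0 ∧ 0 < n))⟩
  | p, .add a b =>
    outputs p (max (a.output n (false :: p)).length (b.output n (true :: p)).length + 1)
  | p, .mul a b =>
    outputs p (2 * max (a.output n (false :: p)).length (b.output n (true :: p)).length)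

/-- The constraints of the circuit for an expression at `p`: one ripple-carry adder for each
addition, one array multiplier for each multiplication; if the operands have different lengths, the
shorter one is padded by constants `0`. -/
def RingExpr.circuit (n : ℕ) : Addr → RingExpr → Set (Constraint BVar)
  | _, .var _ => ∅
  | _, .zero => ∅
  | _, .one => ∅
  | p, .add a b =>
    let x := a.output n (false :: p)
    let y := b.output n (true :: p)
    a.circuit n (false :: p) ∪ b.circuit n (true :: p) ∪
      rippleCarryAdder p (max x.length y.length) x y
  | p, .mul a b =>
    let x := a.output n (false :: p)
    let y := b.output n (true :: p)
    a.circuit n (false :: p) ∪ b.circuit n (true :: p) ∪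
      arrayMultiplier p (max x.length y.length) x y

/-- `e i = (¬ x ∧ y) ∨ (x ∧ ¬ y)` -/
def neqGate (x y : Signal) (i : ℕ) : Constraint BVar where
  vars := x.vars ∪ y.vars ∪ {.neq i}
  holds σ := σ (.neq i) = ((!x.val σ && y.val σ) || (x.val σ && !y.val σ))

/-- `e 0 ∨ ⋯ ∨ e (w - 1)` -/
def someNeq (w : ℕ) : Constraint BVar where
  vars := (Finset.range w).image .neq
  holds σ := ∃ i < w, σ (.neq i) = true

/-- The inequality constraints: the bit-vectors `x` and `y` differ in some bit. -/
def inequality (x y : BitVector) : Set (Constraint BVar) :=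
  {c | ∃ i < max x.length y.length, c = neqGate (x.bit i) (y.bit i) i} ∪
  {someNeq (max x.length y.length)}

/-- The constraints that assert that the array multiplier circuits for `L` and `R`, with input
bit-vectors of length `n`, disagree on some output bit. -/
def arrayConstraints (L R : RingExpr) (n : ℕ) : Set (Constraint BVar) :=
  L.circuit n [false] ∪ R.circuit n [true] ∪
    inequality (L.output n [false]) (R.output n [true])

/-- The SAT instance for the identity `L = R`. -/
def arrayInstance (L R : RingExpr) (n : ℕ) : Set (Clause BVar) :=
  {C | ∃ c ∈ arrayConstraints L R n, C ∈ c.clauses}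

end ArrayMul

/-! It suffices to refute, for each `k`, that bit `k` is the first bit in which the two outputs
differ; these refutations are combined by resolving away the comparison bits
(`derives_empty_of_forall_first`).

Fix `k` and keep, of the quadratic multipliers, only the columns `k - δ, …, k` with `δ` logarithmic
in `n`. Adding up the column equations of the adders (`strip_columns`) shows that the bits of a
quadratic subexpression in this critical strip represent its value modulo `2 ^ (k + 1)`, up to an
error from the carries that enter the strip and the digits below it (`Approx`, `Model.approx_eval`).
Subexpressions of degree at most one are kept in all columns `0, …, k` and are exact
(`Model.strip_zero_eq_eval`). The identity holds in `ZMod (2 ^ (k + 1))`, so both outputs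
approximate the same residue. If they first differ in bit `k`, their parts in the strip differ by
exactly `2 ^ k`. The errors are multiples of `k * 2 ^ (k - δ)`-sized terms by constants, and `δ` is
chosen so that they total less than `2 ^ k`; this is a contradiction (`not_approx_of_differ`).

The constraints that were kept have a path decomposition of logarithmic width. The interval of
columns is folded in the middle, and a sweep visits columns `i` and `k - i` together. A product `x i
* y j` in the strip has `i + j` close to `k`, so its factors have close folded positions, and so do
the mirrored products that occur when factors are commuted. Adders connect only neighbouring
columns. Eliminating the variables in the order in which they leave the bags
(`derives_of_pathDecomposition`) creates only clauses inside bags, hence polynomially many, and it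
is regular because every variable is eliminated once, in one fixed order.

Multiplication by a constant subexpression needs extra care, since its circuit is as large as any
other. Unit propagation (`derives_of_forall_unitClosed`) first fixes the constant circuits and most
cells of such multipliers. What remains is a bounded number of cells per column and, for a constant
second operand, long chains of sum bits, which are traversed one row per time step. -/

namespace ArrayMul

/-! ### Regular derivations with weakening -/

section Derivations

variable {V : Type} [DecidableEq V] {φ : Set (Clause V)}

/-- A regular resolution proof DAG with weakening. The set `hist i` contains all variables that are
resolved on at the node `i` or at one of its ancestors. -/
structure ProofDag (φ : Set (Clause V)) (ι : Type) where
  clause : ι → Clause V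
  level : ι → ℕ
  hist : ι → Set V
  valid : ∀ i, (∃ C ∈ φ, C ⊆ clause i) ∨ ∃ x j k, level j < level i ∧ level k < level i ∧
    clause j ⊆ insert (x, true) (clause i) ∧ clause k ⊆ insert (x, false) (clause i) ∧
    x ∉ hist j ∧ x ∉ hist k ∧ hist j ⊆ hist i ∧ hist k ⊆ hist i ∧ x ∈ hist i

/-- `Derives φ H s C`: some subclause of `C` has a regular derivation from `φ` of size at most `s`
that resolves only on variables in `H`. -/
def Derives (φ : Set (Clause V)) (H : Set V) (s : ℕ) (C : Clause V) : Prop :=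
  ∃ (ι : Type) (_ : Fintype ι) (G : ProofDag φ ι) (i : ι),
    Fintype.card ι ≤ s ∧ G.clause i ⊆ C ∧ G.hist i ⊆ H

theorem Derives.mono {H H' : Set V} {s s' : ℕ} {C C' : Clause V} (h : Derives φ H s C)
    (hH : H ⊆ H') (hs : s ≤ s') (hC : C ⊆ C') : Derives φ H' s' C' := by
  obtain ⟨ι, inst, G, i, h1, h2, h3⟩ := h
  exact ⟨ι, inst, G, i, h1.trans hs, h2.trans hC, h3.trans hH⟩

theorem Derives.input {C : Clause V} (hC : C ∈ φ) : Derives φ ∅ 1 C :=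
  ⟨Unit, inferInstance, ⟨fun _ => C, fun _ => 0, fun _ => ∅, fun _ => Or.inl ⟨C, hC, subset_rfl⟩⟩,
    (), by simp, subset_rfl, subset_rfl⟩

/-- The two DAGs are placed side by side without sharing. The variable sets may overlap: regularity
concerns single paths, so only the new pivot has to be absent from both. -/
theorem Derives.resolve {H₁ H₂ : Set V} {s₁ s₂ : ℕ} {C : Clause V} (x : V)
    (h₁ : Derives φ H₁ s₁ (insert (x, true) C)) (h₂ : Derives φ H₂ s₂ (insert (x, false) C))
    (hx₁ : x ∉ H₁) (hx₂ : x ∉ H₂) :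
    Derives φ (insert x (H₁ ∪ H₂)) (s₁ + s₂ + 1) C := by
  obtain ⟨ι₁, inst₁, G₁, i₁, hs₁, hc₁, hh₁⟩ := h₁
  obtain ⟨ι₂, inst₂, G₂, i₂, hs₂, hc₂, hh₂⟩ := h₂
  refine ⟨Option (ι₁ ⊕ ι₂), inferInstance,
    { clause := fun o => o.elim C (Sum.elim G₁.clause G₂.clause)
      level := fun o => o.elim (G₁.level i₁ + G₂.level i₂ + 1) (Sum.elim G₁.level G₂.level)
      hist := fun o => o.elim (insert x (H₁ ∪ H₂)) (Sum.elim G₁.hist G₂.hist)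
      valid := ?_ }, none, ?_, ?_, ?_⟩
  · rintro (_ | i | i)
    · refine Or.inr ⟨x, some (Sum.inl i₁), some (Sum.inr i₂), ?_, ?_, hc₁, hc₂,
        fun h => hx₁ (hh₁ h), fun h => hx₂ (hh₂ h), ?_, ?_, ?_⟩
      · simp only [Option.elim, Sum.elim_inl]; omega
      · simp only [Option.elim, Sum.elim_inr]; omega
      · exact fun v hv => Or.inr (Or.inl (hh₁ hv))
      · exact fun v hv => Or.inr (Or.inr (hh₂ hv))
      · exact Or.inl rfl
    · rcases G₁.valid i with h | ⟨y, j, k, h⟩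
      · exact Or.inl h
      · exact Or.inr ⟨y, some (Sum.inl j), some (Sum.inl k), h⟩
    · rcases G₂.valid i with h | ⟨y, j, k, h⟩
      · exact Or.inl h
      · exact Or.inr ⟨y, some (Sum.inr j), some (Sum.inr k), h⟩
  · rw [Fintype.card_option, Fintype.card_sum]; omega
  · exact subset_rfl
  · exact subset_rfl

/-- Line `i` of a sequence of clauses is an input clause or the resolvent of two earlier lines, and
the resolution is regular with respect to the sets `hist`. -/
def IsLine (φ : Set (Clause V)) (cl : ℕ → Clause V) (inf : ℕ → Inference V) (hist : ℕ → Set V)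
    (i : ℕ) : Prop :=
  (inf i = .input ∧ cl i ∈ φ) ∨ ∃ x j k, inf i = .resolve x j k ∧ j < i ∧ k < i ∧
    (x, true) ∈ cl j ∧ (x, false) ∈ cl k ∧
    cl i = (cl j).erase (x, true) ∪ (cl k).erase (x, false) ∧
    x ∉ hist j ∧ x ∉ hist k ∧ hist j ⊆ hist i ∧ hist k ⊆ hist i ∧ x ∈ hist i

theorem exists_append_line {N : ℕ} {cl : ℕ → Clause V} {inf : ℕ → Inference V}
    {hist : ℕ → Set V} (hl : ∀ i < N, IsLine φ cl inf hist i) (C : Clause V) (r : Inference V)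
    (H : Set V)
    (hnew : (r = .input ∧ C ∈ φ) ∨ ∃ x j k, r = .resolve x j k ∧ j < N ∧ k < N ∧
      (x, true) ∈ cl j ∧ (x, false) ∈ cl k ∧
      C = (cl j).erase (x, true) ∪ (cl k).erase (x, false) ∧
      x ∉ hist j ∧ x ∉ hist k ∧ hist j ⊆ H ∧ hist k ⊆ H ∧ x ∈ H) :
    ∃ cl' inf' hist', (∀ i < N + 1, IsLine φ cl' inf' hist' i) ∧
      (∀ i < N, cl' i = cl i ∧ hist' i = hist i) ∧ cl' N = C ∧ hist' N = H := by
  refine ⟨fun i => if i < N then cl i else C, fun i => if i < N then inf i else r,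
    fun i => if i < N then hist i else H, ?_, ?_, ?_, ?_⟩
  · intro i hi
    by_cases hiN : i < N
    · rcases hl i hiN with h | ⟨x, j, k, h1, h2, h3, h4⟩
      · left; simpa [hiN] using h
      · right
        refine ⟨x, j, k, ?_⟩
        have hj : j < N := by omega
        have hk : k < N := by omega
        simpa [hiN, hj, hk, h2, h3] using ⟨h1, h4⟩
    · obtain rfl : i = N := by omega
      rcases hnew with h | ⟨x, j, k, h1, h2, h3, h4⟩
      · left; simpa using h
      · right
        refine ⟨x, j, k, ?_⟩
        simpa [h2, h3] using ⟨h1, h4⟩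
  · intro i hi; simp [hi]
  · simp
  · simp

/-- Weakening is removed here, without increasing the size or adding pivots. Nodes are processed by
increasing level, and each is assigned a line whose clause and history are contained in its own. -/
theorem ProofDag.exists_lines {ι : Type} (G : ProofDag φ ι) (s : Finset ι) :
    (∀ i ∈ s, ∀ j, G.level j < G.level i → j ∈ s) →
    ∃ N ≤ s.card, ∃ cl inf hist, (∀ i < N, IsLine φ cl inf hist i) ∧
      ∀ a ∈ s, ∃ r < N, cl r ⊆ G.clause a ∧ hist r ⊆ G.hist a := by
  classical
  induction s using Finset.induction_on_max_value G.level with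
  | empty => exact fun _ => ⟨0, le_rfl, fun _ => ∅, fun _ => .input, fun _ => ∅, by simp, by simp⟩
  | insert a s ha hmax ih =>
    intro hlow
    have hlow' : ∀ j, G.level j < G.level a → j ∈ s := fun j hj =>
      (Finset.mem_insert.1 (hlow a (Finset.mem_insert_self a s) j hj)).resolve_left
        (by rintro rfl; exact lt_irrefl _ hj)
    obtain ⟨N, hN, cl, inf, hist, hl, hm⟩ := ih fun i hi j hj => hlow' j (hj.trans_le (hmax i hi))
    have hcard : (insert a s).card = s.card + 1 := Finset.card_insert_of_notMem ha
    have old : (∃ r < N, cl r ⊆ G.clause a ∧ hist r ⊆ G.hist a) →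
        ∃ N ≤ (insert a s).card, ∃ cl inf hist, (∀ i < N, IsLine φ cl inf hist i) ∧
        ∀ b ∈ insert a s, ∃ r < N, cl r ⊆ G.clause b ∧ hist r ⊆ G.hist b := fun h =>
      ⟨N, by omega, cl, inf, hist, hl, Finset.forall_mem_insert .. |>.2 ⟨h, hm⟩⟩
    have new : (∃ (C : Clause V) (r : Inference V), C ⊆ G.clause a ∧ ((r = .input ∧ C ∈ φ) ∨
        ∃ x j k, r = .resolve x j k ∧ j < N ∧ k < N ∧ (x, true) ∈ cl j ∧ (x, false) ∈ cl k ∧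
        C = (cl j).erase (x, true) ∪ (cl k).erase (x, false) ∧ x ∉ hist j ∧ x ∉ hist k ∧
        hist j ⊆ G.hist a ∧ hist k ⊆ G.hist a ∧ x ∈ G.hist a)) →
        ∃ N ≤ (insert a s).card, ∃ cl inf hist, (∀ i < N, IsLine φ cl inf hist i) ∧
        ∀ b ∈ insert a s, ∃ r < N, cl r ⊆ G.clause b ∧ hist r ⊆ G.hist b := by
      rintro ⟨C, r, hC, hr⟩
      obtain ⟨cl', inf', hist', h1, h2, h3, h4⟩ := exists_append_line hl C r (G.hist a) hr
      refine ⟨N + 1, by omega, cl', inf', hist', h1, Finset.forall_mem_insert .. |>.2 ⟨?_, ?_⟩⟩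
      · exact ⟨N, by omega, h3 ▸ hC, h4 ▸ subset_rfl⟩
      · intro b hb
        obtain ⟨r, hr, hr1, hr2⟩ := hm b hb
        exact ⟨r, by omega, (h2 r hr).1 ▸ hr1, (h2 r hr).2 ▸ hr2⟩
    rcases G.valid a with ⟨C, hC, hCa⟩ | ⟨x, j, k, hj, hk, hcj, hck, hxj, hxk, hhj, hhk, hx⟩
    · exact new ⟨C, .input, hCa, Or.inl ⟨rfl, hC⟩⟩
    · obtain ⟨u, hu, huc, huh⟩ := hm j (hlow' j hj)
      obtain ⟨v, hv, hvc, hvh⟩ := hm k (hlow' k hk)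
      -- The shrunken premises may have lost the pivot. Then that premise already is a subclause of
      -- the conclusion, and its line is reused instead of making a new one.
      by_cases hxu : (x, true) ∈ cl u
      · by_cases hxv : (x, false) ∈ cl v
        · refine new ⟨_, .resolve x u v, ?_, Or.inr ⟨x, u, v, rfl, hu, hv, hxu, hxv, rfl,
            fun h => hxj (huh h), fun h => hxk (hvh h), huh.trans hhj, hvh.trans hhk, hx⟩⟩
          refine Finset.union_subset ?_ ?_
          · exact Finset.subset_insert_iff.1 (huc.trans hcj)
          · exact Finset.subset_insert_iff.1 (hvc.trans hck)
        · exact old ⟨v, hv, (Finset.subset_insert_iff_of_notMem hxv).1 (hvc.trans hck),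
            hvh.trans hhk⟩
      · exact old ⟨u, hu, (Finset.subset_insert_iff_of_notMem hxu).1 (huc.trans hcj),
          huh.trans hhj⟩

/-- Histories grow along edges and contain the pivot of their own line, while a pivot never lies in
the history of a premise. Along a path this excludes any repeated pivot. -/
theorem Derives.exists_refutation {H : Set V} {s : ℕ} (h : Derives φ H s ∅) :
    ∃ P : Refutation φ, P.IsRegular ∧ P.size ≤ s := by
  obtain ⟨ι, inst, G, i₀, hs, hc, -⟩ := h
  obtain ⟨N, hN, cl, inf, hist, hl, hm⟩ := G.exists_lines Finset.univ (by simp)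
  obtain ⟨r, hr, hr1, -⟩ := hm i₀ (Finset.mem_univ _)
  have hN' : N ≤ s := hN.trans (by simpa using hs)
  have hl' : ∀ i < r + 1, IsLine φ cl inf hist i := fun i hi => hl i (by omega)
  let P : Refutation φ :=
    { size := r + 1
      clause := cl
      inference := inf
      input_mem := by
        intro i hi h
        rcases hl' i hi with h' | ⟨x, j, k, h', -⟩
        · exact h'.2
        · simp [h] at h'
      resolve_valid := by
        intro i hi x j k h
        rcases hl' i hi with h' | ⟨x', j', k', h', h2⟩
        · simp [h] at h'
        · rw [h] at h'
          obtain ⟨rfl, rfl, rfl⟩ := Inference.resolve.inj h'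
          exact ⟨h2.1, h2.2.1, h2.2.2.1, h2.2.2.2.1, h2.2.2.2.2.1⟩
      size_pos := by omega
      last_empty := Finset.subset_empty.1 (hr1.trans hc) }
  refine ⟨P, ?_, show r + 1 ≤ s by omega⟩
  have edge : ∀ {j i}, P.Edge j i → j < P.size ∧ hist j ⊆ hist i ∧
      ∀ x, (inf i).pivot = some x → x ∉ hist j := by
    rintro j i ⟨hi, hp⟩
    change (inf i).HasPremise j at hp
    rcases hl' i hi with h' | ⟨x, j', k', h', hj, hk, -, -, -, h6, h7, h8, h9, -⟩
    · rw [h'.1] at hp; exact hp.elim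
    · rw [h'] at hp ⊢
      rcases hp with rfl | rfl
      · exact ⟨hj.trans hi, h8, by rintro y ⟨⟩; exact h6⟩
      · exact ⟨hk.trans hi, h9, by rintro y ⟨⟩; exact h7⟩
  have path : ∀ {j i}, Relation.TransGen P.Edge j i → j < P.size ∧ hist j ⊆ hist i ∧
      ∀ x, (inf i).pivot = some x → x ∉ hist j := by
    intro j i h
    induction h using Relation.TransGen.head_induction_on with
    | single h => exact edge h
    | head h _ ih =>
      exact ⟨(edge h).1, (edge h).2.1.trans ih.2.1,
        fun x hx hxa => ih.2.2 x hx ((edge h).2.1 hxa)⟩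
  intro j i x h hi hj
  obtain ⟨h1, -, h3⟩ := path h
  refine h3 x hi ?_
  rcases hl' j h1 with h' | ⟨y, j', k', h', -, -, -, -, -, -, -, -, -, hy⟩
  · change (inf j).pivot = some x at hj
    rw [h'.1] at hj; cases hj
  · change (inf j).pivot = some x at hj
    rw [h'] at hj; cases hj; exact hy

/-! ### Variable elimination -/

/-- The variables of a clause. -/
def clauseVars (C : Clause V) : Finset V := C.image Prod.fst

theorem mem_clauseVars {C : Clause V} {v : V} : v ∈ clauseVars C ↔ ∃ l ∈ C, l.1 = v := by
  simp [clauseVars]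

theorem fst_mem_clauseVars {C : Clause V} {l : V × Bool} (h : l ∈ C) : l.1 ∈ clauseVars C :=
  Finset.mem_image_of_mem _ h

/-- The assignment `τ` falsifies all literals of `C`. -/
def Falsifies (τ : V → Bool) (C : Clause V) : Prop := ∀ l ∈ C, τ l.1 ≠ l.2

/-- The clauses obtained from `S` by resolving on `v 0, …, v (t - 1)`, in this order. -/
def elimination (S : Set (Clause V)) (v : ℕ → V) : ℕ → Set (Clause V)
  | 0 => S
  | t + 1 => elimination S v t ∪ {R | ∃ D ∈ elimination S v t, ∃ E ∈ elimination S v t,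
      (∀ s < t, v s ∉ clauseVars D) ∧ (∀ s < t, v s ∉ clauseVars E) ∧
      (v t, true) ∈ D ∧ (v t, false) ∈ E ∧ R = D.erase (v t, true) ∪ E.erase (v t, false) ∧
      v t ∉ clauseVars R}

/-- Completeness of Davis–Putnam elimination: a satisfying assignment is built backwards, choosing
the value of the variable eliminated last first. -/
theorem exists_satisfying_of_empty_notMem_elimination {S : Set (Clause V)} {v : ℕ → V} {N : ℕ}
    (hS : ∀ C ∈ elimination S v N, ∀ x ∈ clauseVars C, ∃ s < N, v s = x)
    (he : ∅ ∉ elimination S v N) : ∃ τ : V → Bool, ∀ C ∈ S, ¬ Falsifies τ C := by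
  suffices h : ∀ t ≤ N, ∃ τ : V → Bool, ∀ C ∈ elimination S v t,
      (∀ s < t, v s ∉ clauseVars C) → ¬ Falsifies τ C by
    obtain ⟨τ, hτ⟩ := h 0 (Nat.zero_le _)
    exact ⟨τ, fun C hC => hτ C hC (by simp)⟩
  intro t ht
  induction ht using Nat.decreasingInduction with
  | self =>
    refine ⟨fun _ => false, fun C hC hfr _ => he ?_⟩
    have : C = ∅ := by
      by_contra hne
      obtain ⟨l, hl⟩ := Finset.nonempty_iff_ne_empty.2 hne
      obtain ⟨s, hs, hsx⟩ := hS C hC l.1 (fst_mem_clauseVars hl)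
      exact hfr s hs (hsx ▸ fst_mem_clauseVars hl)
    exact this ▸ hC
  | of_succ t ht ih =>
    obtain ⟨τ, hτ⟩ := ih
    by_contra hno
    push Not at hno
    -- If neither value of `v t` extends `τ`, each value `b` is ruled out by a clause that contains
    -- `v t` with the sign opposite to `b` only. The resolvent of these two clauses is free of `v t`
    -- and is falsified by `τ`.
    have key : ∀ b, ∃ D ∈ elimination S v t, (∀ s < t, v s ∉ clauseVars D) ∧ (v t, !b) ∈ D ∧
        (v t, b) ∉ D ∧ ∀ l ∈ D, l.1 ≠ v t → τ l.1 ≠ l.2 := by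
      intro b
      obtain ⟨D, hD, hfr, hf⟩ := hno (Function.update τ (v t) b)
      have hb : (v t, b) ∉ D := fun h => hf _ h (by simp)
      have hl : ∀ l ∈ D, l.1 ≠ v t → τ l.1 ≠ l.2 := fun l hl hne => by
        have := hf l hl
        rwa [Function.update_of_ne hne] at this
      refine ⟨D, hD, hfr, ?_, hb, hl⟩
      by_contra hnb
      have hvt : v t ∉ clauseVars D := by
        rw [mem_clauseVars]
        rintro ⟨⟨x, c⟩, hl, rfl⟩
        by_cases hc : c = b
        · exact hb (hc ▸ hl)
        · exact hnb (by rwa [← Bool.eq_not.2 hc])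
      refine hτ D (Or.inl hD) ?_ ?_
      · intro s hs
        rcases Nat.lt_succ_iff_lt_or_eq.1 hs with h | rfl
        · exact hfr s h
        · exact hvt
      · exact fun l hlD => hl l hlD fun h => hvt (h ▸ fst_mem_clauseVars hlD)
    obtain ⟨D, hD, hDf, hD1, hD2, hDl⟩ := key false
    obtain ⟨E, hE, hEf, hE1, hE2, hEl⟩ := key true
    have hR : ∀ l ∈ D.erase (v t, true) ∪ E.erase (v t, false), l.1 ≠ v t := by
      rintro ⟨x, b⟩ hl rfl
      cases b <;> simp_all
    have hR' : v t ∉ clauseVars (D.erase (v t, true) ∪ E.erase (v t, false)) := by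
      rw [mem_clauseVars]
      rintro ⟨l, hl, h⟩
      exact hR l hl h
    refine hτ _ (Or.inr ⟨D, hD, E, hE, hDf, hEf, hD1, hE1, rfl, hR'⟩) ?_ ?_
    · intro s hs hmem
      rcases Nat.lt_succ_iff_lt_or_eq.1 hs with h | rfl
      · obtain ⟨l, hl, hls⟩ := mem_clauseVars.1 hmem
        rcases Finset.mem_union.1 hl with hl | hl
        · exact hDf s h (hls ▸ fst_mem_clauseVars (Finset.mem_of_mem_erase hl))
        · exact hEf s h (hls ▸ fst_mem_clauseVars (Finset.mem_of_mem_erase hl))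
      · exact hR' hmem
    · intro l hl
      rcases Finset.mem_union.1 hl with hl' | hl'
      · exact hDl l (Finset.mem_of_mem_erase hl') (hR l hl)
      · exact hEl l (Finset.mem_of_mem_erase hl') (hR l hl)

theorem elimination_mono {S : Set (Clause V)} {v : ℕ → V} {s t : ℕ} (h : s ≤ t) :
    elimination S v s ⊆ elimination S v t := by
  induction h with
  | refl => exact subset_rfl
  | step _ ih => exact ih.trans Set.subset_union_left

/-- If every clause of `S` becomes a clause of `φ` after adding literals of `K`, then the
elimination of variables derives `K` from `φ` unless `S` is satisfiable. -/
theorem derives_of_elimination {S : Set (Clause V)} {v : ℕ → V} {N : ℕ} {K : Clause V}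
    {X : Finset (Clause V)} (hv : ∀ s < N, ∀ t < N, v s = v t → s = t)
    (hφ : ∀ C ∈ S, ∃ C' ∈ φ, C' ⊆ C ∪ K)
    (hX : elimination S v N ⊆ X) (he : ∅ ∈ elimination S v N) :
    Derives φ {x | ∃ s < N, v s = x} X.card K := by
  classical
  have hex : ∀ C : {C // C ∈ elimination S v N}, ∃ t, C.1 ∈ elimination S v t :=
    fun C => ⟨N, C.2⟩
  -- The first stage at which a clause appears serves as its level. A clause of level `t` can only
  -- depend on pivots `v s` with `s < t`, which gives the histories.
  let ht : {C // C ∈ elimination S v N} → ℕ := fun C => Nat.find (hex C)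
  have ht_spec : ∀ C, C.1 ∈ elimination S v (ht C) := fun C => Nat.find_spec (hex C)
  have ht_le' : ∀ C t, C.1 ∈ elimination S v t → ht C ≤ t := fun C t h =>
    Nat.find_min' (hex C) h
  have ht_le : ∀ C, ht C ≤ N := fun C => ht_le' C N C.2
  have hfin : (elimination S v N).Finite := X.finite_toSet.subset hX
  have : Fintype {C // C ∈ elimination S v N} := hfin.fintype
  refine ⟨{C // C ∈ elimination S v N}, inferInstance,
    { clause := fun C => C.1 ∪ K
      level := ht
      hist := fun C => {x | ∃ s < ht C, v s = x}
      valid := ?_ }, ⟨∅, he⟩, ?_, ?_, ?_⟩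
  · intro C
    rcases h : ht C with _ | t
    · have := ht_spec C
      rw [h] at this
      exact Or.inl (hφ _ this)
    · right
      have h1 := ht_spec C
      have h2 := ht_le C
      rw [h] at h1
      rcases h1 with h1 | ⟨D, hD, E, hE, -, -, hD1, hE1, hR, -⟩
      · have := ht_le' C t h1
        omega
      · have hle : elimination S v t ⊆ elimination S v N := elimination_mono (by omega)
        have hD2 := ht_le' ⟨D, hle hD⟩ t hD
        have hE2 := ht_le' ⟨E, hle hE⟩ t hE
        refine ⟨v t, ⟨D, hle hD⟩, ⟨E, hle hE⟩, by omega, by omega, ?_, ?_, ?_, ?_, ?_, ?_, ?_⟩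
        · rw [hR]
          intro l hl
          simp only [Finset.mem_union, Finset.mem_insert, Finset.mem_erase] at hl ⊢
          tauto
        · rw [hR]
          intro l hl
          simp only [Finset.mem_union, Finset.mem_insert, Finset.mem_erase] at hl ⊢
          tauto
        · rintro ⟨s, hs, hsv⟩
          have := hv s (by omega) t (by omega) hsv
          omega
        · rintro ⟨s, hs, hsv⟩
          have := hv s (by omega) t (by omega) hsv
          omega
        · rintro x ⟨s, hs, hsv⟩
          exact ⟨s, by omega, hsv⟩
        · rintro x ⟨s, hs, hsv⟩
          exact ⟨s, by omega, hsv⟩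
        · exact ⟨t, by omega, rfl⟩
  · rw [← Nat.card_eq_fintype_card, ← Set.ncard_coe_finset X]
    exact Set.ncard_le_ncard hX X.finite_toSet
  · simp
  · rintro x ⟨s, hs, hsv⟩
    exact ⟨s, hs.trans_le (ht_le _), hsv⟩

end Derivations

/-! ### Elimination along a path decomposition -/

theorem exists_enumeration_by_key {V : Type} [Nonempty V] (U : Finset V) (key : V → ℕ) :
    ∃ (N : ℕ) (v : ℕ → V), (∀ s < N, ∀ t < N, v s = v t → s = t) ∧
      (∀ u, u ∈ U ↔ ∃ s < N, v s = u) ∧ ∀ s t, s ≤ t → t < N → key (v s) ≤ key (v t) := by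
  classical
  let r : V → V → Prop := fun a b => key a ≤ key b
  have : Std.Total r := ⟨fun a b => le_total _ _⟩
  have : IsTrans V r := ⟨fun a b c => le_trans⟩
  let l := U.toList.insertionSort r
  have hp : l.Perm U.toList := List.perm_insertionSort r _
  have hs : l.Pairwise r := List.pairwise_insertionSort r _
  have hn : l.Nodup := hp.nodup_iff.2 U.nodup_toList
  refine ⟨l.length, fun t => l.getD t (Classical.arbitrary V), ?_, ?_, ?_⟩
  · intro s hs t ht h
    simp only [List.getD_eq_getElem _ _ hs, List.getD_eq_getElem _ _ ht] at h
    exact (hn.getElem_inj_iff).1 h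
  · intro u
    rw [← Finset.mem_toList, ← hp.mem_iff, List.mem_iff_getElem]
    constructor
    · rintro ⟨s, hs, h⟩
      exact ⟨s, hs, (List.getD_eq_getElem _ _ hs).trans h⟩
    · rintro ⟨s, hs, h⟩
      exact ⟨s, hs, (List.getD_eq_getElem _ _ hs).symm.trans h⟩
  · intro s t hst ht
    rcases hst.eq_or_lt with rfl | hst
    · exact le_rfl
    · simp only [List.getD_eq_getElem _ _ ht, List.getD_eq_getElem _ _ (hst.trans ht)]
      exact List.pairwise_iff_getElem.1 hs s t _ _ hst

section Derivations

variable {V : Type} [DecidableEq V] {φ : Set (Clause V)}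

/-- A set of clauses that has a path decomposition (the bag at time `t` consists of the variables
`u ∈ U` with `Alive t u`) and that is unsatisfiable once the literals of `K` are false, derives a
subclause of `K`. -/
theorem derives_of_pathDecomposition {K : Clause V} {Φ : Set (Clause V)} (hΦ : Φ ⊆ φ)
    {U : Finset V} {Alive : ℕ → V → Prop} {T w : ℕ}
    (hK : ∃ τ, Falsifies τ K)
    (hbag : ∀ C ∈ Φ, ∃ t ≤ T, ∀ l ∈ C, l.1 ∈ clauseVars K ∨ (l.1 ∈ U ∧ Alive t l.1))
    (hconv : ∀ u ∈ U, ∀ r s t, r ≤ s → s ≤ t → Alive r u → Alive t u → Alive s u)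
    (hcard : ∀ t ≤ T, ∃ B : Finset V, B.card ≤ w ∧ ∀ u ∈ U, Alive t u → u ∈ B)
    (hunsat : ∀ τ, Falsifies τ K → ∃ C ∈ Φ, Falsifies τ C) :
    Derives φ U ((T + 1) * 4 ^ w) K := by
  classical
  rcases isEmpty_or_nonempty V with hV | hV
  · obtain ⟨C, hC, -⟩ := hunsat (fun _ => false) fun l => (hV.false l.1).elim
    refine (Derives.input (hΦ hC)).mono (Set.empty_subset _) (Nat.mul_pos (by omega) (by positivity))
      fun l => (hV.false l.1).elim
  -- Variables are eliminated in the order of the last bag that contains them.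
  let last : V → ℕ := fun u => Nat.findGreatest (fun t => Alive t u) T
  obtain ⟨N, v, hinj, hmem, hkey⟩ := exists_enumeration_by_key U last
  -- The restriction of `Φ` by the assignment that falsifies `K`: satisfied clauses are dropped and
  -- the literals of `K` are removed. They are put back after the elimination.
  let S : Set (Clause V) := {C | ∃ C' ∈ Φ, C = C'.filter (fun l => l.1 ∉ clauseVars K) ∧
    ∀ l ∈ C', l.1 ∈ clauseVars K → l ∈ K}
  have inv : ∀ t ≤ N, ∀ C ∈ elimination S v t, ∃ r ≤ T, ∀ l ∈ C, l.1 ∈ U ∧ Alive r l.1 := by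
    intro t
    induction t with
    | zero =>
      rintro - C ⟨C', hC', rfl, -⟩
      obtain ⟨r, hr, h⟩ := hbag C' hC'
      refine ⟨r, hr, fun l hl => ?_⟩
      rw [Finset.mem_filter] at hl
      exact (h l hl.1).resolve_left hl.2
    | succ t ih =>
      rintro ht C (hC | ⟨D, hD, E, hE, hDf, hEf, hD1, hE1, rfl, -⟩)
      · exact ih (by omega) C hC
      · have key : ∀ D ∈ elimination S v t, (∀ s < t, v s ∉ clauseVars D) → ∀ b, (v t, b) ∈ D →
            ∀ l ∈ D, l.1 ∈ U ∧ Alive (last (v t)) l.1 := by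
          intro D hD hf b hb l hl
          obtain ⟨r, hr, h⟩ := ih (by omega) D hD
          refine ⟨(h l hl).1, hconv _ (h l hl).1 r _ (last l.1)
            (Nat.le_findGreatest hr (h _ hb).2) ?_ (h l hl).2
            (Nat.findGreatest_spec (P := fun t => Alive t l.1) hr (h l hl).2)⟩
          obtain ⟨s, hs, hsl⟩ := (hmem _).1 (h l hl).1
          rw [← hsl]
          refine hkey t s (not_lt.1 fun hst => hf s hst ?_) hs
          rw [hsl]
          exact fst_mem_clauseVars hl
        refine ⟨last (v t), Nat.findGreatest_le _, fun l hl => ?_⟩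
        rcases Finset.mem_union.1 hl with hl | hl
        · exact key D hD hDf _ hD1 l (Finset.mem_of_mem_erase hl)
        · exact key E hE hEf _ hE1 l (Finset.mem_of_mem_erase hl)
  let X : Finset (Clause V) := (Finset.range (T + 1)).biUnion fun t =>
    ((U.filter (Alive t)) ×ˢ (Finset.univ : Finset Bool)).powerset
  have hX : elimination S v N ⊆ X := by
    intro C hC
    obtain ⟨r, hr, h⟩ := inv N le_rfl C hC
    simp only [X, Finset.mem_coe, Finset.mem_biUnion, Finset.mem_range, Finset.mem_powerset]
    refine ⟨r, by omega, fun l hl => ?_⟩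
    simpa using h l hl
  have hXc : X.card ≤ (T + 1) * 4 ^ w := by
    refine (Finset.card_biUnion_le_card_mul _ _ (4 ^ w) fun t ht => ?_).trans
      (by rw [Finset.card_range])
    -- A bag of `w` variables has `2 * w` literals, hence `4 ^ w` sets of literals.
    rw [Finset.card_powerset, Finset.card_product, Finset.card_univ, Fintype.card_bool, mul_comm,
      pow_mul]
    obtain ⟨B, hB, hBU⟩ := hcard t (Nat.lt_succ_iff.1 (Finset.mem_range.1 ht))
    refine Nat.pow_le_pow_right (by norm_num) ((Finset.card_le_card fun u hu => ?_).trans hB)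
    rw [Finset.mem_filter] at hu
    exact hBU u hu.1 hu.2
  have he : ∅ ∈ elimination S v N := by
    by_contra he
    obtain ⟨τ, hτ⟩ := exists_satisfying_of_empty_notMem_elimination (fun C hC x hx => by
      obtain ⟨r, hr, h⟩ := inv N le_rfl C hC
      obtain ⟨l, hl, rfl⟩ := mem_clauseVars.1 hx
      exact (hmem _).1 (h l hl).1) he
    obtain ⟨τK, hτK⟩ := hK
    -- An assignment satisfying the restricted clauses is overwritten on the variables of `K` so as
    -- to falsify `K`. The clause of `Φ` that it violates then survives the restriction.
    obtain ⟨C, hC, hf⟩ := hunsat (fun x => if x ∈ clauseVars K then τK x else τ x) fun l hl => by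
      simpa [fst_mem_clauseVars hl] using hτK l hl
    refine hτ _ ⟨C, hC, rfl, ?_⟩ ?_
    · intro l hl hx
      obtain ⟨l', hl', he⟩ := mem_clauseVars.1 hx
      have h1 := hf l hl
      have h2 := hτK l' hl'
      simp only [hx, if_true] at h1
      rw [he] at h2
      have : l = l' := Prod.ext he.symm (by
        rw [Bool.eq_not.2 h1.symm, Bool.eq_not.2 h2.symm])
      exact this ▸ hl'
    · intro l hl
      rw [Finset.mem_filter] at hl
      simpa [hl.2] using hf l hl.1
  refine (derives_of_elimination hinj ?_ hX he).mono ?_ hXc subset_rfl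
  · rintro C ⟨C', hC', rfl, h⟩
    refine ⟨C', hΦ hC', fun l hl => ?_⟩
    by_cases hlK : l.1 ∈ clauseVars K
    · exact Finset.mem_union_right _ (h l hl hlK)
    · exact Finset.mem_union_left _ (Finset.mem_filter.2 ⟨hl, hlK⟩)
  · exact fun x hx => (hmem x).2 hx

/-! ### Unit propagation -/

/-- This is the case of a single bag, consisting of the variables of the constraint. -/
theorem derives_of_constraint {g : Constraint V} (hg : g.clauses ⊆ φ) {K : Clause V}
    (hK : ∃ τ, Falsifies τ K) (h : ∀ τ, Falsifies τ K → ¬ g.holds τ) :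
    Derives φ (g.vars \ clauseVars K : Finset V) (4 ^ g.vars.card) K := by
  have := derives_of_pathDecomposition (T := 0) (w := g.vars.card) hg
    (U := g.vars \ clauseVars K) (Alive := fun _ _ => True) hK ?_ (by simp) ?_ ?_
  · simpa using this
  · rintro C ⟨σ, -, rfl⟩
    refine ⟨0, le_rfl, fun l hl => ?_⟩
    obtain ⟨v, hv, rfl⟩ := Finset.mem_image.1 hl
    by_cases hvK : v ∈ clauseVars K <;> simp [hvK, hv]
  · exact fun t _ => ⟨g.vars, le_rfl, fun u hu _ => (Finset.mem_sdiff.1 hu).1⟩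
  · intro τ hτ
    refine ⟨_, ⟨τ, h τ hτ, rfl⟩, fun l hl => ?_⟩
    obtain ⟨v, hv, rfl⟩ := Finset.mem_image.1 hl
    simp

/-- Setting the literals of `K` to false does not contradict any single constraint in `𝒢` and does
not force the value of any further variable. -/
structure UnitClosed (𝒢 : Set (Constraint V)) (K : Clause V) : Prop where
  exists_holds : ∀ g ∈ 𝒢, ∃ τ, Falsifies τ K ∧ g.holds τ
  mem_of_forced : ∀ g ∈ 𝒢, ∀ x ∈ g.vars, ∀ b,
    (∀ τ, Falsifies τ K → g.holds τ → τ x = b) → x ∈ clauseVars K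

theorem falsifies_insert_update {K : Clause V} {τ : V → Bool} (h : Falsifies τ K) {x : V}
    (hx : x ∉ clauseVars K) (b : Bool) :
    Falsifies (Function.update τ x (!b)) (insert (x, b) K) := by
  intro l hl
  rcases Finset.mem_insert.1 hl with rfl | hl
  · simp
  · rw [Function.update_of_ne (fun he => hx (by rw [← he]; exact fst_mem_clauseVars hl))]
    exact h l hl

theorem clauseVars_insert (x : V) (b : Bool) (K : Clause V) :
    clauseVars (insert (x, b) K) = insert x (clauseVars K) := by
  simp [clauseVars]

/-- It suffices to derive a clause after unit propagation. -/
theorem derives_of_forall_unitClosed {𝒢 : Set (Constraint V)} {W : Finset V} {w s : ℕ}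
    (hφ : ∀ g ∈ 𝒢, g.clauses ⊆ φ) (hW : ∀ g ∈ 𝒢, g.vars ⊆ W) (hc : ∀ g ∈ 𝒢, g.vars.card ≤ w)
    {F : Clause V}
    (h : ∀ K, clauseVars K ⊆ W → (∃ τ, Falsifies τ K) → UnitClosed 𝒢 K →
      Derives φ (W \ clauseVars K : Finset V) s (K ∪ F)) :
    Derives φ W (s + (W.card + 1) * (4 ^ w + 1)) F := by
  suffices key : ∀ N K, (W \ clauseVars K).card = N → clauseVars K ⊆ W → (∃ τ, Falsifies τ K) →
      Derives φ (W \ clauseVars K : Finset V) (s + (N + 1) * (4 ^ w + 1)) (K ∪ F) by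
    simpa [clauseVars] using key W.card ∅ (by simp [clauseVars]) (by simp [clauseVars])
      ⟨fun _ => false, by simp [Falsifies]⟩
  intro N
  induction N using Nat.strong_induction_on with
  | _ N ih =>
    intro K hN hKW hK
    have hmul : 4 ^ w + 1 ≤ (N + 1) * (4 ^ w + 1) := Nat.le_mul_of_pos_left _ (by omega)
    have hpow : ∀ g ∈ 𝒢, 4 ^ g.vars.card ≤ 4 ^ w := fun g hg =>
      Nat.pow_le_pow_right (by norm_num) (hc g hg)
    have hsub : ∀ g ∈ 𝒢, ∀ K : Clause V, ((g.vars \ clauseVars K : Finset V) : Set V) ⊆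
        (W \ clauseVars K : Finset V) := fun g hg K => by
      exact_mod_cast Finset.sdiff_subset_sdiff (hW g hg) subset_rfl
    by_cases hcl : UnitClosed 𝒢 K
    · exact (h K hKW hK hcl).mono subset_rfl (by omega) subset_rfl
    by_cases hcon : ∀ g ∈ 𝒢, ∃ τ, Falsifies τ K ∧ g.holds τ
    · have hfor : ∃ g ∈ 𝒢, ∃ x ∈ g.vars, ∃ b, (∀ τ, Falsifies τ K → g.holds τ → τ x = b) ∧
          x ∉ clauseVars K := by
        by_contra hno
        push Not at hno
        exact hcl ⟨hcon, fun g hg x hx b hb => hno g hg x hx b hb⟩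
      obtain ⟨g, hg, x, hx, b, hb, hxK⟩ := hfor
      obtain ⟨τ, hτ⟩ := hK
      have hxW : x ∈ W \ clauseVars K := Finset.mem_sdiff.2 ⟨hW g hg hx, hxK⟩
      have hd : ∀ b', W \ clauseVars (insert (x, b') K) = (W \ clauseVars K).erase x := by
        intro b'
        rw [clauseVars_insert, Finset.sdiff_insert]
      have hN1 : ∀ b', (W \ clauseVars (insert (x, b') K)).card = N - 1 := by
        intro b'
        rw [hd, Finset.card_erase_of_mem hxW, hN]
      have hN0 : 0 < N := hN ▸ Finset.card_pos.2 ⟨x, hxW⟩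
      -- Falsifying `(x, !b)` sets `x` to its forced value, and the propagation goes on. Falsifying
      -- `(x, b)` contradicts the one constraint that forces `x`. Resolving on `x` merges the two
      -- branches at the cost of one small derivation, and `x` is fresh because it was removed from
      -- the remaining variables.
      have d1 := ih (N - 1) (by omega) (insert (x, !b) K) (hN1 _) (by
        rw [clauseVars_insert]
        exact Finset.insert_subset (hW g hg hx) hKW) ⟨_, falsifies_insert_update hτ hxK (!b)⟩
      have d2 := derives_of_constraint (hφ g hg) ⟨_, falsifies_insert_update hτ hxK b⟩
        fun σ hσ hgσ => hσ (x, b) (Finset.mem_insert_self _ _)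
          (hb σ (fun l hl => hσ l (Finset.mem_insert_of_mem hl)) hgσ)
      have d2' : Derives φ (W \ clauseVars (insert (x, b) K) : Finset V) (4 ^ w)
          (insert (x, b) (K ∪ F)) := d2.mono (hsub g hg _) (hpow g hg)
            (Finset.insert_subset_insert _ Finset.subset_union_left)
      rw [Finset.insert_union] at d1
      rw [hd] at d1 d2'
      have hsize : s + (N - 1 + 1) * (4 ^ w + 1) + 4 ^ w + 1 ≤ s + (N + 1) * (4 ^ w + 1) := by
        rw [Nat.sub_add_cancel hN0, Nat.succ_mul]; omega
      have hhist : insert x (((W \ clauseVars K).erase x : Set V) ∪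
          ((W \ clauseVars K).erase x : Finset V)) ⊆ (W \ clauseVars K : Finset V) := by
        rw [Set.union_self]
        exact_mod_cast (Finset.insert_erase hxW).subset
      cases b
      · exact (Derives.resolve x d1 d2' (by simp) (by simp)).mono hhist hsize subset_rfl
      · exact (Derives.resolve x d2' d1 (by simp) (by simp)).mono hhist (by omega) subset_rfl
    · push Not at hcon
      obtain ⟨g, hg, hcon⟩ := hcon
      exact (derives_of_constraint (hφ g hg) hK hcon).mono (hsub g hg K)
        ((hpow g hg).trans (by omega)) Finset.subset_union_left

/-- If the variables `e 0, …, e (m - 1)` cannot have a first one that is true, then they cannot be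
true at all. -/
theorem derives_empty_of_forall_first {e : ℕ → V} (hinj : Function.Injective e) {m s : ℕ}
    {H : Set V} (heH : ∀ i, e i ∉ H) (hsome : (Finset.range m).image (fun i => (e i, true)) ∈ φ)
    (h : ∀ k < m, Derives φ H s
      (insert (e k, false) ((Finset.range k).image fun i => (e i, true)))) :
    Derives φ Set.univ (m * (s + 1) + 1) ∅ := by
  -- The initial disjunction is shortened from the top: the clauses for `k = m - 1, m - 2, …` remove
  -- `e k` in turn. The comparison variables are thus resolved below all variables of `H`, each
  -- once.
  suffices key : ∀ j ≤ m, Derives φ (H ∪ {x | ∃ i, m - j ≤ i ∧ e i = x}) (j * (s + 1) + 1)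
      ((Finset.range (m - j)).image fun i => (e i, true)) by
    simpa using (key m le_rfl).mono (Set.subset_univ _) le_rfl subset_rfl
  intro j
  induction j with
  | zero => exact fun _ => (Derives.input hsome).mono (Set.empty_subset _) (by simp) (by simp)
  | succ j ih =>
    intro hj
    have h1 := ih (by omega)
    have hm : m - j = m - (j + 1) + 1 := by omega
    refine (Derives.resolve (e (m - (j + 1))) (h1.mono subset_rfl le_rfl ?_)
      (h (m - (j + 1)) (by omega)) ?_ (heH _)).mono ?_ ?_ subset_rfl
    · rw [hm, Finset.range_add_one, Finset.image_insert]
    · rintro (h2 | ⟨i, hi, h2⟩)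
      · exact heH _ h2
      · have := hinj h2
        omega
    · rintro x (rfl | (hx | ⟨i, hi, rfl⟩) | hx)
      · exact Or.inr ⟨_, le_rfl, rfl⟩
      · exact Or.inl hx
      · exact Or.inr ⟨i, by omega, rfl⟩
      · exact Or.inl hx
    · rw [Nat.succ_mul]; omega

end Derivations

open Finset

/-! ### Column sums of adders and multipliers -/

/-- The carries that come into a column, from the carries `C` that leave the columns. -/
def carriesIn (C : ℕ → ℕ) : ℕ → ℕ
  | 0 => 0
  | K + 1 => C K

/-- The part of the number with digits `x` in the columns `a, …, k`. -/
def strip (a k : ℕ) (x : ℕ → ℕ) : ℕ := ∑ K ∈ Ico a (k + 1), 2 ^ K * x K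

/-- The digits of the product of two numbers, before carrying. -/
def conv (x y : ℕ → ℕ) (K : ℕ) : ℕ := ∑ j ∈ range (K + 1), x (K - j) * y j

/-- Multiplying the equation of column `K` by `2 ^ K` and adding up, the carries telescope. Only
those entering at `a` and leaving at `k` remain. -/
theorem strip_columns {T C o : ℕ → ℕ} {a k : ℕ} (hak : a ≤ k)
    (h : ∀ K, a ≤ K → K ≤ k → T K + carriesIn C K = 2 * C K + o K) :
    strip a k T + 2 ^ a * carriesIn C a = 2 ^ (k + 1) * C k + strip a k o := by
  induction k, hak using Nat.le_induction with
  | base =>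
    have := h a le_rfl le_rfl
    simp only [strip, Nat.Ico_succ_singleton, sum_singleton]
    rw [← mul_add, this]; ring
  | succ k hak ih =>
    have h1 := ih fun K h1 h2 => h K h1 (by omega)
    have h2 := h (k + 1) (by omega) le_rfl
    simp only [carriesIn] at h2
    have hs : ∀ u, strip a (k + 1) u = strip a k u + 2 ^ (k + 1) * u (k + 1) :=
      fun u => sum_Ico_succ_top (by omega) _
    rw [hs, hs, pow_succ 2 (k + 1)]
    linear_combination h1 + 2 ^ (k + 1) * h2

theorem conv_comm (x y : ℕ → ℕ) : conv x y = conv y x := by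
  funext K
  unfold conv
  rw [← sum_flip]
  refine sum_congr rfl fun j hj => ?_
  have : j ≤ K := by simpa [Nat.lt_succ_iff] using hj
  rw [Nat.sub_sub_self this, mul_comm]

/-- The two sides differ by the products of digits with `i + j > k`, each of which has a weight
divisible by `2 ^ (k + 1)`. -/
theorem strip_zero_conv (x y : ℕ → ℕ) (k : ℕ) :
    ∃ q, strip 0 k x * strip 0 k y = strip 0 k (conv x y) + 2 ^ (k + 1) * q := by
  have h1 : strip 0 k (conv x y) = ∑ j ∈ range (k + 1), ∑ i ∈ range (k + 1 - j),
      2 ^ (i + j) * (x i * y j) := by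
    rw [← sum_range_diag_flip (k + 1) fun j i => 2 ^ (i + j) * (x i * y j)]
    simp only [strip, conv, Nat.Ico_zero_eq_range, mul_sum]
    refine sum_congr rfl fun K _ => sum_congr rfl fun j hj => ?_
    rw [Nat.sub_add_cancel (by simpa [Nat.lt_succ_iff] using hj)]
  have h2 : strip 0 k x * strip 0 k y = ∑ j ∈ range (k + 1), ∑ i ∈ range (k + 1),
      2 ^ (i + j) * (x i * y j) := by
    simp only [strip, Nat.Ico_zero_eq_range]
    rw [sum_mul_sum, sum_comm]
    refine sum_congr rfl fun K _ => sum_congr rfl fun j hj => ?_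
    ring
  have h3 : ∀ j ∈ range (k + 1), 2 ^ (k + 1) ∣
      ∑ i ∈ Ico (k + 1 - j) (k + 1), 2 ^ (i + j) * (x i * y j) := fun j _ =>
    dvd_sum fun i hi => Dvd.dvd.mul_right (pow_dvd_pow 2 (by have := mem_Ico.1 hi; omega)) _
  obtain ⟨q, hq⟩ := dvd_sum h3
  refine ⟨q, ?_⟩
  rw [← hq, h1, h2, ← sum_add_distrib]
  refine sum_congr rfl fun j _ => ?_
  rw [sum_range_add_sum_Ico _ (by omega)]

theorem sum_low_digits_le {x : ℕ → ℕ} (hx : ∀ i, x i ≤ 1) (a : ℕ) :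
    ∑ i ∈ range a, 2 ^ i * x i ≤ a * 2 ^ a := by
  have := sum_le_card_nsmul (range a) (fun i => 2 ^ i * x i) (2 ^ a) fun i hi => by
    refine (Nat.mul_le_mul_left (2 ^ i) (hx i)).trans ?_
    rw [mul_one]
    exact Nat.pow_le_pow_right (by norm_num) (mem_range.1 hi).le
  simpa using this

theorem conv_le {x y : ℕ → ℕ} (hx : ∀ i, x i ≤ 1) (hy : ∀ i, y i ≤ 1) (K : ℕ) :
    conv x y K ≤ K + 1 := by
  have := sum_le_card_nsmul (range (K + 1)) (fun j => x (K - j) * y j) 1 fun j _ => by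
    simpa using Nat.mul_le_mul (hx (K - j)) (hy j)
  simpa [conv] using this

theorem sum_low_conv_le {x y : ℕ → ℕ} (hx : ∀ i, x i ≤ 1) (hy : ∀ i, y i ≤ 1) (a : ℕ) :
    ∑ i ∈ range a, 2 ^ i * conv x y i ≤ a * 2 ^ a := by
  calc ∑ i ∈ range a, 2 ^ i * conv x y i ≤ ∑ i ∈ range a, 2 ^ i * a :=
        sum_le_sum fun i hi => Nat.mul_le_mul_left _
          ((conv_le hx hy i).trans (mem_range.1 hi))
    _ = (∑ i ∈ range a, 2 ^ i) * a := by rw [sum_mul]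
    _ ≤ 2 ^ a * a := Nat.mul_le_mul_right _ (Nat.geomSum_lt (m := 2) le_rfl (by simp)).le
    _ = a * 2 ^ a := mul_comm _ _

theorem sum_low_add_strip {a k : ℕ} (hak : a ≤ k) (x : ℕ → ℕ) :
    ∑ i ∈ range a, 2 ^ i * x i + strip a k x = strip 0 k x := by
  unfold strip
  rw [Nat.Ico_zero_eq_range, sum_range_add_sum_Ico _ (by omega)]

theorem strip_add (a k : ℕ) (x y : ℕ → ℕ) :
    strip a k (fun i => x i + y i) = strip a k x + strip a k y := by
  simp [strip, mul_add, sum_add_distrib]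

/-! ### Approximation modulo a power of two -/

/-- The number `v` agrees with `z` modulo `2 ^ (k + 1)`, up to an error of at most `C a 2 ^ a`. -/
def Approx (a k C v : ℕ) (z : ZMod (2 ^ (k + 1))) : Prop :=
  ∃ e : ℤ, |e| ≤ C * (a * 2 ^ a) ∧ (v : ZMod (2 ^ (k + 1))) = z + e

theorem natCast_two_pow_mul (k q : ℕ) : ((2 ^ (k + 1) * q : ℕ) : ZMod (2 ^ (k + 1))) = 0 := by
  rw [Nat.cast_mul, ZMod.natCast_self, zero_mul]

theorem strip_zero_columns {T C o : ℕ → ℕ} {k : ℕ}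
    (h : ∀ K ≤ k, T K + carriesIn C K = 2 * C K + o K) :
    (strip 0 k o : ZMod (2 ^ (k + 1))) = strip 0 k T := by
  have := strip_columns (Nat.zero_le k) fun K _ => h K
  simp only [carriesIn, mul_zero, add_zero] at this
  rw [this, Nat.cast_add, natCast_two_pow_mul, zero_add]

theorem natCast_strip_zero_conv (x y : ℕ → ℕ) (k : ℕ) :
    (strip 0 k (conv x y) : ZMod (2 ^ (k + 1))) = strip 0 k x * strip 0 k y := by
  obtain ⟨q, hq⟩ := strip_zero_conv x y k
  rw [← Nat.cast_mul, hq, Nat.cast_add, natCast_two_pow_mul, add_zero]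

theorem Approx.mono {a k C C' v : ℕ} {z : ZMod (2 ^ (k + 1))} (h : Approx a k C v z)
    (hC : C ≤ C') : Approx a k C' v z := by
  obtain ⟨e, he, hv⟩ := h
  exact ⟨e, he.trans (by gcongr), hv⟩

/-- Carries leaving column `k` vanish modulo `2 ^ (k + 1)`. The at most `a` carries entering column
`a` have weight `2 ^ a` each, which adds one unit `a * 2 ^ a` of error. -/
theorem Approx.columns {T C o : ℕ → ℕ} {a k B : ℕ} {z : ZMod (2 ^ (k + 1))} (hak : a ≤ k)
    (h : ∀ K, a ≤ K → K ≤ k → T K + carriesIn C K = 2 * C K + o K) (hC : carriesIn C a ≤ a)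
    (hT : Approx a k B (strip a k T) z) : Approx a k (B + 1) (strip a k o) z := by
  obtain ⟨e, he, hv⟩ := hT
  have h1 := congrArg (Nat.cast : ℕ → ZMod (2 ^ (k + 1))) (strip_columns hak h)
  rw [Nat.cast_add, Nat.cast_add, natCast_two_pow_mul, zero_add, hv] at h1
  refine ⟨e + (2 ^ a * carriesIn C a : ℕ), ?_, ?_⟩
  · refine (abs_add_le _ _).trans ?_
    rw [Nat.abs_cast]
    have : ((2 ^ a * carriesIn C a : ℕ) : ℤ) ≤ a * 2 ^ a := by
      rw [mul_comm (a : ℤ)]; exact_mod_cast Nat.mul_le_mul_left _ hC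
    push_cast at this ⊢
    linarith
  · rw [← h1]; push_cast; ring

/-- The error is exactly the part in the columns below `a`, which is dropped. -/
theorem Approx.of_exact {x : ℕ → ℕ} {a k : ℕ} {z : ZMod (2 ^ (k + 1))} (hak : a ≤ k)
    (hx : ∑ i ∈ range a, 2 ^ i * x i ≤ a * 2 ^ a) (h : (strip 0 k x : ZMod (2 ^ (k + 1))) = z) :
    Approx a k 1 (strip a k x) z := by
  refine ⟨-(∑ i ∈ range a, 2 ^ i * x i : ℕ), ?_, ?_⟩
  · rw [abs_neg, Nat.abs_cast, Nat.cast_one, one_mul]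
    exact_mod_cast hx
  · rw [← h, ← sum_low_add_strip hak]; push_cast; ring

theorem Approx.add {a k A B v v' : ℕ} {z z' : ZMod (2 ^ (k + 1))} (h : Approx a k A v z)
    (h' : Approx a k B v' z') : Approx a k (A + B) (v + v') (z + z') := by
  obtain ⟨e, he, hv⟩ := h
  obtain ⟨e', he', hv'⟩ := h'
  refine ⟨e + e', (abs_add_le _ _).trans ?_, ?_⟩
  · push_cast; linarith
  · push_cast; rw [hv, hv']; ring

/-- Multiplication by a number of at most `2 ^ c` scales the error of `y` by that number. The digits
of `y` below `a` can be shifted into the strip by the multiplication; this accounts for the extra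
`1` in `B + 1`. -/
theorem Approx.conv_const {x y : ℕ → ℕ} {a k c B : ℕ} {z z' : ZMod (2 ^ (k + 1))} (hak : a ≤ k)
    (hy : ∀ i, y i ≤ 1) (hxc : strip 0 k x ≤ 2 ^ c)
    (hx : (strip 0 k x : ZMod (2 ^ (k + 1))) = z) (h : Approx a k B (strip a k y) z') :
    Approx a k (2 ^ c * (B + 1)) (strip a k (conv x y)) (z * z') := by
  obtain ⟨e, he, hv⟩ := h
  -- The product with the high digits has no digits below column `a`, so cutting at `a` loses
  -- nothing and the exact product formula applies. The product with the low digits goes entirely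
  -- into the error.
  let lo : ℕ → ℕ := fun i => if i < a then y i else 0
  let hi : ℕ → ℕ := fun i => if i < a then 0 else y i
  have hlohi : conv x y = fun K => conv x lo K + conv x hi K := by
    funext K
    simp only [conv, ← sum_add_distrib, ← mul_add]
    refine sum_congr rfl fun j _ => ?_
    by_cases hj : j < a <;> simp [lo, hi, hj]
  have hhi : strip a k (conv x hi) = strip 0 k (conv x hi) := by
    rw [← sum_low_add_strip hak (conv x hi), sum_eq_zero, zero_add]
    intro K hK
    have : conv x hi K = 0 := sum_eq_zero fun j hj => by
      have h1 := mem_range.1 hK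
      have h2 := mem_range.1 hj
      have : j < a := by omega
      simp [hi, this]
    rw [this, mul_zero]
  have hhi' : strip 0 k hi = strip a k y := by
    rw [← sum_low_add_strip hak hi, sum_eq_zero, zero_add]
    · refine sum_congr rfl fun i hi' => ?_
      have := (mem_Ico.1 hi').1
      simp [hi, this]
    · intro i hi'
      have := mem_range.1 hi'
      simp [hi, this]
  have hlo : strip a k (conv x lo) ≤ 2 ^ c * (a * 2 ^ a) := by
    obtain ⟨q, hq⟩ := strip_zero_conv x lo k
    have h1 := sum_low_add_strip hak (conv x lo)
    have h2 : strip 0 k lo ≤ a * 2 ^ a := by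
      have h3 := sum_low_digits_le hy a
      rw [← sum_low_add_strip hak lo]
      have h4 : strip a k lo = 0 := sum_eq_zero fun i hi' => by
        have := (mem_Ico.1 hi').1
        simp [lo, this]
      have h5 : ∑ i ∈ range a, 2 ^ i * lo i = ∑ i ∈ range a, 2 ^ i * y i :=
        sum_congr rfl fun i hi' => by simp [lo, mem_range.1 hi']
      omega
    have h6 := Nat.mul_le_mul hxc h2
    omega
  refine ⟨(strip 0 k x : ℤ) * e + (strip a k (conv x lo) : ℕ), ?_, ?_⟩
  · refine (abs_add_le _ _).trans ?_
    rw [abs_mul, Nat.abs_cast, Nat.abs_cast]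
    have h1 : (strip 0 k x : ℤ) * |e| ≤ 2 ^ c * (B * (a * 2 ^ a)) :=
      mul_le_mul (by exact_mod_cast hxc) he (abs_nonneg _) (by positivity)
    have h2 : (strip a k (conv x lo) : ℤ) ≤ 2 ^ c * (a * 2 ^ a) := by exact_mod_cast hlo
    push_cast
    linarith
  · rw [hlohi, strip_add, hhi]
    push_cast
    rw [natCast_strip_zero_conv, hhi', hv, hx]
    ring

/-- Two numbers that differ exactly in bit `k` of the columns `a, …, k` do not approximate the same
number well. -/
theorem not_approx_of_differ {x y : ℕ → ℕ} {a k A B : ℕ} {z : ZMod (2 ^ (k + 1))} (hak : a ≤ k)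
    (hlow : ∀ i, a ≤ i → i < k → x i = y i) (hk : x k = y k + 1 ∨ y k = x k + 1)
    (hbound : (A + B) * (a * 2 ^ a) < 2 ^ k) (hx : Approx a k A (strip a k x) z)
    (hy : Approx a k B (strip a k y) z) : False := by
  obtain ⟨e, he, hv⟩ := hx
  obtain ⟨e', he', hv'⟩ := hy
  have hsplit : ∀ u : ℕ → ℕ, strip a k u = ∑ i ∈ Ico a k, 2 ^ i * u i + 2 ^ k * u k :=
    fun u => sum_Ico_succ_top hak _
  have hsum : ∑ i ∈ Ico a k, 2 ^ i * x i = ∑ i ∈ Ico a k, 2 ^ i * y i :=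
    sum_congr rfl fun i hi => by rw [hlow i (mem_Ico.1 hi).1 (mem_Ico.1 hi).2]
  have hb : (A + B : ℤ) * (a * 2 ^ a) < 2 ^ k := by exact_mod_cast hbound
  -- The strips differ by `2 ^ k` or its negative, and the errors by less than `2 ^ k`. So this
  -- multiple of `2 ^ (k + 1)` is smaller than the modulus and must be zero, which the sizes forbid.
  have hdvd : ((2 ^ (k + 1) : ℕ) : ℤ) ∣ ((strip a k x : ℤ) - strip a k y) - (e - e') := by
    rw [← ZMod.intCast_zmod_eq_zero_iff_dvd]
    push_cast
    rw [hv, hv']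
    ring
  have hd : (strip a k x : ℤ) - strip a k y = 2 ^ k ∨
      (strip a k x : ℤ) - strip a k y = -2 ^ k := by
    rw [hsplit, hsplit, hsum]
    rcases hk with h | h <;> rw [h] <;> push_cast
    · left; ring
    · right; ring
  have hee : |e - e'| < 2 ^ k := (abs_sub _ _).trans_lt (by linarith)
  rw [abs_lt] at hee
  have hpow : ((2 ^ (k + 1) : ℕ) : ℤ) = 2 * 2 ^ k := by push_cast; ring
  rw [hpow] at hdvd
  have hz := Int.eq_zero_of_abs_lt_dvd hdvd (by rcases hd with h | h <;> rw [h, abs_lt] <;>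
    constructor <;> linarith)
  rcases hd with h | h <;> rw [h] at hz <;> linarith

/-! ### Column equations of the circuits -/

/-- The digits of a bit-vector under an assignment. -/
def BitVector.digits (τ : BVar → Bool) (x : BitVector) (i : ℕ) : ℕ := ((x.bit i).val τ).toNat

theorem BitVector.digits_le_one (τ : BVar → Bool) (x : BitVector) (i : ℕ) : x.digits τ i ≤ 1 :=
  Bool.toNat_le _

theorem adder_sum {τ : BVar → Bool} {a₀ a₁ a₂ : Signal} {c d : BVar}
    (h : ∀ g ∈ adder a₀ a₁ a₂ c d, g.holds τ) :
    (a₀.val τ).toNat + (a₁.val τ).toNat + (a₂.val τ).toNat = 2 * (τ c).toNat + (τ d).toNat := by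
  have h1 : τ c = _ := h _ (Or.inl rfl)
  have h2 : τ d = _ := h _ (Or.inr rfl)
  rw [h1, h2]
  cases a₀.val τ <;> cases a₁.val τ <;> cases a₂.val τ <;> rfl

/-- The carry that leaves column `i` of a ripple-carry adder. -/
def rippleCarries (τ : BVar → Bool) (p : Addr) (w i : ℕ) : ℕ :=
  if i < w then (τ (.rcarry p i)).toNat else 0

/-- The carry out of column `w` vanishes because both operands have only zeros there, so
`rippleCarries` may omit it. This makes the equation valid in every column, also beyond the circuit.
-/
theorem ripple_column {τ : BVar → Bool} {p : Addr} {w : ℕ} {x y : BitVector} {K : ℕ}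
    (hx : ∀ i, w ≤ i → x.bit i = .const false) (hy : ∀ i, w ≤ i → y.bit i = .const false)
    (h : K ≤ w → ∀ g ∈ adder (x.bit K) (y.bit K) (rippleCarryIn p K) (.rcarry p K) (.out p K),
      g.holds τ) :
    x.digits τ K + y.digits τ K + carriesIn (rippleCarries τ p w) K =
      2 * rippleCarries τ p w K + (outputs p (w + 1)).digits τ K := by
  rcases lt_trichotomy K w with hK | rfl | hK
  · have h1 := adder_sum (h hK.le)
    have h2 : ((rippleCarryIn p K).val τ).toNat = carriesIn (rippleCarries τ p w) K := by
      rcases K with _ | K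
      · rfl
      · simp only [carriesIn, rippleCarries, if_pos (show K < w by omega)]; rfl
    rw [h2] at h1
    simp only [BitVector.digits, outputs, rippleCarries, if_pos hK, if_pos (Nat.lt_succ_of_lt hK)]
    exact h1
  · have h1 := adder_sum (h le_rfl)
    have h0 : τ (.rcarry p K) = _ := h le_rfl _ (Or.inl rfl)
    have h2 : ((rippleCarryIn p K).val τ).toNat = carriesIn (rippleCarries τ p K) K := by
      rcases K with _ | K
      · rfl
      · simp only [carriesIn, rippleCarries, if_pos (Nat.lt_succ_self K)]; rfl
    simp only [hx K le_rfl, hy K le_rfl, Signal.val, Bool.false_and, Bool.or_false] at h0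
    rw [h0, h2] at h1
    simp only [BitVector.digits, outputs, rippleCarries, lt_irrefl, if_false,
      if_pos (Nat.lt_succ_self K)]
    exact h1
  · obtain ⟨K, rfl⟩ : ∃ K', K = K' + 1 := ⟨K - 1, by omega⟩
    have h1 : ¬ K < w := by omega
    have h2 : ¬ K + 1 < w := by omega
    simp [BitVector.digits, outputs, rippleCarries, carriesIn, hx (K + 1) (by omega),
      hy (K + 1) (by omega), h1, h2, Signal.val]

/-- The number of carries that leave column `K` of an array multiplier. -/
def arrayCarries (τ : BVar → Bool) (p : Addr) (w K : ℕ) : ℕ :=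
  ∑ j ∈ range (K + 1), if K - j < w ∧ j < w then (τ (.car p (K - j) j)).toNat else 0

theorem arrayCarries_le (τ : BVar → Bool) (p : Addr) (w K : ℕ) :
    arrayCarries τ p w K ≤ K + 1 := by
  have := sum_le_card_nsmul (range (K + 1))
    (fun j => if K - j < w ∧ j < w then (τ (.car p (K - j) j)).toNat else 0) 1 fun j _ => by
    split_ifs
    · exact Bool.toNat_le _
    · exact Nat.zero_le _
  simpa [arrayCarries] using this

theorem sum_diagonal {g : ℕ → ℕ} {w : ℕ} (hw : 1 ≤ w) (hg : ∀ j, w ≤ j → g j = 0) (M : ℕ) :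
    ∑ j ∈ range (M + 1), g j =
      ∑ j ∈ range M, (if j + 1 < w then g j else 0) + if M < w then g M else g (w - 1) := by
  induction M with
  | zero => simp [show 0 < w from hw]
  | succ M ih =>
    rw [sum_range_succ, ih, sum_range_succ]
    rcases lt_trichotomy (M + 1) w with h | h | h
    · simp [h, show M < w by omega]
    · have h1 : w - 1 = M := by omega
      have h2 := hg (M + 1) h.ge
      rw [if_pos (by omega), if_neg (by omega), if_neg (by omega), h1, h2, add_zero, add_zero]
    · have h2 := hg (M + 1) h.le
      simp [show ¬ M < w by omega, show ¬ M + 1 < w by omega, h2]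

/-- The adder equations are added along the diagonal `i + j = K`. A sum bit that is passed to the
next row occurs once as an output and once as an input and cancels. The only one left is the output
bit of the column. -/
theorem multiplier_column {τ : BVar → Bool} {p : Addr} {w : ℕ} {x y : BitVector} {K : ℕ}
    (hw : 1 ≤ w)
    (hx : ∀ i, w ≤ i → x.bit i = .const false) (hy : ∀ i, w ≤ i → y.bit i = .const false)
    (htab : ∀ i j, i < w → j < w → i + j = K →
      (andGate (x.bit i) (y.bit j) (.tab p i j)).holds τ)
    (hadd : ∀ i j, i ≤ w → j < w → i + j = K →
      ∀ g ∈ adder (tabIn p w i j) (sumIn p w i j) (carIn p i j) (.car p i j) (.sum p i j),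
      g.holds τ)
    (hout : K < 2 * w → (eqGate (.var (arrayOut p w K)) (.out p K)).holds τ) :
    conv (x.digits τ) (y.digits τ) K + carriesIn (arrayCarries τ p w) K =
      2 * arrayCarries τ p w K + (outputs p (2 * w)).digits τ K := by
  have hx0 : ∀ i, w ≤ i → x.digits τ i = 0 := fun i hi => by
    simp [BitVector.digits, hx i hi, Signal.val]
  have hy0 : ∀ i, w ≤ i → y.digits τ i = 0 := fun i hi => by
    simp [BitVector.digits, hy i hi, Signal.val]
  -- All quantities are extended by zero outside the grid, so that the cell equation holds on the
  -- whole diagonal and no boundary terms arise in the summation.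
  let d : ℕ → ℕ → ℕ := fun i j => if i ≤ w ∧ j < w then (τ (.sum p i j)).toNat else 0
  let cc : ℕ → ℕ → ℕ := fun i j => if i < w ∧ j < w then (τ (.car p i j)).toNat else 0
  let din : ℕ → ℕ → ℕ := fun i j => match j with
    | 0 => 0
    | j + 1 => if j + 1 < w then d (i + 1) j else 0
  let cin : ℕ → ℕ → ℕ := fun i j => match i with
    | 0 => 0
    | i + 1 => cc i j
  have point : ∀ i j, i + j = K →
      x.digits τ i * y.digits τ j + din i j + cin i j = 2 * cc i j + d i j := by
    intro i j hij
    by_cases hj : j < w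
    swap
    · have h1 : cin i j = 0 := by rcases i with _ | i <;> simp [cin, cc, hj]
      have h2 : din i j = 0 := by rcases j with _ | j <;> simp [din, hj]
      simp [h1, h2, hy0 j (not_lt.1 hj), cc, d, hj]
    by_cases hi : w < i
    · obtain ⟨i, rfl⟩ : ∃ i', i = i' + 1 := ⟨i - 1, by omega⟩
      have h2 : din (i + 1) j = 0 := by
        rcases j with _ | j
        · rfl
        · have : ¬ i + 1 < w := by omega
          simp [din, d, this]
      simp [cin, h2, hx0 (i + 1) (by omega), cc, d, show ¬ i < w by omega,
        show ¬ i + 1 ≤ w by omega, show ¬ i + 1 < w by omega]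
    have hg := hadd i j (by omega) hj hij
    have h1 := adder_sum hg
    have hc : ((carIn p i j).val τ).toNat = cin i j := by
      rcases i with _ | i
      · rfl
      · simp only [cin, cc, if_pos (show i < w ∧ j < w by omega)]; rfl
    have hs : ((sumIn p w i j).val τ).toNat = din i j := by
      rcases j with _ | j
      · rfl
      · by_cases hi' : i < w
        · simp [sumIn, din, d, hi', hj, show j < w by omega, Signal.val]
        · simp [sumIn, din, d, hi', Signal.val]
    have ht : ((tabIn p w i j).val τ).toNat = x.digits τ i * y.digits τ j := by
      by_cases hi' : i < w
      · have : τ (.tab p i j) = _ := htab i j hi' hj hij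
        rw [tabIn, if_pos hi', show Signal.val τ (.var (.tab p i j)) = _ from this]
        simp only [BitVector.digits]
        cases (x.bit i).val τ <;> cases (y.bit j).val τ <;> rfl
      · simp [tabIn, hi', hx0 i (by omega), Signal.val]
    rw [hc, hs, ht] at h1
    rw [h1]
    by_cases hi' : i < w
    · simp [cc, d, hi', hj, hi'.le]
    -- The adder with `i = w` has only its carry input, so it produces no carry. This justifies `i <
    -- w` in `cc`.
    · have h0 : τ (.car p i j) = _ := hg _ (Or.inl rfl)
      have h3 : (sumIn p w i j).val τ = false := by
        rcases j with _ | j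
        · rfl
        · simp [sumIn, hi', Signal.val]
      have h4 : (tabIn p w i j).val τ = false := by simp [tabIn, hi', Signal.val]
      rw [h3, h4] at h0
      simp only [Bool.false_and, Bool.or_false] at h0
      simp [cc, d, hi', hj, h0, show i ≤ w by omega]
  have total : ∑ j ∈ range (K + 1), (x.digits τ (K - j) * y.digits τ j + din (K - j) j +
      cin (K - j) j) = ∑ j ∈ range (K + 1), (2 * cc (K - j) j + d (K - j) j) :=
    sum_congr rfl fun j hj => point _ _ (Nat.sub_add_cancel (Nat.lt_succ_iff.1 (mem_range.1 hj)))
  simp only [sum_add_distrib, ← mul_sum] at total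
  have hcin : ∑ j ∈ range (K + 1), cin (K - j) j = carriesIn (arrayCarries τ p w) K := by
    rcases K with _ | K
    · rfl
    · rw [sum_range_succ, Nat.sub_self]
      simp only [carriesIn, arrayCarries]
      rw [show cin 0 (K + 1) = 0 from rfl, add_zero]
      refine sum_congr rfl fun j hj => ?_
      rw [Nat.succ_sub (Nat.lt_succ_iff.1 (mem_range.1 hj))]
  have hdin : ∑ j ∈ range (K + 1), din (K - j) j =
      ∑ j ∈ range K, if j + 1 < w then d (K - j) j else 0 := by
    rw [sum_range_succ', show din (K - 0) 0 = 0 from rfl, add_zero]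
    refine sum_congr rfl fun j hj => ?_
    have := mem_range.1 hj
    simp only [din]
    rw [show K - (j + 1) + 1 = K - j by omega]
  -- Below the last row every sum bit of the diagonal is passed on except the one with `i = 0`; in
  -- the last row none is. The bit that is not passed on is in row `K` if `K < w`, and in row `w -
  -- 1` otherwise.
  have hdiag := sum_diagonal hw (g := fun j => d (K - j) j)
    (fun j hj => by simp [d, not_lt.2 hj]) K
  have hlast : (if K < w then d (K - K) K else d (K - (w - 1)) (w - 1)) =
      (outputs p (2 * w)).digits τ K := by
    by_cases h2 : K < 2 * w
    · have ho : τ (.out p K) = _ := hout h2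
      simp only [outputs, BitVector.digits, h2, if_true, Signal.val, ho]
      by_cases h1 : K < w
      · simp [h1, arrayOut, d]
      · simp [h1, arrayOut, d, show K - (w - 1) ≤ w by omega, show 0 < w by omega]
    · have h3 : ¬ K - (w - 1) ≤ w := by omega
      simp [outputs, BitVector.digits, h2, show ¬ K < w by omega, d, h3, Signal.val]
  rw [hcin, hdin, hdiag, hlast] at total
  simp only [conv, arrayCarries] at total ⊢
  simp only [cc] at total
  omega

/-! ### Expressions and their circuits -/

/-- The value of an expression in a commutative semiring. -/
def RingExpr.eval {S : Type} [CommSemiring S] (ρ : ℕ → S) : RingExpr → S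
  | .var v => ρ v
  | .zero => 0
  | .one => 1
  | .add a b => a.eval ρ + b.eval ρ
  | .mul a b => a.eval ρ * b.eval ρ

theorem RingIdentity.eval_eq {S : Type} [CommSemiring S] (ρ : ℕ → S) {L R : RingExpr}
    (h : RingIdentity L R) : L.eval ρ = R.eval ρ := by
  induction h with
  | refl a => rfl
  | symm _ ih => exact ih.symm
  | trans _ _ ih₁ ih₂ => exact ih₁.trans ih₂
  | add_congr _ _ ih₁ ih₂ => simp only [RingExpr.eval, ih₁, ih₂]
  | mul_congr _ _ ih₁ ih₂ => simp only [RingExpr.eval, ih₁, ih₂]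
  | _ => simp only [RingExpr.eval]; ring

theorem RingExpr.le_length (n : ℕ) (p : Addr) (e : RingExpr) : n ≤ (e.output n p).length := by
  induction e generalizing p with
  | var v => exact le_rfl
  | zero => exact le_rfl
  | one => exact le_rfl
  | add a b iha ihb =>
    have := iha (false :: p)
    simp only [RingExpr.output, outputs]; omega
  | mul a b iha ihb =>
    have := iha (false :: p)
    simp only [RingExpr.output, outputs]; omega

theorem RingExpr.bit_of_length_le {n : ℕ} {p : Addr} {e : RingExpr} {i : ℕ}
    (h : (e.output n p).length ≤ i) : (e.output n p).bit i = .const false := by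
  cases e with
  | var v => exact if_neg (not_lt.2 h)
  | zero => rfl
  | one =>
    have : ¬ (i = 0 ∧ 0 < n) := by
      have : n ≤ i := h
      omega
    simp only [RingExpr.output, decide_eq_false this]
  | add a b => exact if_neg (not_lt.2 h)
  | mul a b => exact if_neg (not_lt.2 h)

theorem Signal.val_congr {σ τ : BVar → Bool} {s : Signal} (h : ∀ v ∈ s.vars, σ v = τ v) :
    s.val σ = s.val τ := by
  cases s with
  | const b => rfl
  | var x => exact h x (mem_singleton_self x)

theorem Signal.card_vars_le (s : Signal) : s.vars.card ≤ 1 := by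
  cases s <;> simp [Signal.vars]

/-- The constraints that occur in circuits. -/
inductive IsGate : Constraint BVar → Prop
  | and (x y : Signal) (z : BVar) : IsGate (andGate x y z)
  | eq (x : Signal) (z : BVar) : IsGate (eqGate x z)
  | sum (x y z : Signal) (d : BVar) : IsGate (sumGate x y z d)
  | maj (x y z : Signal) (c : BVar) : IsGate (majGate x y z c)

theorem IsGate.card_vars_le {g : Constraint BVar} (h : IsGate g) : g.vars.card ≤ 4 := by
  have key : ∀ (x y z : Signal) (d : BVar), (x.vars ∪ y.vars ∪ z.vars ∪ {d}).card ≤ 4 := by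
    intro x y z d
    have h1 := card_union_le (x.vars ∪ y.vars ∪ z.vars) {d}
    have h2 := card_union_le (x.vars ∪ y.vars) z.vars
    have h3 := card_union_le x.vars y.vars
    have := x.card_vars_le
    have := y.card_vars_le
    have := z.card_vars_le
    rw [card_singleton] at h1
    omega
  cases h with
  | and x y z => simpa [andGate, Signal.vars] using key x y (.const false) z
  | eq x z => simpa [eqGate, Signal.vars] using key x (.const false) (.const false) z
  | sum x y z d => exact key x y z d
  | maj x y z d => exact key x y z d

theorem IsGate.holds_congr {g : Constraint BVar} (h : IsGate g) {σ τ : BVar → Bool}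
    (hv : ∀ v ∈ g.vars, σ v = τ v) (hσ : g.holds σ) : g.holds τ := by
  cases h with
  | and x y z =>
    simp only [andGate, mem_union, mem_singleton] at hv hσ ⊢
    rw [← hv z (by simp), hσ, Signal.val_congr fun v hx => hv v (by simp [hx]),
      Signal.val_congr fun v hx => hv v (by simp [hx])]
  | eq x z =>
    simp only [eqGate, mem_union, mem_singleton] at hv hσ ⊢
    rw [← hv z (by simp), hσ, Signal.val_congr fun v hx => hv v (by simp [hx])]
  | sum x y z d =>
    simp only [sumGate, mem_union, mem_singleton] at hv hσ ⊢
    rw [← hv d (by simp), hσ, Signal.val_congr (s := x) fun v hx => hv v (by simp [hx]),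
      Signal.val_congr (s := y) fun v hx => hv v (by simp [hx]),
      Signal.val_congr (s := z) fun v hx => hv v (by simp [hx])]
  | maj x y z d =>
    simp only [majGate, mem_union, mem_singleton] at hv hσ ⊢
    rw [← hv d (by simp), hσ, Signal.val_congr (s := x) fun v hx => hv v (by simp [hx]),
      Signal.val_congr (s := y) fun v hx => hv v (by simp [hx]),
      Signal.val_congr (s := z) fun v hx => hv v (by simp [hx])]

theorem RingExpr.isGate_of_mem_circuit {n : ℕ} {p : Addr} {e : RingExpr} {g : Constraint BVar}
    (h : g ∈ e.circuit n p) : IsGate g := by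
  induction e generalizing p with
  | var v => exact h.elim
  | zero => exact h.elim
  | one => exact h.elim
  | add a b iha ihb =>
    rcases h with (h | h) | ⟨i, -, rfl | rfl⟩
    · exact iha h
    · exact ihb h
    · exact .maj ..
    · exact .sum ..
  | mul a b iha ihb =>
    rcases h with (h | h) | (⟨i, -, j, -, rfl⟩ | ⟨i, -, j, -, rfl | rfl⟩) | ⟨k, -, rfl⟩
    · exact iha h
    · exact ihb h
    · exact .and ..
    · exact .maj ..
    · exact .sum ..
    · exact .eq ..

/-! ### Constant parts of the circuits -/

/-- The signal is fixed when the literals of `K` are false. -/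
def Signal.Fixed (K : Clause BVar) (s : Signal) : Prop := s.vars ⊆ clauseVars K

/-- The signal is fixed to `0` when the literals of `K` are false. -/
def Signal.FixedZero (K : Clause BVar) (s : Signal) : Prop :=
  s.Fixed K ∧ ∀ τ, Falsifies τ K → s.val τ = false

theorem Falsifies.eq_of_mem {K : Clause BVar} {σ τ : BVar → Bool} (hσ : Falsifies σ K)
    (hτ : Falsifies τ K) {v : BVar} (hv : v ∈ clauseVars K) : σ v = τ v := by
  obtain ⟨l, hl, rfl⟩ := mem_clauseVars.1 hv
  rw [Bool.eq_not.2 (hσ l hl), Bool.eq_not.2 (hτ l hl)]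

theorem Signal.Fixed.val_eq {K : Clause BVar} {s : Signal} (h : s.Fixed K) {σ τ : BVar → Bool}
    (hσ : Falsifies σ K) (hτ : Falsifies τ K) : s.val σ = s.val τ :=
  Signal.val_congr fun _ hv => hσ.eq_of_mem hτ (h hv)

theorem Signal.fixed_const (K : Clause BVar) (b : Bool) : (Signal.const b).Fixed K :=
  empty_subset _

theorem Signal.fixed_var {K : Clause BVar} {x : BVar} :
    (Signal.var x).Fixed K ↔ x ∈ clauseVars K := by
  simp [Signal.Fixed, Signal.vars]

theorem Signal.fixedZero_const (K : Clause BVar) : (Signal.const false).FixedZero K :=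
  ⟨Signal.fixed_const K false, fun _ _ => rfl⟩

section Fixed

variable {𝒢 : Set (Constraint BVar)} {K : Clause BVar}

theorem UnitClosed.fixedZero_of_forced (hK : UnitClosed 𝒢 K) {g : Constraint BVar} (hg : g ∈ 𝒢)
    {x : BVar} (hx : x ∈ g.vars) (h : ∀ τ, Falsifies τ K → g.holds τ → τ x = false) :
    (Signal.var x).FixedZero K := by
  have hxK := hK.mem_of_forced g hg x hx false h
  obtain ⟨σ, hσ, hgσ⟩ := hK.exists_holds g hg
  exact ⟨Signal.fixed_var.2 hxK, fun τ hτ => (hτ.eq_of_mem hσ hxK).trans (h σ hσ hgσ)⟩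

theorem UnitClosed.fixed_of_determined (hK : UnitClosed 𝒢 K) {g : Constraint BVar} (hg : g ∈ 𝒢)
    {x : BVar} (hx : x ∈ g.vars) (h : ∀ σ τ, Falsifies σ K → Falsifies τ K →
      g.holds σ → g.holds τ → σ x = τ x) : (Signal.var x).Fixed K := by
  obtain ⟨σ, hσ, hgσ⟩ := hK.exists_holds g hg
  exact Signal.fixed_var.2
    (hK.mem_of_forced g hg x hx (σ x) fun τ hτ hgτ => h τ σ hτ hσ hgτ hgσ)

theorem UnitClosed.fixed_and (hK : UnitClosed 𝒢 K) {x y : Signal} {z : BVar}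
    (hg : andGate x y z ∈ 𝒢) (hx : x.Fixed K) (hy : y.Fixed K) : (Signal.var z).Fixed K :=
  hK.fixed_of_determined hg (by simp [andGate]) fun σ τ hσ hτ h₁ h₂ => by
    simp only [andGate] at h₁ h₂
    rw [h₁, h₂, hx.val_eq hσ hτ, hy.val_eq hσ hτ]

theorem UnitClosed.fixed_eq (hK : UnitClosed 𝒢 K) {x : Signal} {z : BVar}
    (hg : eqGate x z ∈ 𝒢) (hx : x.Fixed K) : (Signal.var z).Fixed K :=
  hK.fixed_of_determined hg (by simp [eqGate]) fun σ τ hσ hτ h₁ h₂ => by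
    simp only [eqGate] at h₁ h₂
    rw [h₁, h₂, hx.val_eq hσ hτ]

theorem UnitClosed.fixed_adder (hK : UnitClosed 𝒢 K) {x y z : Signal} {c d : BVar}
    (hg : adder x y z c d ⊆ 𝒢) (hx : x.Fixed K) (hy : y.Fixed K) (hz : z.Fixed K) :
    (Signal.var c).Fixed K ∧ (Signal.var d).Fixed K := by
  constructor
  · refine hK.fixed_of_determined (hg (Or.inl rfl)) (by simp [majGate]) fun σ τ hσ hτ h₁ h₂ => ?_
    simp only [majGate] at h₁ h₂
    rw [h₁, h₂, hx.val_eq hσ hτ, hy.val_eq hσ hτ, hz.val_eq hσ hτ]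
  · refine hK.fixed_of_determined (hg (Or.inr rfl)) (by simp [sumGate]) fun σ τ hσ hτ h₁ h₂ => ?_
    simp only [sumGate] at h₁ h₂
    rw [h₁, h₂, hx.val_eq hσ hτ, hy.val_eq hσ hτ, hz.val_eq hσ hτ]

theorem UnitClosed.fixedZero_and_left (hK : UnitClosed 𝒢 K) {x y : Signal} {z : BVar}
    (hg : andGate x y z ∈ 𝒢) (hx : x.FixedZero K) : (Signal.var z).FixedZero K :=
  hK.fixedZero_of_forced hg (by simp [andGate]) fun τ hτ h => by
    simp only [andGate] at h
    rw [h, hx.2 τ hτ, Bool.false_and]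

theorem UnitClosed.fixedZero_and_right (hK : UnitClosed 𝒢 K) {x y : Signal} {z : BVar}
    (hg : andGate x y z ∈ 𝒢) (hy : y.FixedZero K) : (Signal.var z).FixedZero K :=
  hK.fixedZero_of_forced hg (by simp [andGate]) fun τ hτ h => by
    simp only [andGate] at h
    rw [h, hy.2 τ hτ, Bool.and_false]

theorem UnitClosed.fixedZero_carry (hK : UnitClosed 𝒢 K) {x y z : Signal} {c d : BVar}
    (hg : adder x y z c d ⊆ 𝒢)
    (h : (x.FixedZero K ∧ y.FixedZero K) ∨ (x.FixedZero K ∧ z.FixedZero K)) :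
    (Signal.var c).FixedZero K :=
  hK.fixedZero_of_forced (hg (Or.inl rfl)) (by simp [majGate]) fun τ hτ hc => by
    simp only [majGate] at hc
    rcases h with ⟨hx, hy⟩ | ⟨hx, hz⟩
    · simp [hc, hx.2 τ hτ, hy.2 τ hτ]
    · simp [hc, hx.2 τ hτ, hz.2 τ hτ]

theorem UnitClosed.fixedZero_sum (hK : UnitClosed 𝒢 K) {x y z : Signal} {c d : BVar}
    (hg : adder x y z c d ⊆ 𝒢) (hx : x.FixedZero K) (hy : y.FixedZero K) (hz : z.FixedZero K) :
    (Signal.var d).FixedZero K :=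
  hK.fixedZero_of_forced (hg (Or.inr rfl)) (by simp [sumGate]) fun τ hτ hd => by
    simp only [sumGate] at hd
    simp [hd, hx.2 τ hτ, hy.2 τ hτ, hz.2 τ hτ]

theorem adder_subset_ripple {p : Addr} {w : ℕ} {x y : BitVector} {i : ℕ} (hi : i ≤ w) :
    adder (x.bit i) (y.bit i) (rippleCarryIn p i) (.rcarry p i) (.out p i) ⊆
      rippleCarryAdder p w x y := fun _ hg => ⟨i, hi, hg⟩

theorem andGate_mem_array {p : Addr} {w : ℕ} {x y : BitVector} {i j : ℕ} (hi : i < w)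
    (hj : j < w) : andGate (x.bit i) (y.bit j) (.tab p i j) ∈ arrayMultiplier p w x y :=
  Or.inl (Or.inl ⟨i, hi, j, hj, rfl⟩)

theorem adder_subset_array {p : Addr} {w : ℕ} {x y : BitVector} {i j : ℕ} (hi : i ≤ w)
    (hj : j < w) :
    adder (tabIn p w i j) (sumIn p w i j) (carIn p i j) (.car p i j) (.sum p i j) ⊆
      arrayMultiplier p w x y := fun _ hg => Or.inl (Or.inr ⟨i, hi, j, hj, hg⟩)

theorem eqGate_mem_array {p : Addr} {w : ℕ} {x y : BitVector} {k : ℕ} (hk : k < 2 * w) :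
    eqGate (.var (arrayOut p w k)) (.out p k) ∈ arrayMultiplier p w x y := Or.inr ⟨k, hk, rfl⟩

theorem UnitClosed.fixed_ripple (hK : UnitClosed 𝒢 K) {p : Addr} {w : ℕ} {x y : BitVector}
    (hg : rippleCarryAdder p w x y ⊆ 𝒢) (hx : ∀ i, (x.bit i).Fixed K)
    (hy : ∀ i, (y.bit i).Fixed K) (i : ℕ) (hi : i ≤ w) :
    (Signal.var (.rcarry p i)).Fixed K ∧ (Signal.var (.out p i)).Fixed K := by
  induction i with
  | zero =>
    exact hK.fixed_adder ((adder_subset_ripple hi).trans hg) (hx 0) (hy 0)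
      (Signal.fixed_const K false)
  | succ i ih =>
    exact hK.fixed_adder ((adder_subset_ripple hi).trans hg) (hx _) (hy _) (ih (by omega)).1

theorem UnitClosed.fixed_array (hK : UnitClosed 𝒢 K) {p : Addr} {w : ℕ} {x y : BitVector}
    (hg : arrayMultiplier p w x y ⊆ 𝒢) (hx : ∀ i, (x.bit i).Fixed K)
    (hy : ∀ i, (y.bit i).Fixed K) (j : ℕ) (hj : j < w) (i : ℕ) (hi : i ≤ w) :
    (Signal.var (.car p i j)).Fixed K ∧ (Signal.var (.sum p i j)).Fixed K := by
  have ht : ∀ i j, j < w → (tabIn p w i j).Fixed K := by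
    intro i j hj
    unfold tabIn
    split_ifs with hi
    · exact hK.fixed_and (hg (andGate_mem_array hi hj)) (hx i) (hy j)
    · exact Signal.fixed_const K false
  induction j generalizing i with
  | zero =>
    induction i with
    | zero =>
      exact hK.fixed_adder ((adder_subset_array hi hj).trans hg) (ht _ _ hj)
        (Signal.fixed_const K false) (Signal.fixed_const K false)
    | succ i ih =>
      exact hK.fixed_adder ((adder_subset_array hi hj).trans hg) (ht _ _ hj)
        (Signal.fixed_const K false) (ih (by omega)).1
  | succ j ihj =>
    have hs : ∀ i, (sumIn p w i (j + 1)).Fixed K := by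
      intro i
      unfold sumIn
      split_ifs with hi
      · exact (ihj (by omega) (i + 1) hi).2
      · exact Signal.fixed_const K false
    induction i with
    | zero =>
      exact hK.fixed_adder ((adder_subset_array hi hj).trans hg) (ht _ _ hj) (hs 0)
        (Signal.fixed_const K false)
    | succ i ih =>
      exact hK.fixed_adder ((adder_subset_array hi hj).trans hg) (ht _ _ hj) (hs _)
        (ih (by omega)).1

/-- A bound for the number of bits of the values of constant subexpressions. -/
def RingExpr.constBits : RingExpr → ℕ
  | .var _ => 0
  | .zero => 0
  | .one => 1
  | .add a b => max a.constBits b.constBits + 1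
  | .mul a b => a.constBits + b.constBits

/-- Since `K` contradicts no single gate, a gate without free variables is satisfied. Constant
circuits can therefore be evaluated although none of their variables is in a bag. -/
theorem UnitClosed.holds_of_fixed (hK : UnitClosed 𝒢 K) {g : Constraint BVar} (hg : g ∈ 𝒢)
    (hgate : IsGate g) (hv : g.vars ⊆ clauseVars K) {τ : BVar → Bool} (hτ : Falsifies τ K) :
    g.holds τ := by
  obtain ⟨σ, hσ, hgσ⟩ := hK.exists_holds g hg
  exact hgate.holds_congr (fun v hvg => hσ.eq_of_mem hτ (hv hvg)) hgσ

/-- Nothing is carried into column `0`, so carrying can only lose what leaves at the top. This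
bounds constants as integers, not just modulo a power of two. -/
theorem strip_zero_le_of_columns {T C o : ℕ → ℕ}
    (h : ∀ K, T K + carriesIn C K = 2 * C K + o K) (N : ℕ) : strip 0 N o ≤ strip 0 N T := by
  have := strip_columns (Nat.zero_le N) fun K _ _ => h K
  simp only [carriesIn, mul_zero, add_zero] at this
  omega

theorem fixed_adder_vars {x y z : Signal} {c d : BVar} (hx : x.Fixed K) (hy : y.Fixed K)
    (hz : z.Fixed K) (hc : (Signal.var c).Fixed K) (hd : (Signal.var d).Fixed K) :
    ∀ g ∈ adder x y z c d, g.vars ⊆ clauseVars K := by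
  rintro g (rfl | rfl)
  · exact union_subset (union_subset (union_subset hx hy) hz) hc
  · exact union_subset (union_subset (union_subset hx hy) hz) hd

theorem strip_zero_digits_one {n : ℕ} (hn : 1 ≤ n) (p : Addr) (τ : BVar → Bool) (N : ℕ) :
    strip 0 N ((RingExpr.one.output n p).digits τ) = 1 := by
  have h0 : 0 < n := hn
  unfold strip
  rw [sum_eq_single_of_mem 0 (by simp)]
  · simp [BitVector.digits, RingExpr.output, Signal.val, h0]
  · intro i _ hi
    simp [BitVector.digits, RingExpr.output, Signal.val, hi]

/-- The circuit of a constant expression is fixed, and it computes a number with few bits. -/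
theorem UnitClosed.degree_zero (hK : UnitClosed 𝒢 K) {n : ℕ} (hn : 1 ≤ n) {e : RingExpr}
    (hdeg : e.degree = 0) {p : Addr} (hg : e.circuit n p ⊆ 𝒢) :
    (∀ i, ((e.output n p).bit i).Fixed K) ∧
      ∀ τ, Falsifies τ K → ∀ N, strip 0 N ((e.output n p).digits τ) < 2 ^ e.constBits := by
  induction e generalizing p with
  | var v => simp [RingExpr.degree] at hdeg
  | zero =>
    exact ⟨fun i => Signal.fixed_const K _, fun τ _ N => by
      simp [strip, BitVector.digits, RingExpr.output, Signal.val, RingExpr.constBits]⟩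
  | one =>
    refine ⟨fun i => Signal.fixed_const K _, fun τ _ N => ?_⟩
    rw [strip_zero_digits_one hn]
    simp [RingExpr.constBits]
  | add a b iha ihb =>
    simp only [RingExpr.degree, Nat.max_eq_zero_iff] at hdeg
    have hgr : rippleCarryAdder p _ (a.output n (false :: p)) (b.output n (true :: p)) ⊆ 𝒢 :=
      Set.subset_union_right.trans hg
    obtain ⟨fa, va⟩ := iha hdeg.1 fun g h => hg (Or.inl (Or.inl h))
    obtain ⟨fb, vb⟩ := ihb hdeg.2 fun g h => hg (Or.inl (Or.inr h))
    have fix := hK.fixed_ripple hgr fa fb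
    refine ⟨fun i => ?_, fun τ hτ N => ?_⟩
    · simp only [RingExpr.output, outputs]
      split_ifs with hi
      · exact (fix i (by omega)).2
      · exact Signal.fixed_const K _
    · have hcin : ∀ i ≤ max (a.output n (false :: p)).length (b.output n (true :: p)).length,
          (rippleCarryIn p i).Fixed K := by
        rintro (_ | i) hi
        · exact Signal.fixed_const K _
        · exact (fix i (by omega)).1
      have col := fun i => ripple_column (τ := τ) (p := p) (K := i)
        (fun i hi => RingExpr.bit_of_length_le ((le_max_left _ _).trans hi))
        (fun i hi => RingExpr.bit_of_length_le ((le_max_right _ _).trans hi))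
        fun hi g hgi => hK.holds_of_fixed (hgr (adder_subset_ripple hi hgi))
          (RingExpr.isGate_of_mem_circuit (n := n) (p := p) (e := .add a b)
            (Or.inr (adder_subset_ripple hi hgi)))
          (fixed_adder_vars (fa i) (fb i) (hcin i hi) (fix i hi).1 (fix i hi).2 g hgi) hτ
      have h1 := strip_zero_le_of_columns col N
      rw [strip_add] at h1
      have h2 := va τ hτ N
      have h3 := vb τ hτ N
      have h4 : 2 ^ a.constBits ≤ 2 ^ max a.constBits b.constBits :=
        Nat.pow_le_pow_right (by norm_num) (le_max_left _ _)
      have h5 : 2 ^ b.constBits ≤ 2 ^ max a.constBits b.constBits :=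
        Nat.pow_le_pow_right (by norm_num) (le_max_right _ _)
      refine h1.trans_lt ?_
      rw [RingExpr.constBits, pow_succ]
      omega
  | mul a b iha ihb =>
    simp only [RingExpr.degree, Nat.add_eq_zero_iff] at hdeg
    have hgr : arrayMultiplier p _ (a.output n (false :: p)) (b.output n (true :: p)) ⊆ 𝒢 :=
      Set.subset_union_right.trans hg
    obtain ⟨fa, va⟩ := iha hdeg.1 fun g h => hg (Or.inl (Or.inl h))
    obtain ⟨fb, vb⟩ := ihb hdeg.2 fun g h => hg (Or.inl (Or.inr h))
    have hla := a.le_length n (false :: p)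
    set w := max (a.output n (false :: p)).length (b.output n (true :: p)).length with hw
    have hw1 : 1 ≤ w := by omega
    have fix := hK.fixed_array hgr fa fb
    have ftab : ∀ i j, i < w → j < w → (Signal.var (.tab p i j)).Fixed K := fun i j hi hj =>
      hK.fixed_and (hgr (andGate_mem_array hi hj)) (fa i) (fb j)
    have fao : ∀ k < 2 * w, (Signal.var (arrayOut p w k)).Fixed K := by
      intro k hk
      unfold arrayOut
      split_ifs with h
      · exact (fix k h 0 (by omega)).2
      · exact (fix (w - 1) (by omega) _ (by omega)).2
    have fout : ∀ k < 2 * w, (Signal.var (.out p k)).Fixed K := fun k hk =>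
      hK.fixed_eq (hgr (eqGate_mem_array hk)) (fao k hk)
    refine ⟨fun i => ?_, fun τ hτ N => ?_⟩
    · simp only [RingExpr.output, outputs]
      split_ifs with hi
      · exact fout i hi
      · exact Signal.fixed_const K _
    · have fti : ∀ i j, j < w → (tabIn p w i j).Fixed K := by
        intro i j hj
        unfold tabIn
        split_ifs with hi
        · exact ftab i j hi hj
        · exact Signal.fixed_const K _
      have fsi : ∀ i j, j < w → (sumIn p w i j).Fixed K := by
        rintro i (_ | j) hj
        · exact Signal.fixed_const K _
        · unfold sumIn
          split_ifs with hi
          · exact (fix j (by omega) (i + 1) hi).2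
          · exact Signal.fixed_const K _
      have fci : ∀ i j, i ≤ w → j < w → (carIn p i j).Fixed K := by
        rintro (_ | i) j hi hj
        · exact Signal.fixed_const K _
        · exact (fix j hj i (by omega)).1
      have hgate : ∀ g ∈ arrayMultiplier p w (a.output n (false :: p)) (b.output n (true :: p)),
          IsGate g := fun g h =>
        RingExpr.isGate_of_mem_circuit (n := n) (p := p) (e := .mul a b) (Or.inr h)
      have hold : ∀ g ∈ arrayMultiplier p w (a.output n (false :: p)) (b.output n (true :: p)),
          g.vars ⊆ clauseVars K → g.holds τ := fun g h hv =>
        hK.holds_of_fixed (hgr h) (hgate g h) hv hτ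
      have col := fun i => multiplier_column (τ := τ) (p := p) (K := i) hw1
        (fun i hi => RingExpr.bit_of_length_le ((le_max_left _ _).trans hi))
        (fun i hi => RingExpr.bit_of_length_le ((le_max_right _ _).trans hi))
        (fun i j hi hj _ => hold _ (andGate_mem_array hi hj)
          (union_subset (union_subset (fa i) (fb j)) (ftab i j hi hj)))
        (fun i j hi hj _ g hgi => hold g (adder_subset_array hi hj hgi)
          (fixed_adder_vars (fti i j hj) (fsi i j hj) (fci i j hi hj) (fix j hj i hi).1
            (fix j hj i hi).2 g hgi))
        (fun hi => hold _ (eqGate_mem_array hi) (union_subset (fao i hi) (fout i hi)))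
      have h1 := strip_zero_le_of_columns col N
      obtain ⟨q, hq⟩ := strip_zero_conv ((a.output n (false :: p)).digits τ)
        ((b.output n (true :: p)).digits τ) N
      refine h1.trans_lt ?_
      rw [RingExpr.constBits, pow_add]
      have := Nat.mul_lt_mul'' (va τ hτ N) (vb τ hτ N)
      omega

/-- A one in position `i` would alone contribute `2 ^ i`, exceeding the bound on the value. -/
theorem UnitClosed.fixedZero_bit (hK : UnitClosed 𝒢 K) {n : ℕ} (hn : 1 ≤ n) {e : RingExpr}
    (hdeg : e.degree = 0) {p : Addr} (hg : e.circuit n p ⊆ 𝒢) {i : ℕ} (hi : e.constBits ≤ i) :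
    ((e.output n p).bit i).FixedZero K := by
  obtain ⟨h1, h2⟩ := hK.degree_zero hn hdeg hg
  refine ⟨h1 i, fun τ hτ => ?_⟩
  by_contra hne
  have hone : (e.output n p).digits τ i = 1 := by
    simp [BitVector.digits, Bool.eq_true_of_not_eq_false hne]
  have h3 : 2 ^ i * (e.output n p).digits τ i ≤ strip 0 i ((e.output n p).digits τ) :=
    single_le_sum (f := fun K => 2 ^ K * (e.output n p).digits τ K) (fun _ _ => Nat.zero_le _)
      (by simp)
  have h4 : 2 ^ e.constBits ≤ 2 ^ i := Nat.pow_le_pow_right (by norm_num) hi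
  have h5 := h2 τ hτ i
  rw [hone] at h3
  omega

/-- In a multiplier whose first operand is a small constant, everything far from the low end of the
rows is `0`. -/
theorem UnitClosed.fixedZero_of_left (hK : UnitClosed 𝒢 K) {p : Addr} {w c : ℕ}
    {x y : BitVector} (hg : arrayMultiplier p w x y ⊆ 𝒢)
    (hx : ∀ i, c ≤ i → (x.bit i).FixedZero K) (j : ℕ) (hj : j < w) (i : ℕ) (hi : i ≤ w) :
    (c ≤ i → (tabIn p w i j).FixedZero K) ∧
      (c ≤ i → (Signal.var (.car p i j)).FixedZero K) ∧
      (c < i → (Signal.var (.sum p i j)).FixedZero K) := by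
  have ht : ∀ i j, j < w → c ≤ i → (tabIn p w i j).FixedZero K := by
    intro i j hj hc
    unfold tabIn
    split_ifs with hi
    · exact hK.fixedZero_and_left (hg (andGate_mem_array hi hj)) (hx i hc)
    · exact Signal.fixedZero_const K
  refine ⟨ht i j hj, ?_⟩
  induction j generalizing i with
  | zero =>
    have hcar : ∀ i ≤ w, c ≤ i → (Signal.var (.car p i 0)).FixedZero K := fun i hi hc =>
      hK.fixedZero_carry ((adder_subset_array hi hj).trans hg)
        (Or.inl ⟨ht i 0 hj hc, Signal.fixedZero_const K⟩)
    refine ⟨hcar i hi, fun hc => ?_⟩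
    obtain ⟨i, rfl⟩ : ∃ i', i = i' + 1 := ⟨i - 1, by omega⟩
    exact hK.fixedZero_sum ((adder_subset_array hi hj).trans hg) (ht _ _ hj hc.le)
      (Signal.fixedZero_const K) (hcar i (by omega) (by omega))
  | succ j ih =>
    have hs : ∀ i, c ≤ i → (sumIn p w i (j + 1)).FixedZero K := by
      intro i hc
      unfold sumIn
      split_ifs with hi
      -- The sum input comes from position `i + 1` of the previous row. Hence the strict bound `c <
      -- i` for sum bits yields the weak bound needed for carries.
      · exact (ih (by omega) (i + 1) hi).2 (by omega)
      · exact Signal.fixedZero_const K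
    have hcar : ∀ i ≤ w, c ≤ i → (Signal.var (.car p i (j + 1))).FixedZero K := fun i hi hc =>
      hK.fixedZero_carry ((adder_subset_array hi hj).trans hg)
        (Or.inl ⟨ht i _ hj hc, hs i hc⟩)
    refine ⟨hcar i hi, fun hc => ?_⟩
    obtain ⟨i, rfl⟩ : ∃ i', i = i' + 1 := ⟨i - 1, by omega⟩
    exact hK.fixedZero_sum ((adder_subset_array hi hj).trans hg) (ht _ _ hj hc.le)
      (hs _ hc.le) (hcar i (by omega) (by omega))

/-- In a multiplier whose second operand is a small constant, there are no carries in the high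
rows. -/
theorem UnitClosed.fixedZero_of_right (hK : UnitClosed 𝒢 K) {p : Addr} {w c : ℕ}
    {x y : BitVector} (hg : arrayMultiplier p w x y ⊆ 𝒢)
    (hy : ∀ j, c ≤ j → (y.bit j).FixedZero K) (j : ℕ) (hj : j < w) (hc : c ≤ j) (i : ℕ)
    (hi : i ≤ w) :
    (tabIn p w i j).FixedZero K ∧ (Signal.var (.car p i j)).FixedZero K := by
  have ht : ∀ i, (tabIn p w i j).FixedZero K := by
    intro i
    unfold tabIn
    split_ifs with hi
    · exact hK.fixedZero_and_right (hg (andGate_mem_array hi hj)) (hy j hc)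
    · exact Signal.fixedZero_const K
  refine ⟨ht i, ?_⟩
  induction i with
  | zero =>
    exact hK.fixedZero_carry ((adder_subset_array hi hj).trans hg)
      (Or.inr ⟨ht 0, Signal.fixedZero_const K⟩)
  | succ i ih =>
    exact hK.fixedZero_carry ((adder_subset_array hi hj).trans hg)
      (Or.inr ⟨ht _, ih (by omega)⟩)

end Fixed

/-! ### A path decomposition of the critical strip -/

/-- The distance of column `i` from the nearer end of the interval `0, …, k`. -/
def fold (k i : ℕ) : ℕ := min i (k - i)

/-- The distance of `x` and `y` is at most `d`. -/
def Near (d x y : ℕ) : Prop := x ≤ y + d ∧ y ≤ x + d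

/-- The parameters of the path decomposition: the critical column `k`, the width `δ` of the
critical strip, a bound `c` for the number of bits of the constants, and the degrees of the
subexpressions. -/
structure Layout : Type where
  k : ℕ
  δ : ℕ
  c : ℕ
  deg : Addr → ℕ

namespace Layout

variable (Λ : Layout)

/-- The lowest column of the critical strip. -/
def lo : ℕ := Λ.k - Λ.δ

/-- The number of time steps that are spent on one pair of columns. -/
def period : ℕ := Λ.k + 2

/-- For how many column pairs an input bit stays alive. -/
def reach : ℕ := Λ.δ + Λ.c + 1

/-- The last time step. -/
def horizon : ℕ := Λ.period * (Λ.k + 1)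

/-- When a tableau variable or a carry bit of a multiplier is alive. -/
def CellAlive (t : ℕ) (p : Addr) (i j : ℕ) : Prop :=
  i + j ≤ Λ.k ∧ if Λ.deg p = 2 then
      Λ.lo ≤ i + j + 1 ∧ Near 1 (fold Λ.k i) (t / Λ.period)
    else (i ≤ Λ.c ∨ j ≤ Λ.c) ∧ Near Λ.reach (fold Λ.k (i + j)) (t / Λ.period)

/-- The bag at time `t` consists of the variables that are alive at time `t`. -/
def Alive (t : ℕ) : BVar → Prop
  | .inp _ i => i ≤ Λ.k ∧ Near Λ.reach (fold Λ.k i) (t / Λ.period)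
  | .out _ i => i ≤ Λ.k ∧ (Near Λ.reach (fold Λ.k i) (t / Λ.period) ∨ Λ.lo ≤ i)
  | .rcarry _ i => i ≤ Λ.k ∧ Near Λ.reach (fold Λ.k i) (t / Λ.period)
  | .tab p i j => Λ.CellAlive t p i j
  | .car p i j => Λ.CellAlive t p i j
  | .sum p i j => Λ.CellAlive t p i j ∨ (i + j ≤ Λ.k ∧ Λ.deg p ≠ 2 ∧
      Λ.period * fold Λ.k (i + j) + j ≤ t ∧ t ≤ Λ.period * fold Λ.k (i + j) + j + 1)
  | .neq _ => False

variable {Λ}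

theorem near_convex {d x r s t : ℕ} (hrs : r ≤ s) (hst : s ≤ t) (hr : Near d x r)
    (ht : Near d x t) : Near d x s := by
  unfold Near at *; omega

theorem period_pos : 0 < Λ.period := by unfold period; omega

theorem mul_add_div_period {f j : ℕ} (hj : j < Λ.period) :
    (Λ.period * f + j) / Λ.period = f := by
  rw [Nat.mul_add_div period_pos, Nat.div_eq_of_lt hj, add_zero]

theorem mul_div_period {f : ℕ} : (Λ.period * f) / Λ.period = f :=
  Nat.mul_div_cancel_left f period_pos

theorem cellAlive_convex {p : Addr} {i j r s t : ℕ} (hrs : r ≤ s) (hst : s ≤ t)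
    (hr : Λ.CellAlive r p i j) (ht : Λ.CellAlive t p i j) : Λ.CellAlive s p i j := by
  have h1 : r / Λ.period ≤ s / Λ.period := Nat.div_le_div_right hrs
  have h2 : s / Λ.period ≤ t / Λ.period := Nat.div_le_div_right hst
  unfold CellAlive at *
  split_ifs at * with h
  · exact ⟨hr.1, hr.2.1, near_convex h1 h2 hr.2.2 ht.2.2⟩
  · exact ⟨hr.1, hr.2.1, near_convex h1 h2 hr.2.2 ht.2.2⟩

/-- The connectivity condition of the path decomposition. -/
theorem alive_convex {u : BVar} {r s t : ℕ} (hrs : r ≤ s) (hst : s ≤ t)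
    (hr : Λ.Alive r u) (ht : Λ.Alive t u) : Λ.Alive s u := by
  have h1 : r / Λ.period ≤ s / Λ.period := Nat.div_le_div_right hrs
  have h2 : s / Λ.period ≤ t / Λ.period := Nat.div_le_div_right hst
  cases u with
  | inp v i => exact ⟨hr.1, near_convex h1 h2 hr.2 ht.2⟩
  | out p i =>
    refine ⟨hr.1, ?_⟩
    rcases hr.2 with h | h
    · rcases ht.2 with h' | h'
      · exact Or.inl (near_convex h1 h2 h h')
      · exact Or.inr h'
    · exact Or.inr h
  | rcarry p i => exact ⟨hr.1, near_convex h1 h2 hr.2 ht.2⟩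
  | tab p i j => exact cellAlive_convex hrs hst hr ht
  | car p i j => exact cellAlive_convex hrs hst hr ht
  | sum p i j =>
    -- A sum bit can have both a cell lifetime and a wire lifetime. The two steps of the wire lie
    -- within the period of its own column, hence inside the cell lifetime if there is one, and the
    -- union remains an interval.
    have key : ∀ t', (∃ t'', Λ.CellAlive t'' p i j) → (i + j ≤ Λ.k ∧ Λ.deg p ≠ 2 ∧
        Λ.period * fold Λ.k (i + j) + j ≤ t' ∧ t' ≤ Λ.period * fold Λ.k (i + j) + j + 1) →
        Λ.CellAlive t' p i j := by
      rintro t' ⟨t'', h⟩ ⟨h1, h2, h3, h4⟩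
      unfold CellAlive at h ⊢
      rw [if_neg h2] at h ⊢
      refine ⟨h.1, h.2.1, ?_⟩
      have hdiv : t' / Λ.period = fold Λ.k (i + j) := by
        obtain ⟨x, rfl⟩ : ∃ x, t' = Λ.period * fold Λ.k (i + j) + x := ⟨_, (Nat.add_sub_of_le
          (by omega)).symm⟩
        exact mul_add_div_period (by unfold period; omega)
      rw [hdiv]
      constructor <;> omega
    rcases hr with hr | hr <;> rcases ht with ht | ht
    · exact Or.inl (cellAlive_convex hrs hst hr ht)
    · exact Or.inl (cellAlive_convex hrs hst hr (key t ⟨r, hr⟩ ht))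
    · exact Or.inl (cellAlive_convex hrs hst (key r ⟨t, ht⟩ hr) ht)
    · exact Or.inr ⟨hr.1, hr.2.1, hr.2.2.1.trans hrs, hst.trans ht.2.2.2⟩
  | neq i => exact hr

variable (Λ) in
/-- The variables of the signal are alive at time `t`, except those that are fixed. -/
def Fits (K : Clause BVar) (t : ℕ) (U : Finset BVar) : Prop :=
  ∀ u ∈ U, u ∈ clauseVars K ∨ Λ.Alive t u

variable (Λ) in
/-- The assignment makes the literals of `K` false and satisfies all constraints that fit into a
bag. -/
structure Model (𝒢 : Set (Constraint BVar)) (K : Clause BVar) (τ : BVar → Bool) : Prop where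
  falsifies : Falsifies τ K
  holds : ∀ g ∈ 𝒢, ∀ t ≤ Λ.horizon, Λ.Fits K t g.vars → g.holds τ

section Fits

variable {K : Clause BVar} {t : ℕ}

theorem Fits.union {U U' : Finset BVar} (h : Λ.Fits K t U) (h' : Λ.Fits K t U') :
    Λ.Fits K t (U ∪ U') := fun u hu => (mem_union.1 hu).elim (h u) (h' u)

theorem fits_empty : Λ.Fits K t ∅ := fun _ hu => absurd hu (notMem_empty _)

theorem fits_singleton {u : BVar} (h : Λ.Alive t u) : Λ.Fits K t {u} := fun v hv => by
  rw [mem_singleton.1 hv]; exact Or.inr h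

theorem fits_of_fixed {s : Signal} (h : s.Fixed K) : Λ.Fits K t s.vars :=
  fun _ hu => Or.inl (h hu)

theorem fits_adder {x y z : Signal} {c d : BVar} (hx : Λ.Fits K t x.vars)
    (hy : Λ.Fits K t y.vars) (hz : Λ.Fits K t z.vars) (hc : Λ.Fits K t {c})
    (hd : Λ.Fits K t {d}) : ∀ g ∈ adder x y z c d, Λ.Fits K t g.vars := by
  rintro g (rfl | rfl)
  · exact ((hx.union hy).union hz).union hc
  · exact ((hx.union hy).union hz).union hd

theorem fits_bit {n : ℕ} {p : Addr} {e : RingExpr} {i : ℕ} (hi : i ≤ Λ.k)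
    (h : Near Λ.reach (fold Λ.k i) (t / Λ.period)) :
    Λ.Fits K t ((e.output n p).bit i).vars := by
  have ho : ∀ w, Λ.Fits K t ((outputs p w).bit i).vars := by
    intro w
    simp only [outputs]
    split_ifs
    · exact fits_singleton ⟨hi, Or.inl h⟩
    · exact fits_empty
  cases e with
  | var v =>
    simp only [RingExpr.output]
    split_ifs
    · exact fits_singleton ⟨hi, h⟩
    · exact fits_empty
  | zero => exact fits_empty
  | one => exact fits_empty
  | add a b => exact ho _
  | mul a b => exact ho _

end Fits

theorem mul_fold_le_horizon {i j : ℕ} (hj : j ≤ Λ.k) :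
    Λ.period * fold Λ.k i + j ≤ Λ.horizon := by
  have h1 : fold Λ.k i ≤ Λ.k := by unfold fold; omega
  have h2 : Λ.period * fold Λ.k i ≤ Λ.period * Λ.k := Nat.mul_le_mul_left _ h1
  unfold horizon
  rw [Nat.mul_succ]
  have : Λ.period = Λ.k + 2 := rfl
  omega

/-! ### Column equations that follow from constraints inside bags -/

section Columns

variable {𝒢 : Set (Constraint BVar)} {K : Clause BVar} {τ : BVar → Bool} {n : ℕ} {p : Addr}
  {a b : RingExpr}

theorem Model.ripple_column (hτ : Λ.Model 𝒢 K τ)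
    (hg : (RingExpr.add a b).circuit n p ⊆ 𝒢) {i : ℕ} (hi : i ≤ Λ.k) :
    (a.output n (false :: p)).digits τ i + (b.output n (true :: p)).digits τ i +
      carriesIn (rippleCarries τ p (max (a.output n (false :: p)).length
        (b.output n (true :: p)).length)) i =
      2 * rippleCarries τ p (max (a.output n (false :: p)).length
        (b.output n (true :: p)).length) i + ((RingExpr.add a b).output n p).digits τ i := by
  refine ArrayMul.ripple_column
    (fun i hi => RingExpr.bit_of_length_le ((le_max_left _ _).trans hi))
    (fun i hi => RingExpr.bit_of_length_le ((le_max_right _ _).trans hi)) fun hiw g hgi => ?_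
  refine hτ.holds g (hg (Or.inr (adder_subset_ripple hiw hgi))) (Λ.period * fold Λ.k i)
    (mul_fold_le_horizon (Nat.zero_le _)) (fits_adder ?_ ?_ ?_ ?_ ?_ g hgi)
  all_goals have hself : Near Λ.reach (fold Λ.k i) ((Λ.period * fold Λ.k i) / Λ.period) := by
              rw [mul_div_period]; constructor <;> omega
  · exact fits_bit hi hself
  · exact fits_bit hi hself
  · rcases i with _ | i
    · exact fits_empty
    · refine fits_singleton ⟨by omega, ?_⟩
      rw [mul_div_period]
      unfold Near fold reach
      omega
  · exact fits_singleton ⟨hi, hself⟩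
  · exact fits_singleton ⟨hi, Or.inl hself⟩

/-- Cell `(i, j)` is visited together with folded position `fold k i`. Its neighbours have first
index `i` or `i ± 1`, so they are at distance at most one. As `i + j` is between `k - δ` and `k`,
the folded positions of `i` and `j` differ by at most `δ`, and both operand bits are alive. The
output bit may be produced far from its own folded column; for this reason the output bits of the
strip are alive at all times. -/
theorem Model.strip_multiplier_column (hτ : Λ.Model 𝒢 K τ) (hn : 1 ≤ n) (hdeg : Λ.deg p = 2)
    (hg : (RingExpr.mul a b).circuit n p ⊆ 𝒢) {i₀ : ℕ} (hlo : Λ.lo ≤ i₀) (hi₀ : i₀ ≤ Λ.k) :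
    conv ((a.output n (false :: p)).digits τ) ((b.output n (true :: p)).digits τ) i₀ +
      carriesIn (arrayCarries τ p (max (a.output n (false :: p)).length
        (b.output n (true :: p)).length)) i₀ =
      2 * arrayCarries τ p (max (a.output n (false :: p)).length
        (b.output n (true :: p)).length) i₀ + ((RingExpr.mul a b).output n p).digits τ i₀ := by
  have hla := a.le_length n (false :: p)
  have hcell : ∀ i j i', i + j ≤ Λ.k → Λ.lo ≤ i + j + 1 → Near 1 (fold Λ.k i) (fold Λ.k i') →
      Λ.CellAlive (Λ.period * fold Λ.k i') p i j := by
    intro i j i' h1 h2 h3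
    refine ⟨h1, ?_⟩
    rw [if_pos hdeg, mul_div_period]
    exact ⟨h2, h3⟩
  refine multiplier_column (by omega)
    (fun i hi => RingExpr.bit_of_length_le ((le_max_left _ _).trans hi))
    (fun i hi => RingExpr.bit_of_length_le ((le_max_right _ _).trans hi)) ?_ ?_ ?_
  · intro i j hi hj hij
    refine hτ.holds _ (hg (Or.inr (andGate_mem_array hi hj))) (Λ.period * fold Λ.k i)
      (mul_fold_le_horizon (Nat.zero_le _)) (((fits_bit ?_ ?_).union (fits_bit ?_ ?_)).union
        (fits_singleton (hcell i j i ?_ ?_ ?_)))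
    all_goals try rw [mul_div_period]
    all_goals simp only [lo] at hlo
    all_goals try simp only [Near, fold, reach, lo]
    all_goals omega
  · intro i j hi hj hij g hgi
    refine hτ.holds g (hg (Or.inr (adder_subset_array hi hj hgi))) (Λ.period * fold Λ.k i)
      (mul_fold_le_horizon (Nat.zero_le _)) (fits_adder ?_ ?_ ?_ ?_ ?_ g hgi)
    all_goals have hself : Near 1 (fold Λ.k i) (fold Λ.k i) := by constructor <;> omega
    · unfold tabIn
      split_ifs
      · exact fits_singleton (hcell i j i (by omega) (by omega) hself)
      · exact fits_empty
    · rcases j with _ | j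
      · exact fits_empty
      · unfold sumIn
        split_ifs
        · exact fits_singleton (Or.inl (hcell (i + 1) j i (by omega) (by omega)
            (by unfold Near fold; omega)))
        · exact fits_empty
    · rcases i with _ | i
      · exact fits_empty
      · exact fits_singleton (hcell i j (i + 1) (by omega) (by omega)
          (by unfold Near fold; omega))
    · exact fits_singleton (hcell i j i (by omega) (by omega) hself)
    · exact fits_singleton (Or.inl (hcell i j i (by omega) (by omega) hself))
  · intro hk
    obtain ⟨i, j, hij, hao⟩ : ∃ i j, i + j = i₀ ∧ arrayOut p (max (a.output n (false :: p)).length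
        (b.output n (true :: p)).length) i₀ = .sum p i j := by
      unfold arrayOut
      split_ifs
      · exact ⟨0, i₀, by omega, rfl⟩
      · exact ⟨_, _, by omega, rfl⟩
    rw [hao]
    refine hτ.holds _ (hg (Or.inr (hao ▸ eqGate_mem_array hk))) (Λ.period * fold Λ.k i)
      (mul_fold_le_horizon (Nat.zero_le _)) ((fits_singleton (u := .sum p i j) (Or.inl (hcell i j i
        (by omega) (by omega) (by constructor <;> omega)))).union (fits_singleton ⟨hi₀, Or.inr hlo⟩))

/-- Here a cell is visited at the folded position of its column `i + j`. With a constant first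
operand, all cells with `i > Λ.c` are fixed, and those with `i ≤ Λ.c` use operand bits at most `Λ.c`
columns away. With a constant second operand, the rows `j ≥ Λ.c` have no carries and only hand a sum
bit down the column. Such a chain may have up to `k` links, too many for one bag, so row `j` is
treated at step `j` of the period, when only two consecutive links are alive. -/
theorem Model.const_multiplier_column (hτ : Λ.Model 𝒢 K τ) (hn : 1 ≤ n) (hK : UnitClosed 𝒢 K)
    (hdeg : Λ.deg p ≠ 2) (hg : (RingExpr.mul a b).circuit n p ⊆ 𝒢)
    (hconst : (∀ i, ((a.output n (false :: p)).bit i).Fixed K ∧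
        (Λ.c ≤ i → ((a.output n (false :: p)).bit i).FixedZero K)) ∨
      ∀ i, ((b.output n (true :: p)).bit i).Fixed K ∧
        (Λ.c ≤ i → ((b.output n (true :: p)).bit i).FixedZero K)) {i₀ : ℕ} (hi₀ : i₀ ≤ Λ.k) :
    conv ((a.output n (false :: p)).digits τ) ((b.output n (true :: p)).digits τ) i₀ +
      carriesIn (arrayCarries τ p (max (a.output n (false :: p)).length
        (b.output n (true :: p)).length)) i₀ =
      2 * arrayCarries τ p (max (a.output n (false :: p)).length
        (b.output n (true :: p)).length) i₀ + ((RingExpr.mul a b).output n p).digits τ i₀ := by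
  have hla := a.le_length n (false :: p)
  have hga : arrayMultiplier p _ (a.output n (false :: p)) (b.output n (true :: p)) ⊆ 𝒢 :=
    fun g h => hg (Or.inr h)
  set w := max (a.output n (false :: p)).length (b.output n (true :: p)).length with hw
  have hcell : ∀ i j t, i + j ≤ Λ.k → (i ≤ Λ.c ∨ j ≤ Λ.c) →
      Near Λ.reach (fold Λ.k (i + j)) (t / Λ.period) → Λ.CellAlive t p i j := by
    intro i j t h1 h2 h3
    refine ⟨h1, ?_⟩
    rw [if_neg hdeg]
    exact ⟨h2, h3⟩
  have hwire : ∀ i j t, i + j ≤ Λ.k → Λ.period * fold Λ.k (i + j) + j ≤ t →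
      t ≤ Λ.period * fold Λ.k (i + j) + j + 1 → Λ.Alive t (.sum p i j) :=
    fun i j t h1 h2 h3 => Or.inr ⟨h1, hdeg, h2, h3⟩
  refine multiplier_column (by omega)
    (fun i hi => RingExpr.bit_of_length_le ((le_max_left _ _).trans hi))
    (fun i hi => RingExpr.bit_of_length_le ((le_max_right _ _).trans hi)) ?_ ?_ ?_
  · intro i j hi hj hij
    rcases hconst with hx | hy
    · by_cases hc : Λ.c ≤ i
      · refine hτ.holds _ (hga (andGate_mem_array hi hj)) (Λ.period * fold Λ.k j)
          (mul_fold_le_horizon (Nat.zero_le _)) (((fits_of_fixed (hx i).1).union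
            (fits_bit (by omega) ?_)).union (fits_of_fixed
              (hK.fixedZero_and_left (hga (andGate_mem_array hi hj)) ((hx i).2 hc)).1))
        rw [mul_div_period]
        constructor <;> omega
      · refine hτ.holds _ (hga (andGate_mem_array hi hj)) (Λ.period * fold Λ.k (i + j))
          (mul_fold_le_horizon (Nat.zero_le _)) (((fits_of_fixed (hx i).1).union
            (fits_bit (by omega) ?_)).union (fits_singleton (hcell i j _ (by omega)
              (by omega) ?_)))
        all_goals rw [mul_div_period]; simp only [Near, fold, reach]; omega
    · by_cases hc : Λ.c ≤ j
      · refine hτ.holds _ (hga (andGate_mem_array hi hj)) (Λ.period * fold Λ.k i)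
          (mul_fold_le_horizon (Nat.zero_le _)) (((fits_bit (by omega) ?_).union
            (fits_of_fixed (hy j).1)).union (fits_of_fixed
              (hK.fixedZero_and_right (hga (andGate_mem_array hi hj)) ((hy j).2 hc)).1))
        rw [mul_div_period]
        constructor <;> omega
      · refine hτ.holds _ (hga (andGate_mem_array hi hj)) (Λ.period * fold Λ.k (i + j))
          (mul_fold_le_horizon (Nat.zero_le _)) (((fits_bit (by omega) ?_).union
            (fits_of_fixed (hy j).1)).union (fits_singleton (hcell i j _ (by omega)
              (by omega) ?_)))
        all_goals rw [mul_div_period]; simp only [Near, fold, reach]; omega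
  · intro i j hi hj hij g hgi
    have hnear : ∀ i', i' = i + j ∨ i' + 1 = i + j →
        Near Λ.reach (fold Λ.k i') ((Λ.period * fold Λ.k (i + j)) / Λ.period) := by
      intro i' h
      rw [mul_div_period]
      simp only [Near, fold, reach]
      omega
    have hgm := hga (adder_subset_array hi hj hgi)
    rcases hconst with hx | hy
    · have hz := hK.fixedZero_of_left hga fun i hc => (hx i).2 hc
      by_cases hc : i ≤ Λ.c
      · refine hτ.holds g hgm (Λ.period * fold Λ.k (i + j))
          (mul_fold_le_horizon (Nat.zero_le _)) (fits_adder ?_ ?_ ?_ ?_ ?_ g hgi)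
        · unfold tabIn
          split_ifs
          · exact fits_singleton (hcell i j _ (by omega) (by omega) (hnear _ (by omega)))
          · exact fits_empty
        · rcases j with _ | j
          · exact fits_empty
          · unfold sumIn
            split_ifs with hiw
            · by_cases hc' : i + 1 ≤ Λ.c
              · exact fits_singleton (Or.inl (hcell (i + 1) j _ (by omega) (by omega)
                  (hnear _ (by omega))))
              · exact fits_of_fixed ((hz j (by omega) (i + 1) hiw).2.2 (by omega)).1
            · exact fits_empty
        · rcases i with _ | i
          · exact fits_empty
          · exact fits_singleton (hcell i j _ (by omega) (by omega) (hnear _ (by omega)))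
        · exact fits_singleton (hcell i j _ (by omega) (by omega) (hnear _ (by omega)))
        · exact fits_singleton (Or.inl (hcell i j _ (by omega) (by omega) (hnear _ (by omega))))
      · refine hτ.holds g hgm 0 (Nat.zero_le _) (fits_adder ?_ ?_ ?_ ?_ ?_ g hgi)
        · exact fits_of_fixed ((hz j hj i hi).1 (by omega)).1
        · rcases j with _ | j
          · exact fits_empty
          · unfold sumIn
            split_ifs with hiw
            · exact fits_of_fixed ((hz j (by omega) (i + 1) hiw).2.2 (by omega)).1
            · exact fits_empty
        · rcases i with _ | i
          · exact fits_empty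
          · exact fits_of_fixed ((hz j hj i (by omega)).2.1 (by omega)).1
        · exact fits_of_fixed (s := .var _) ((hz j hj i hi).2.1 (by omega)).1
        · exact fits_of_fixed (s := .var _) ((hz j hj i hi).2.2 (by omega)).1
    · by_cases hc : Λ.c ≤ j
      · have hz := hK.fixedZero_of_right hga (fun i hc => (hy i).2 hc) j hj hc
        refine hτ.holds g hgm (Λ.period * fold Λ.k (i + j) + j)
          (mul_fold_le_horizon (by omega)) (fits_adder ?_ ?_ ?_ ?_ ?_ g hgi)
        · exact fits_of_fixed (hz i hi).1.1
        · rcases j with _ | j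
          · exact fits_empty
          · unfold sumIn
            split_ifs
            -- The incoming link belongs to the previous row of the same column. It is alive for one
            -- step after its own, which is the current step.
            · refine fits_singleton (hwire (i + 1) j _ (by omega) ?_ ?_)
              all_goals rw [show i + 1 + j = i + (j + 1) by omega]; omega
            · exact fits_empty
        · rcases i with _ | i
          · exact fits_empty
          · exact fits_of_fixed (hz i (by omega)).2.1
        · exact fits_of_fixed (s := .var _) (hz i hi).2.1
        · exact fits_singleton (hwire i j _ (by omega) le_rfl (by omega))
      · refine hτ.holds g hgm (Λ.period * fold Λ.k (i + j))
          (mul_fold_le_horizon (Nat.zero_le _)) (fits_adder ?_ ?_ ?_ ?_ ?_ g hgi)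
        · unfold tabIn
          split_ifs
          · exact fits_singleton (hcell i j _ (by omega) (by omega) (hnear _ (by omega)))
          · exact fits_empty
        · rcases j with _ | j
          · exact fits_empty
          · unfold sumIn
            split_ifs with hiw
            · exact fits_singleton (Or.inl (hcell (i + 1) j _ (by omega) (by omega)
                (hnear _ (by omega))))
            · exact fits_empty
        · rcases i with _ | i
          · exact fits_empty
          · exact fits_singleton (hcell i j _ (by omega) (by omega) (hnear _ (by omega)))
        · exact fits_singleton (hcell i j _ (by omega) (by omega) (hnear _ (by omega)))
        · exact fits_singleton (Or.inl (hcell i j _ (by omega) (by omega) (hnear _ (by omega))))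
  · intro hk
    obtain ⟨i, j, hij, hao⟩ : ∃ i j, i + j = i₀ ∧ arrayOut p w i₀ = .sum p i j := by
      unfold arrayOut
      split_ifs
      · exact ⟨0, i₀, by omega, rfl⟩
      · exact ⟨_, _, by omega, rfl⟩
    rw [hao]
    refine hτ.holds _ (hg (Or.inr (hao ▸ eqGate_mem_array hk)))
      (Λ.period * fold Λ.k (i + j) + j) (mul_fold_le_horizon (by omega))
      ((fits_singleton (hwire i j _ (by omega) le_rfl (by omega))).union
        (fits_singleton ⟨hi₀, Or.inl ?_⟩))
    -- The last link is reached late in the period, but division by the period still gives the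
    -- folded column of the output bit.
    rw [mul_add_div_period (by unfold period; omega), hij]
    constructor <;> omega

end Columns

end Layout

/-! ### The critical strip is contradictory -/

/-- `deg` gives the degrees of the subexpressions of the expression at `p`. -/
def RingExpr.Labels (deg : Addr → ℕ) : Addr → RingExpr → Prop
  | p, .add a b =>
    deg p = max a.degree b.degree ∧ a.Labels deg (false :: p) ∧ b.Labels deg (true :: p)
  | p, .mul a b =>
    deg p = a.degree + b.degree ∧ a.Labels deg (false :: p) ∧ b.Labels deg (true :: p)
  | _, _ => True

/-- The operands of an expression. -/
def RingExpr.child : Bool → RingExpr → RingExpr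
  | false, .add a _ => a
  | true, .add _ b => b
  | false, .mul a _ => a
  | true, .mul _ b => b
  | _, _ => .zero

/-- The subexpression at a position. -/
def nodeAt (L R : RingExpr) : Addr → RingExpr
  | [] => .zero
  | [b] => if b then R else L
  | b :: c :: p => (nodeAt L R (c :: p)).child b

theorem nodeAt_cons (L R : RingExpr) (b : Bool) {p : Addr} (hp : p ≠ []) :
    nodeAt L R (b :: p) = (nodeAt L R p).child b := by
  cases p with
  | nil => exact absurd rfl hp
  | cons c p => rfl

theorem labels_nodeAt (L R : RingExpr) {p : Addr} (hp : p ≠ []) {e : RingExpr}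
    (he : nodeAt L R p = e) : e.Labels (fun q => (nodeAt L R q).degree) p := by
  induction e generalizing p with
  | var v => trivial
  | zero => trivial
  | one => trivial
  | add a b iha ihb =>
    exact ⟨congrArg RingExpr.degree he, iha (by simp) (by rw [nodeAt_cons _ _ _ hp, he]; rfl),
      ihb (by simp) (by rw [nodeAt_cons _ _ _ hp, he]; rfl)⟩
  | mul a b iha ihb =>
    exact ⟨congrArg RingExpr.degree he, iha (by simp) (by rw [nodeAt_cons _ _ _ hp, he]; rfl),
      ihb (by simp) (by rw [nodeAt_cons _ _ _ hp, he]; rfl)⟩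

/-- The values of the ring variables modulo `2 ^ (k + 1)`. -/
def inputValue (τ : BVar → Bool) (n k v : ℕ) : ZMod (2 ^ (k + 1)) :=
  (strip 0 k (((RingExpr.var v).output n []).digits τ) : ℕ)

/-- A bound for the error that arises if only the critical strip of the circuit is considered. -/
def RingExpr.errorBound (c : ℕ) : RingExpr → ℕ
  | .var _ => 1
  | .zero => 1
  | .one => 1
  | .add a b => a.errorBound c + b.errorBound c + 1
  | .mul a b => 2 ^ c * (a.errorBound c + b.errorBound c + 1) + 1

theorem RingExpr.one_le_errorBound (c : ℕ) (e : RingExpr) : 1 ≤ e.errorBound c := by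
  cases e <;> simp [RingExpr.errorBound]

theorem RingExpr.constBits_le_mul {a b : RingExpr} {c : ℕ} (h : (a.mul b).constBits ≤ c) :
    a.constBits ≤ c ∧ b.constBits ≤ c := by
  simp only [RingExpr.constBits] at h
  omega

theorem RingExpr.constBits_le_add {a b : RingExpr} {c : ℕ} (h : (a.add b).constBits ≤ c) :
    a.constBits ≤ c ∧ b.constBits ≤ c := by
  simp only [RingExpr.constBits] at h
  omega

namespace Layout

variable {Λ : Layout} {𝒢 : Set (Constraint BVar)} {K : Clause BVar} {τ : BVar → Bool} {n : ℕ}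

/-- Linear subexpressions are computed correctly modulo `2 ^ (k + 1)`. -/
theorem Model.strip_zero_eq_eval (hτ : Λ.Model 𝒢 K τ) (hn : 1 ≤ n) (hK : UnitClosed 𝒢 K)
    {e : RingExpr} {p : Addr} (hlab : e.Labels Λ.deg p) (hdeg : e.degree ≤ 1)
    (hc : e.constBits ≤ Λ.c) (hg : e.circuit n p ⊆ 𝒢) :
    (strip 0 Λ.k ((e.output n p).digits τ) : ZMod (2 ^ (Λ.k + 1))) =
      e.eval (inputValue τ n Λ.k) := by
  induction e generalizing p with
  | var v => rfl
  | zero =>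
    simp [strip, BitVector.digits, RingExpr.output, Signal.val, RingExpr.eval]
  | one => rw [strip_zero_digits_one hn]; simp [RingExpr.eval]
  | add a b iha ihb =>
    have hd : a.degree ≤ 1 ∧ b.degree ≤ 1 := by simpa [RingExpr.degree] using hdeg
    have hc' := RingExpr.constBits_le_add hc
    have ha := iha hlab.2.1 hd.1 hc'.1 fun g h => hg (Or.inl (Or.inl h))
    have hb := ihb hlab.2.2 hd.2 hc'.2 fun g h => hg (Or.inl (Or.inr h))
    rw [strip_zero_columns fun i hi => hτ.ripple_column hg hi, strip_add]
    push_cast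
    rw [ha, hb]
    rfl
  | mul a b iha ihb =>
    have hd : a.degree + b.degree ≤ 1 := hdeg
    have hc' := RingExpr.constBits_le_mul hc
    have hga : a.circuit n (false :: p) ⊆ 𝒢 := fun g h => hg (Or.inl (Or.inl h))
    have hgb : b.circuit n (true :: p) ⊆ 𝒢 := fun g h => hg (Or.inl (Or.inr h))
    have ha := iha hlab.2.1 (by omega) hc'.1 hga
    have hb := ihb hlab.2.2 (by omega) hc'.2 hgb
    have hconst : (∀ i, ((a.output n (false :: p)).bit i).Fixed K ∧
        (Λ.c ≤ i → ((a.output n (false :: p)).bit i).FixedZero K)) ∨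
        ∀ i, ((b.output n (true :: p)).bit i).Fixed K ∧
        (Λ.c ≤ i → ((b.output n (true :: p)).bit i).FixedZero K) := by
      rcases Nat.eq_zero_or_pos a.degree with h0 | h0
      · exact Or.inl fun i => ⟨(hK.degree_zero hn h0 hga).1 i,
          fun hi => hK.fixedZero_bit hn h0 hga (by omega)⟩
      · have h0 : b.degree = 0 := by omega
        exact Or.inr fun i => ⟨(hK.degree_zero hn h0 hgb).1 i,
          fun hi => hK.fixedZero_bit hn h0 hgb (by omega)⟩
    rw [strip_zero_columns fun i hi => hτ.const_multiplier_column hn hK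
      (by rw [hlab.1]; omega) hg hconst hi, natCast_strip_zero_conv, ha, hb]
    rfl

theorem lo_le : Λ.lo ≤ Λ.k := Nat.sub_le _ _

theorem carriesIn_ripple_le {p : Addr} {w a : ℕ} : carriesIn (rippleCarries τ p w) a ≤ a := by
  rcases a with _ | a
  · exact le_rfl
  · simp only [carriesIn, rippleCarries]
    split_ifs
    · exact (Bool.toNat_le _).trans (by omega)
    · exact Nat.zero_le _

theorem carriesIn_array_le {p : Addr} {w a : ℕ} : carriesIn (arrayCarries τ p w) a ≤ a := by
  rcases a with _ | a
  · exact le_rfl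
  · exact arrayCarries_le τ p w a

/-- Quadratic subexpressions are computed approximately in the critical strip. -/
theorem Model.approx_eval (hτ : Λ.Model 𝒢 K τ) (hn : 1 ≤ n) (hK : UnitClosed 𝒢 K)
    {e : RingExpr} {p : Addr} (hlab : e.Labels Λ.deg p) (hdeg : e.degree ≤ 2)
    (hc : e.constBits ≤ Λ.c) (hg : e.circuit n p ⊆ 𝒢) :
    Approx Λ.lo Λ.k (e.errorBound Λ.c) (strip Λ.lo Λ.k ((e.output n p).digits τ))
      (e.eval (inputValue τ n Λ.k)) := by
  by_cases hdeg1 : e.degree ≤ 1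
  · exact (Approx.of_exact lo_le (sum_low_digits_le (BitVector.digits_le_one τ _) _)
      (hτ.strip_zero_eq_eval hn hK hlab hdeg1 hc hg)).mono (e.one_le_errorBound _)
  induction e generalizing p with
  | var v => simp [RingExpr.degree] at hdeg1
  | zero => simp [RingExpr.degree] at hdeg1
  | one => simp [RingExpr.degree] at hdeg1
  | add a b iha ihb =>
    have hd : a.degree ≤ 2 ∧ b.degree ≤ 2 := by simpa [RingExpr.degree] using hdeg
    have hc' := RingExpr.constBits_le_add hc
    have hga : a.circuit n (false :: p) ⊆ 𝒢 := fun g h => hg (Or.inl (Or.inl h))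
    have hgb : b.circuit n (true :: p) ⊆ 𝒢 := fun g h => hg (Or.inl (Or.inr h))
    -- A summand of a quadratic expression may itself have degree at most one. The induction
    -- hypothesis does not cover it, but its exact value does.
    have key : ∀ (e : RingExpr) (p : Addr), (¬ e.degree ≤ 1 → Approx Λ.lo Λ.k (e.errorBound Λ.c)
        (strip Λ.lo Λ.k ((e.output n p).digits τ)) (e.eval (inputValue τ n Λ.k))) →
        e.Labels Λ.deg p → e.constBits ≤ Λ.c → e.circuit n p ⊆ 𝒢 →
        Approx Λ.lo Λ.k (e.errorBound Λ.c)
        (strip Λ.lo Λ.k ((e.output n p).digits τ)) (e.eval (inputValue τ n Λ.k)) := by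
      intro e p h h1 h2 h3
      by_cases hd : e.degree ≤ 1
      · exact (Approx.of_exact lo_le (sum_low_digits_le (BitVector.digits_le_one τ _) _)
          (hτ.strip_zero_eq_eval hn hK h1 hd h2 h3)).mono (e.one_le_errorBound _)
      · exact h hd
    have ha := key a _ (iha hlab.2.1 hd.1 hc'.1 hga) hlab.2.1 hc'.1 hga
    have hb := key b _ (ihb hlab.2.2 hd.2 hc'.2 hgb) hlab.2.2 hc'.2 hgb
    refine Approx.columns lo_le (fun i _ hi => hτ.ripple_column hg hi) carriesIn_ripple_le ?_
    rw [strip_add]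
    exact ha.add hb
  | mul a b iha ihb =>
    have hd : a.degree + b.degree = 2 := by
      have h1 : a.degree + b.degree ≤ 2 := hdeg
      have h2 : ¬ a.degree + b.degree ≤ 1 := hdeg1
      omega
    have hc' := RingExpr.constBits_le_mul hc
    have hga : a.circuit n (false :: p) ⊆ 𝒢 := fun g h => hg (Or.inl (Or.inl h))
    have hgb : b.circuit n (true :: p) ⊆ 𝒢 := fun g h => hg (Or.inl (Or.inr h))
    have hsmall : ∀ (e : RingExpr) (p : Addr), e.degree = 0 → e.constBits ≤ Λ.c →
        e.circuit n p ⊆ 𝒢 → strip 0 Λ.k ((e.output n p).digits τ) ≤ 2 ^ Λ.c :=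
      fun e p h1 h2 h3 => ((hK.degree_zero hn h1 h3).2 τ hτ.falsifies Λ.k).le.trans
        (Nat.pow_le_pow_right (by norm_num) h2)
    refine Approx.columns lo_le (fun i hlo hi => hτ.strip_multiplier_column hn
      (hlab.1.trans hd) hg hlo hi) carriesIn_array_le ?_
    have hpow : 1 ≤ 2 ^ Λ.c := Nat.one_le_two_pow
    -- Either one factor is constant and the other quadratic, and the error is scaled; or both are
    -- linear and exact, and the only error in the product digits comes from the dropped low
    -- columns.
    by_cases ha0 : a.degree = 0
    · have hb := ihb hlab.2.2 (by omega) hc'.2 hgb (by omega)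
      refine (Approx.conv_const lo_le (BitVector.digits_le_one τ _) (hsmall a _ ha0 hc'.1 hga)
        (hτ.strip_zero_eq_eval hn hK hlab.2.1 (by omega) hc'.1 hga) hb).mono ?_
      exact Nat.mul_le_mul_left _ (by omega)
    · by_cases hb0 : b.degree = 0
      · have ha := iha hlab.2.1 (by omega) hc'.1 hga (by omega)
        rw [conv_comm, RingExpr.eval, mul_comm (a.eval _)]
        refine (Approx.conv_const lo_le (BitVector.digits_le_one τ _) (hsmall b _ hb0 hc'.2 hgb)
          (hτ.strip_zero_eq_eval hn hK hlab.2.2 (by omega) hc'.2 hgb) ha).mono ?_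
        exact Nat.mul_le_mul_left _ (by omega)
      · refine (Approx.of_exact lo_le (sum_low_conv_le (BitVector.digits_le_one τ _)
          (BitVector.digits_le_one τ _) _) ?_).mono (C := 1) (Nat.mul_pos hpow (by omega))
        rw [natCast_strip_zero_conv,
          hτ.strip_zero_eq_eval hn hK hlab.2.1 (by omega) hc'.1 hga,
          hτ.strip_zero_eq_eval hn hK hlab.2.2 (by omega) hc'.2 hgb]
        rfl

/-- The outputs of the circuits for the two sides of an identity cannot differ for the first time
in the critical column. -/
theorem Model.false_of_first_difference (hτ : Λ.Model 𝒢 K τ) (hn : 1 ≤ n) (hK : UnitClosed 𝒢 K)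
    {L R : RingExpr} (hLR : RingIdentity L R) (hL : L.degree ≤ 2) (hR : R.degree ≤ 2)
    {p q : Addr} (hlabL : L.Labels Λ.deg p) (hlabR : R.Labels Λ.deg q)
    (hcL : L.constBits ≤ Λ.c) (hcR : R.constBits ≤ Λ.c)
    (hgL : L.circuit n p ⊆ 𝒢) (hgR : R.circuit n q ⊆ 𝒢)
    (hbound : (L.errorBound Λ.c + R.errorBound Λ.c) * Λ.k < 2 ^ Λ.δ)
    (hlow : ∀ i < Λ.k, Λ.lo ≤ i → ((L.output n p).bit i).val τ = ((R.output n q).bit i).val τ)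
    (hdiff : ((L.output n p).bit Λ.k).val τ ≠ ((R.output n q).bit Λ.k).val τ) : False := by
  refine not_approx_of_differ (x := (L.output n p).digits τ) (y := (R.output n q).digits τ)
    lo_le (fun i h1 h2 => congrArg Bool.toNat (hlow i h2 h1)) ?_ ?_
    (hτ.approx_eval hn hK hlabL hL hcL hgL)
    (hLR.eval_eq (inputValue τ n Λ.k) ▸ hτ.approx_eval hn hK hlabR hR hcR hgR)
  · revert hdiff
    unfold BitVector.digits
    cases ((L.output n p).bit Λ.k).val τ <;> cases ((R.output n q).bit Λ.k).val τ <;> simp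
  -- If the strip reaches column `0`, the error bound is zero. Otherwise `k = δ + lo`, and the
  -- hypothesis on `δ` is multiplied by `2 ^ lo`.
  · rcases Nat.eq_zero_or_pos Λ.lo with h0 | h0
    · rw [h0]; simp
    · have hk : Λ.k = Λ.δ + Λ.lo := by unfold lo at *; omega
      calc (L.errorBound Λ.c + R.errorBound Λ.c) * (Λ.lo * 2 ^ Λ.lo)
          ≤ (L.errorBound Λ.c + R.errorBound Λ.c) * (Λ.k * 2 ^ Λ.lo) := by
            gcongr; exact lo_le
        _ = (L.errorBound Λ.c + R.errorBound Λ.c) * Λ.k * 2 ^ Λ.lo := by ring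
        _ < 2 ^ Λ.δ * 2 ^ Λ.lo := Nat.mul_lt_mul_of_pos_right hbound (by positivity)
        _ = 2 ^ Λ.k := by rw [← pow_add, ← hk]

end Layout

/-! ### Counting variables -/

/-- The variables of the inputs in `S` and the circuits at `A` with indices in `I` or index pairs
in `J`. -/
def varBox (A : Finset Addr) (S I : Finset ℕ) (J : Finset (ℕ × ℕ)) : Finset BVar :=
  (S ×ˢ I).image (fun q => .inp q.1 q.2) ∪
  ((A ×ˢ I).image (fun q => .out q.1 q.2) ∪ (A ×ˢ I).image (fun q => .rcarry q.1 q.2)) ∪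
  ((A ×ˢ J).image (fun q => .tab q.1 q.2.1 q.2.2) ∪ (A ×ˢ J).image (fun q => .car q.1 q.2.1 q.2.2) ∪
    (A ×ˢ J).image (fun q => .sum q.1 q.2.1 q.2.2))

theorem card_varBox_le (A : Finset Addr) (S I : Finset ℕ) (J : Finset (ℕ × ℕ)) :
    (varBox A S I J).card ≤ (S.card + A.card) * (2 * I.card + 3 * J.card) := by
  have hI : ∀ f : Addr × ℕ → BVar, ((A ×ˢ I).image f).card ≤ A.card * I.card := fun f =>
    card_image_le.trans (card_product _ _).le
  have hJ : ∀ f : Addr × ℕ × ℕ → BVar, ((A ×ˢ J).image f).card ≤ A.card * J.card := fun f =>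
    card_image_le.trans (card_product _ _).le
  have hS : ((S ×ˢ I).image (fun q => BVar.inp q.1 q.2)).card ≤ S.card * I.card :=
    card_image_le.trans (card_product _ _).le
  refine (card_union_le _ _).trans ?_
  refine (Nat.add_le_add (card_union_le _ _) (card_union_le _ _)).trans ?_
  refine (Nat.add_le_add (Nat.add_le_add hS (card_union_le _ _))
    (Nat.add_le_add (card_union_le _ _) (hJ _))).trans ?_
  refine (Nat.add_le_add (Nat.add_le_add le_rfl (Nat.add_le_add (hI _) (hI _)))
    (Nat.add_le_add (Nat.add_le_add (hJ _) (hJ _)) le_rfl)).trans ?_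
  nlinarith [Nat.zero_le (S.card * I.card), Nat.zero_le (S.card * J.card)]

section Mem

variable {A : Finset Addr} {S I : Finset ℕ} {J : Finset (ℕ × ℕ)} {p : Addr} {v i j : ℕ}

theorem inp_mem_varBox : .inp v i ∈ varBox A S I J ↔ v ∈ S ∧ i ∈ I := by simp [varBox]

theorem out_mem_varBox : .out p i ∈ varBox A S I J ↔ p ∈ A ∧ i ∈ I := by simp [varBox]

theorem rcarry_mem_varBox : .rcarry p i ∈ varBox A S I J ↔ p ∈ A ∧ i ∈ I := by simp [varBox]

theorem tab_mem_varBox : .tab p i j ∈ varBox A S I J ↔ p ∈ A ∧ (i, j) ∈ J := by simp [varBox]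

theorem car_mem_varBox : .car p i j ∈ varBox A S I J ↔ p ∈ A ∧ (i, j) ∈ J := by simp [varBox]

theorem sum_mem_varBox : .sum p i j ∈ varBox A S I J ↔ p ∈ A ∧ (i, j) ∈ J := by simp [varBox]

theorem neq_notMem_varBox : .neq i ∉ varBox A S I J := by simp [varBox]

end Mem

/-- The positions of the subexpressions that are not leaves. -/
def RingExpr.addrs : Addr → RingExpr → Finset Addr
  | p, .add a b => insert p (a.addrs (false :: p) ∪ b.addrs (true :: p))
  | p, .mul a b => insert p (a.addrs (false :: p) ∪ b.addrs (true :: p))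
  | _, _ => ∅

/-- The ring variables of an expression. -/
def RingExpr.varSet : RingExpr → Finset ℕ
  | .var v => {v}
  | .zero => ∅
  | .one => ∅
  | .add a b => a.varSet ∪ b.varSet
  | .mul a b => a.varSet ∪ b.varSet

/-- All variables with indices below `N`. -/
def allVars (A : Finset Addr) (S : Finset ℕ) (N : ℕ) : Finset BVar :=
  varBox A S (range N) (range N ×ˢ range N)

theorem RingExpr.bit_vars_subset {A : Finset Addr} {S : Finset ℕ} {n N : ℕ} {p : Addr}
    {e : RingExpr} (hA : e.addrs p ⊆ A) (hS : e.varSet ⊆ S) (hN : (e.output n p).length ≤ N)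
    (i : ℕ) : ((e.output n p).bit i).vars ⊆ allVars A S N := by
  have ho : ∀ w, w ≤ N → p ∈ A → ((outputs p w).bit i).vars ⊆ allVars A S N := by
    intro w hw hp
    simp only [outputs]
    split_ifs with hi
    · exact singleton_subset_iff.2 (out_mem_varBox.2 ⟨hp, mem_range.2 (by omega)⟩)
    · exact empty_subset _
  cases e with
  | var v =>
    simp only [RingExpr.output] at hN ⊢
    split_ifs with hi
    · exact singleton_subset_iff.2 (inp_mem_varBox.2
        ⟨hS (mem_singleton_self v), mem_range.2 (by omega)⟩)
    · exact empty_subset _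
  | zero => exact empty_subset _
  | one => exact empty_subset _
  | add a b => exact ho _ hN (hA (mem_insert_self _ _))
  | mul a b => exact ho _ hN (hA (mem_insert_self _ _))

theorem adder_vars_subset {W : Finset BVar} {x y z : Signal} {c d : BVar} (hx : x.vars ⊆ W)
    (hy : y.vars ⊆ W) (hz : z.vars ⊆ W) (hc : c ∈ W) (hd : d ∈ W) :
    ∀ g ∈ adder x y z c d, g.vars ⊆ W := by
  rintro g (rfl | rfl)
  · exact union_subset (union_subset (union_subset hx hy) hz) (singleton_subset_iff.2 hc)
  · exact union_subset (union_subset (union_subset hx hy) hz) (singleton_subset_iff.2 hd)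

theorem RingExpr.circuit_vars_subset {A : Finset Addr} {S : Finset ℕ} {n N : ℕ} (hn : 1 ≤ n)
    {p : Addr} {e : RingExpr} (hA : e.addrs p ⊆ A) (hS : e.varSet ⊆ S)
    (hN : (e.output n p).length ≤ N) : ∀ g ∈ e.circuit n p, g.vars ⊆ allVars A S N := by
  induction e generalizing p with
  | var v => exact fun g hg => hg.elim
  | zero => exact fun g hg => hg.elim
  | one => exact fun g hg => hg.elim
  | add a b iha ihb =>
    have hp : p ∈ A := hA (mem_insert_self _ _)
    have hAa : a.addrs (false :: p) ⊆ A := fun q hq => hA (mem_insert_of_mem (mem_union_left _ hq))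
    have hAb : b.addrs (true :: p) ⊆ A := fun q hq => hA (mem_insert_of_mem (mem_union_right _ hq))
    have hSa : a.varSet ⊆ S := subset_union_left.trans hS
    have hSb : b.varSet ⊆ S := subset_union_right.trans hS
    simp only [RingExpr.output, outputs] at hN
    rintro g ((hg | hg) | ⟨i, hi, hg⟩)
    · exact iha hAa hSa (by omega) g hg
    · exact ihb hAb hSb (by omega) g hg
    · refine adder_vars_subset (bit_vars_subset hAa hSa (by omega) i)
        (bit_vars_subset hAb hSb (by omega) i) ?_ ?_ ?_ g hg
      · rcases i with _ | i
        · exact empty_subset _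
        · exact singleton_subset_iff.2 (rcarry_mem_varBox.2 ⟨hp, mem_range.2 (by omega)⟩)
      · exact rcarry_mem_varBox.2 ⟨hp, mem_range.2 (by omega)⟩
      · exact out_mem_varBox.2 ⟨hp, mem_range.2 (by omega)⟩
  | mul a b iha ihb =>
    have hp : p ∈ A := hA (mem_insert_self _ _)
    have hAa : a.addrs (false :: p) ⊆ A := fun q hq => hA (mem_insert_of_mem (mem_union_left _ hq))
    have hAb : b.addrs (true :: p) ⊆ A := fun q hq => hA (mem_insert_of_mem (mem_union_right _ hq))
    have hSa : a.varSet ⊆ S := subset_union_left.trans hS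
    have hSb : b.varSet ⊆ S := subset_union_right.trans hS
    have hla := a.le_length n (false :: p)
    simp only [RingExpr.output, outputs] at hN
    have hJ : ∀ i j, i ≤ max (a.output n (false :: p)).length (b.output n (true :: p)).length →
        j < max (a.output n (false :: p)).length (b.output n (true :: p)).length →
        p ∈ A ∧ (i, j) ∈ range N ×ˢ range N := fun i j hi hj =>
      ⟨hp, mem_product.2 ⟨mem_range.2 (by omega), mem_range.2 (by omega)⟩⟩
    rintro g ((hg | hg) | (⟨i, hi, j, hj, rfl⟩ | ⟨i, hi, j, hj, hg⟩) | ⟨k, hk, rfl⟩)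
    · exact iha hAa hSa (by omega) g hg
    · exact ihb hAb hSb (by omega) g hg
    · exact union_subset (union_subset (bit_vars_subset hAa hSa (by omega) i)
        (bit_vars_subset hAb hSb (by omega) j))
        (singleton_subset_iff.2 (tab_mem_varBox.2 (hJ i j (by omega) hj)))
    · refine adder_vars_subset ?_ ?_ ?_ (car_mem_varBox.2 (hJ i j hi hj))
        (sum_mem_varBox.2 (hJ i j hi hj)) g hg
      · unfold tabIn
        split_ifs
        · exact singleton_subset_iff.2 (tab_mem_varBox.2 (hJ i j hi hj))
        · exact empty_subset _
      · rcases j with _ | j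
        · exact empty_subset _
        · unfold sumIn
          split_ifs
          · exact singleton_subset_iff.2 (sum_mem_varBox.2 (hJ (i + 1) j (by omega) (by omega)))
          · exact empty_subset _
      · rcases i with _ | i
        · exact empty_subset _
        · exact singleton_subset_iff.2 (car_mem_varBox.2 (hJ i j (by omega) hj))
    · refine union_subset (singleton_subset_iff.2 ?_)
        (singleton_subset_iff.2 (out_mem_varBox.2 ⟨hp, mem_range.2 (by omega)⟩))
      unfold arrayOut
      split_ifs
      · exact sum_mem_varBox.2 (hJ _ _ (by omega) (by omega))
      · exact sum_mem_varBox.2 (hJ _ _ (by omega) (by omega))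

namespace Layout

/-- The columns at folded distance about `s`. -/
def nearColumns (k d s : ℕ) : Finset ℕ := Icc (s - d) (s + d) ∪ Icc (k - (s + d)) (k - (s - d))

theorem mem_nearColumns {k d s i : ℕ} (hi : i ≤ k) (h : Near d (fold k i) s) :
    i ∈ nearColumns k d s := by
  unfold Near fold at h
  simp only [nearColumns, mem_union, mem_Icc]
  omega

theorem card_nearColumns_le (k d s : ℕ) : (nearColumns k d s).card ≤ 4 * d + 2 := by
  refine (card_union_le _ _).trans ?_
  rw [Nat.card_Icc, Nat.card_Icc]
  omega

variable (Λ : Layout)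

/-- The indices of the bits that may be alive at time `t`. -/
def aliveBits (t : ℕ) : Finset ℕ :=
  nearColumns Λ.k Λ.reach (t / Λ.period) ∪ Icc Λ.lo Λ.k

/-- The indices of the multiplier cells that may be alive at time `t`. -/
def aliveCells (t : ℕ) : Finset (ℕ × ℕ) :=
  (nearColumns Λ.k 1 (t / Λ.period) ×ˢ Icc (Λ.lo - 1) Λ.k).image (fun q => (q.1, q.2 - q.1)) ∪
  ((nearColumns Λ.k Λ.reach (t / Λ.period) ×ˢ range (Λ.c + 1)).image (fun q => (q.2, q.1 - q.2)) ∪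
    (nearColumns Λ.k Λ.reach (t / Λ.period) ×ˢ range (Λ.c + 1)).image
      (fun q => (q.1 - q.2, q.2))) ∪
  (nearColumns Λ.k 0 (t / Λ.period) ×ˢ range 2).image
    (fun q => (q.1 - (t % Λ.period - q.2), t % Λ.period - q.2))

variable {Λ}

theorem card_aliveBits_le (t : ℕ) : (Λ.aliveBits t).card ≤ 5 * (Λ.reach + 1) := by
  refine (card_union_le _ _).trans ?_
  have := card_nearColumns_le Λ.k Λ.reach (t / Λ.period)
  rw [Nat.card_Icc]
  have h : Λ.k + 1 - Λ.lo ≤ Λ.reach := by unfold lo reach; omega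
  omega

/-- For fixed `c` this is linear in the reach: for quadratic multipliers boundedly many rows meet
the strip in about `δ` diagonals, and for the others about `reach` columns have boundedly many cells
each. The wires add only a constant. -/
theorem card_aliveCells_le (t : ℕ) :
    (Λ.aliveCells t).card ≤ (8 * Λ.c + 18) * (Λ.reach + 1) := by
  have h1 : Λ.k + 1 - (Λ.lo - 1) ≤ Λ.reach + 1 := by unfold lo reach; omega
  refine (card_union_le _ _).trans ?_
  refine (Nat.add_le_add ((card_union_le _ _).trans (Nat.add_le_add card_image_le
    ((card_union_le _ _).trans (Nat.add_le_add card_image_le card_image_le))))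
    card_image_le).trans ?_
  simp only [card_product, card_range, Nat.card_Icc]
  have h2 := Nat.mul_le_mul (card_nearColumns_le Λ.k 1 (t / Λ.period)) h1
  have h3 := Nat.mul_le_mul_right (Λ.c + 1) (card_nearColumns_le Λ.k Λ.reach (t / Λ.period))
  have h4 := card_nearColumns_le Λ.k 0 (t / Λ.period)
  nlinarith

theorem mem_aliveCells_of_cellAlive {t : ℕ} {p : Addr} {i j : ℕ} (h : Λ.CellAlive t p i j) :
    (i, j) ∈ Λ.aliveCells t := by
  obtain ⟨hij, h⟩ := h
  split_ifs at h with hd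
  · refine mem_union_left _ (mem_union_left _ (mem_image.2 ⟨(i, i + j), mem_product.2
      ⟨mem_nearColumns (by omega) h.2, mem_Icc.2 (by dsimp only; omega)⟩, by simp⟩))
  · refine mem_union_left _ (mem_union_right _ ?_)
    have hcol := mem_nearColumns hij h.2
    rcases h.1 with h' | h'
    · exact mem_union_left _ (mem_image.2 ⟨(i + j, i), mem_product.2
        ⟨hcol, mem_range.2 (by dsimp only; omega)⟩, by simp⟩)
    · exact mem_union_right _ (mem_image.2 ⟨(i + j, j), mem_product.2
        ⟨hcol, mem_range.2 (by dsimp only; omega)⟩, by simp⟩)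

/-- The quotient of `t` by the period determines the folded column and the remainder determines the
row up to one step, so the wires contribute boundedly many cells to a bag. -/
theorem mem_aliveCells_of_wire {t i j : ℕ} (hij : i + j ≤ Λ.k)
    (h₁ : Λ.period * fold Λ.k (i + j) + j ≤ t)
    (h₂ : t ≤ Λ.period * fold Λ.k (i + j) + j + 1) : (i, j) ∈ Λ.aliveCells t := by
  obtain ⟨x, rfl⟩ : ∃ x, t = Λ.period * fold Λ.k (i + j) + (j + x) :=
    ⟨t - (Λ.period * fold Λ.k (i + j) + j), by omega⟩
  have hlt : j + x < Λ.period := by unfold period; omega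
  have hdiv := mul_add_div_period (f := fold Λ.k (i + j)) hlt
  have hmod : (Λ.period * fold Λ.k (i + j) + (j + x)) % Λ.period = j + x := by
    rw [Nat.mul_add_mod, Nat.mod_eq_of_lt hlt]
  refine mem_union_right _ (mem_image.2 ⟨(i + j, x), mem_product.2 ⟨?_, mem_range.2 ?_⟩, ?_⟩)
  · rw [hdiv]
    exact mem_nearColumns hij ⟨Nat.le_add_right _ _, Nat.le_add_right _ _⟩
  · dsimp only; omega
  · rw [hmod]
    simp

theorem mem_varBox_of_alive {A : Finset Addr} {S : Finset ℕ} {N t : ℕ} {u : BVar}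
    (hu : u ∈ allVars A S N) (h : Λ.Alive t u) :
    u ∈ varBox A S (Λ.aliveBits t) (Λ.aliveCells t) := by
  cases u with
  | inp v i =>
    exact inp_mem_varBox.2 ⟨(inp_mem_varBox.1 hu).1, mem_union_left _ (mem_nearColumns h.1 h.2)⟩
  | out p i =>
    refine out_mem_varBox.2 ⟨(out_mem_varBox.1 hu).1, ?_⟩
    rcases h.2 with h' | h'
    · exact mem_union_left _ (mem_nearColumns h.1 h')
    · exact mem_union_right _ (mem_Icc.2 ⟨h', h.1⟩)
  | rcarry p i =>
    exact rcarry_mem_varBox.2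
      ⟨(rcarry_mem_varBox.1 hu).1, mem_union_left _ (mem_nearColumns h.1 h.2)⟩
  | tab p i j => exact tab_mem_varBox.2 ⟨(tab_mem_varBox.1 hu).1, mem_aliveCells_of_cellAlive h⟩
  | car p i j => exact car_mem_varBox.2 ⟨(car_mem_varBox.1 hu).1, mem_aliveCells_of_cellAlive h⟩
  | sum p i j =>
    refine sum_mem_varBox.2 ⟨(sum_mem_varBox.1 hu).1, ?_⟩
    rcases h with h | h
    · exact mem_aliveCells_of_cellAlive h
    · exact mem_aliveCells_of_wire h.1 h.2.2.1 h.2.2.2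
  | neq i => exact h.elim

theorem card_aliveBox_le (A : Finset Addr) (S : Finset ℕ) (t : ℕ) :
    (varBox A S (Λ.aliveBits t) (Λ.aliveCells t)).card ≤
      (S.card + A.card) * (24 * Λ.c + 64) * (Λ.reach + 1) := by
  refine (card_varBox_le _ _ _ _).trans ?_
  rw [mul_assoc]
  refine Nat.mul_le_mul_left _ ?_
  have h1 := card_aliveBits_le (Λ := Λ) t
  have h2 := card_aliveCells_le (Λ := Λ) t
  nlinarith

end Layout

/-! ### The refutation -/

/-- The output of the circuit for `e` has length at most `e.lengthBound * n`. -/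
def RingExpr.lengthBound : RingExpr → ℕ
  | .var _ => 1
  | .zero => 1
  | .one => 1
  | .add a b => max a.lengthBound b.lengthBound + 1
  | .mul a b => 2 * max a.lengthBound b.lengthBound

theorem RingExpr.length_le {n : ℕ} (hn : 1 ≤ n) (p : Addr) (e : RingExpr) :
    (e.output n p).length ≤ e.lengthBound * n := by
  induction e generalizing p with
  | var v => simp [RingExpr.output, RingExpr.lengthBound]
  | zero => simp [RingExpr.output, RingExpr.lengthBound]
  | one => simp [RingExpr.output, RingExpr.lengthBound]
  | add a b iha ihb =>
    simp only [RingExpr.output, RingExpr.lengthBound, outputs]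
    rw [Nat.succ_mul]
    have h1 := (iha (false :: p)).trans (Nat.mul_le_mul_right n (le_max_left _ b.lengthBound))
    have h2 := (ihb (true :: p)).trans (Nat.mul_le_mul_right n (le_max_right a.lengthBound _))
    omega
  | mul a b iha ihb =>
    simp only [RingExpr.output, RingExpr.lengthBound, outputs]
    rw [mul_assoc]
    have h1 := (iha (false :: p)).trans (Nat.mul_le_mul_right n (le_max_left _ b.lengthBound))
    have h2 := (ihb (true :: p)).trans (Nat.mul_le_mul_right n (le_max_right a.lengthBound _))
    omega

/-- The clause that excludes that bit `k` is the first bit in which the outputs differ. -/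
def firstDifference (k : ℕ) : Clause BVar :=
  insert (.neq k, false) ((range k).image fun i => (.neq i, true))

theorem falsifies_firstDifference {τ : BVar → Bool} {k : ℕ} :
    Falsifies τ (firstDifference k) ↔ τ (.neq k) = true ∧ ∀ i < k, τ (.neq i) = false := by
  simp [Falsifies, firstDifference]

theorem neq_mem_clauseVars_firstDifference {i k : ℕ} (hi : i ≤ k) :
    .neq i ∈ clauseVars (firstDifference k) := by
  rcases hi.eq_or_lt with rfl | hi
  · exact fst_mem_clauseVars (l := (BVar.neq i, false)) (mem_insert_self _ _)
  · exact fst_mem_clauseVars (l := (BVar.neq i, true))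
      (mem_insert_of_mem (mem_image_of_mem _ (mem_range.2 hi)))

theorem falsifies_union {V : Type} [DecidableEq V] {τ : V → Bool} {C D : Clause V} :
    Falsifies τ (C ∪ D) ↔ Falsifies τ C ∧ Falsifies τ D := by
  simp only [Falsifies, mem_union, or_imp, forall_and]

theorem Constraint.exists_clause_of_not_holds {V : Type} [DecidableEq V] {g : Constraint V}
    {τ : V → Bool} (h : ¬ g.holds τ) : ∃ C ∈ g.clauses, Falsifies τ C := by
  refine ⟨_, ⟨τ, h, rfl⟩, fun l hl => ?_⟩
  obtain ⟨v, -, rfl⟩ := mem_image.1 hl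
  simp

section Refutation

variable {L R : RingExpr} {n : ℕ}

/-- Unit propagation is applied to the circuits only. What remains is derived from the gates that
fit into a bag and the comparison gates up to `k`; any assignment satisfying these and falsifying
the target clause would be a `Model` with a first difference in column `k`. -/
theorem derives_firstDifference (hLR : RingIdentity L R) (hL : L.degree ≤ 2) (hR : R.degree ≤ 2)
    (hn : 1 ≤ n) {A : Finset Addr} {S : Finset ℕ} {N : ℕ}
    (hA : L.addrs [false] ∪ R.addrs [true] ⊆ A) (hS : L.varSet ∪ R.varSet ⊆ S)
    (hNL : (L.output n [false]).length ≤ N) (hNR : (R.output n [true]).length ≤ N)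
    {Λ : Layout} (hdeg : Λ.deg = fun p => (nodeAt L R p).degree)
    (hk : Λ.k < max (L.output n [false]).length (R.output n [true]).length)
    (hcL : L.constBits ≤ Λ.c) (hcR : R.constBits ≤ Λ.c)
    (hbound : (L.errorBound Λ.c + R.errorBound Λ.c) * Λ.k < 2 ^ Λ.δ) :
    Derives (arrayInstance L R n) (allVars A S N)
      ((Λ.horizon + 1) * 4 ^ ((S.card + A.card) * (24 * Λ.c + 64) * (Λ.reach + 1)) +
        ((allVars A S N).card + 1) * (4 ^ 4 + 1)) (firstDifference Λ.k) := by
  have hvars : ∀ g ∈ L.circuit n [false] ∪ R.circuit n [true], g.vars ⊆ allVars A S N := by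
    rintro g (hg | hg)
    · exact RingExpr.circuit_vars_subset hn (subset_union_left.trans hA)
        (subset_union_left.trans hS) hNL g hg
    · exact RingExpr.circuit_vars_subset hn (subset_union_right.trans hA)
        (subset_union_right.trans hS) hNR g hg
  refine derives_of_forall_unitClosed (𝒢 := L.circuit n [false] ∪ R.circuit n [true])
    (fun g hg C hC => show C ∈ arrayInstance L R n from ⟨g, Or.inl hg, hC⟩) hvars ?_ ?_
  · rintro g (hg | hg) <;> exact (RingExpr.isGate_of_mem_circuit hg).card_vars_le
  intro K hKW hKcons hK
  have hclV : ∀ {v}, v ∈ clauseVars K → v ∈ clauseVars (K ∪ firstDifference Λ.k) := fun h => by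
    obtain ⟨l, hl, rfl⟩ := mem_clauseVars.1 h
    exact fst_mem_clauseVars (mem_union_left _ hl)
  have hclF : ∀ {v}, v ∈ clauseVars (firstDifference Λ.k) →
      v ∈ clauseVars (K ∪ firstDifference Λ.k) := fun h => by
    obtain ⟨l, hl, rfl⟩ := mem_clauseVars.1 h
    exact fst_mem_clauseVars (mem_union_right _ hl)
  have hfit : ∀ {t} {U : Finset BVar}, U ⊆ allVars A S N → Λ.Fits K t U → ∀ v ∈ U,
      v ∈ clauseVars (K ∪ firstDifference Λ.k) ∨
        (v ∈ allVars A S N \ clauseVars K ∧ Λ.Alive t v) := by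
    intro t U hU hf v hv
    by_cases hvK : v ∈ clauseVars K
    · exact Or.inl (hclV hvK)
    · exact Or.inr ⟨mem_sdiff.2 ⟨hU hv, hvK⟩, (hf v hv).resolve_left hvK⟩
  refine derives_of_pathDecomposition (Alive := Λ.Alive)
    (Φ := {C | ∃ g, ((g ∈ L.circuit n [false] ∪ R.circuit n [true] ∧
      ∃ t ≤ Λ.horizon, Λ.Fits K t g.vars) ∨ ∃ i ≤ Λ.k,
      g = neqGate ((L.output n [false]).bit i) ((R.output n [true]).bit i) i) ∧ C ∈ g.clauses})
    ?_ ?_ ?_ (fun u _ r s t hrs hst => Layout.alive_convex hrs hst) ?_ ?_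
  · rintro C ⟨g, ⟨hg, -⟩ | ⟨i, hi, rfl⟩, hC⟩
    · exact ⟨g, Or.inl hg, hC⟩
    · exact ⟨_, Or.inr (Or.inl ⟨i, by omega, rfl⟩), hC⟩
  · obtain ⟨τ, hτ⟩ := hKcons
    -- The clause `K` concerns circuit variables and the other one comparison variables only, so
    -- they can be falsified independently.
    refine ⟨fun u => match u with
      | .neq i => decide (i = Λ.k)
      | u => τ u, falsifies_union.2 ⟨fun l hl => ?_, falsifies_firstDifference.2
        ⟨by simp, fun i hi => by simp [hi.ne]⟩⟩⟩
    have hW := hKW (fst_mem_clauseVars hl)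
    have := hτ l hl
    obtain ⟨u, b⟩ := l
    cases u with
    | neq i => exact absurd hW neq_notMem_varBox
    | _ => exact this
  · rintro C ⟨g, h, σ, -, rfl⟩
    rcases h with ⟨hg, t, ht, hf⟩ | ⟨i, hi, rfl⟩
    · refine ⟨t, ht, fun l hl => ?_⟩
      obtain ⟨v, hv, rfl⟩ := mem_image.1 hl
      exact hfit (hvars g hg) hf v hv
    · refine ⟨Λ.period * fold Λ.k i, Layout.mul_fold_le_horizon (Nat.zero_le _), fun l hl => ?_⟩
      obtain ⟨v, hv, rfl⟩ := mem_image.1 hl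
      have hnear : Near Λ.reach (fold Λ.k i) ((Λ.period * fold Λ.k i) / Λ.period) := by
        rw [Layout.mul_div_period]; constructor <;> omega
      rcases mem_union.1 hv with hv | hv
      · rcases mem_union.1 hv with hv | hv
        · exact hfit (RingExpr.bit_vars_subset (subset_union_left.trans hA)
            (subset_union_left.trans hS) hNL i) (Layout.fits_bit hi hnear) v hv
        · exact hfit (RingExpr.bit_vars_subset (subset_union_right.trans hA)
            (subset_union_right.trans hS) hNR i) (Layout.fits_bit hi hnear) v hv
      · rw [mem_singleton.1 hv]
        exact Or.inl (hclF (neq_mem_clauseVars_firstDifference hi))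
  · exact fun t _ => ⟨_, Layout.card_aliveBox_le A S t, fun u hu h =>
      Layout.mem_varBox_of_alive (mem_sdiff.1 hu).1 h⟩
  · intro τ hτ
    obtain ⟨hτK, hτF⟩ := falsifies_union.1 hτ
    rw [falsifies_firstDifference] at hτF
    by_contra hno
    push Not at hno
    have hmodel : Λ.Model (L.circuit n [false] ∪ R.circuit n [true]) K τ := by
      refine ⟨hτK, fun g hg t ht hf => ?_⟩
      by_contra hg'
      obtain ⟨C, hC, hCτ⟩ := Constraint.exists_clause_of_not_holds hg'
      exact hno C ⟨g, Or.inl ⟨hg, t, ht, hf⟩, hC⟩ hCτ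
    have hneq : ∀ i ≤ Λ.k,
        (neqGate ((L.output n [false]).bit i) ((R.output n [true]).bit i) i).holds τ := by
      intro i hi
      by_contra hg'
      obtain ⟨C, hC, hCτ⟩ := Constraint.exists_clause_of_not_holds hg'
      exact hno C ⟨_, Or.inr ⟨i, hi, rfl⟩, hC⟩ hCτ
    refine hmodel.false_of_first_difference hn hK hLR hL hR (p := [false]) (q := [true])
      ?_ ?_ hcL hcR (fun g => Or.inl) (fun g => Or.inr) hbound ?_ ?_
    · rw [hdeg]; exact labels_nodeAt L R (by simp) rfl
    · rw [hdeg]; exact labels_nodeAt L R (by simp) rfl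
    · intro i hi _
      have h1 : τ (.neq i) = _ := hneq i hi.le
      rw [hτF.2 i hi] at h1
      revert h1
      cases ((L.output n [false]).bit i).val τ <;> cases ((R.output n [true]).bit i).val τ <;> simp
    · have h1 : τ (.neq Λ.k) = _ := hneq Λ.k le_rfl
      rw [hτF.1] at h1
      revert h1
      cases ((L.output n [false]).bit Λ.k).val τ <;>
        cases ((R.output n [true]).bit Λ.k).val τ <;> simp

theorem someNeq_mem_arrayInstance (L R : RingExpr) (n : ℕ) :
    (range (max (L.output n [false]).length (R.output n [true]).length)).image
      (fun i => (BVar.neq i, true)) ∈ arrayInstance L R n := by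
  refine ⟨_, Or.inr (Or.inr rfl), fun _ => false, by simp [someNeq], ?_⟩
  simp [someNeq, image_image, Function.comp_def]

/-- The size of the refutation, in terms of the length `N` of the outputs. -/
theorem refutation_size_le {N B c E Q δ W : ℕ} (hN : 1 ≤ N) (hE : 2 ^ δ ≤ 2 * (E * N))
    (hW : W ≤ Q * (2 * N + 3 * (N * N))) :
    N * (((N + 1) * N + 1) * 4 ^ (B * (δ + c + 2)) + (W + 1) * (4 ^ 4 + 1) + 1) + 1 ≤
      (3 * (4 ^ (B * (c + 2)) * (2 * E) ^ (2 * B)) + 257 * (5 * Q + 1) + 2) * N ^ (2 * B + 3) := by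
  -- The number of clauses is exponential in `δ`, but `2 ^ δ` is at most linear in `N`; this makes
  -- it a power of `N`.
  have h1 : 4 ^ (B * (δ + c + 2)) ≤ 4 ^ (B * (c + 2)) * (2 * E) ^ (2 * B) * N ^ (2 * B) := by
    calc 4 ^ (B * (δ + c + 2)) = 4 ^ (B * (c + 2)) * (2 ^ δ) ^ (2 * B) := by
          rw [show (4 : ℕ) = 2 ^ 2 by norm_num, ← pow_mul, ← pow_mul, ← pow_mul, ← pow_add]
          congr 1; ring
      _ ≤ 4 ^ (B * (c + 2)) * (2 * (E * N)) ^ (2 * B) := by gcongr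
      _ = _ := by rw [← mul_assoc 2 E N, mul_pow (2 * E) N]; ring
  set G := 4 ^ (B * (c + 2)) * (2 * E) ^ (2 * B)
  set X := N ^ (2 * B)
  have hX : 1 ≤ X := Nat.one_le_pow _ _ hN
  have h2 : (N + 1) * N + 1 ≤ 3 * N ^ 2 := by nlinarith
  have h3 : W + 1 ≤ (5 * Q + 1) * N ^ 2 := by
    have : 2 * N + 3 * (N * N) ≤ 5 * N ^ 2 := by nlinarith
    have h4 := Nat.mul_le_mul_left Q this
    have h5 : 1 ≤ N ^ 2 := Nat.one_le_pow _ _ hN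
    nlinarith
  have hN3 : 1 ≤ N ^ 3 := Nat.one_le_pow _ _ hN
  have hNN : N ≤ N ^ 3 := Nat.le_self_pow (by norm_num) N
  have hXN : N ^ 3 ≤ X * N ^ 3 := Nat.le_mul_of_pos_left _ hX
  calc N * (((N + 1) * N + 1) * 4 ^ (B * (δ + c + 2)) + (W + 1) * (4 ^ 4 + 1) + 1) + 1
      ≤ N * (3 * N ^ 2 * (G * X) + (5 * Q + 1) * N ^ 2 * (4 ^ 4 + 1) + 1) + 1 := by gcongr
    _ = 3 * G * (X * N ^ 3) + 257 * (5 * Q + 1) * N ^ 3 + N + 1 := by ring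
    _ ≤ 3 * G * (X * N ^ 3) + 257 * (5 * Q + 1) * (X * N ^ 3) + X * N ^ 3 + X * N ^ 3 := by
        gcongr
        · exact hNN.trans hXN
        · exact hN3.trans hXN
    _ = (3 * G + 257 * (5 * Q + 1) + 2) * N ^ (2 * B + 3) := by rw [pow_add]; ring

end Refutation

end ArrayMul

open ArrayMul in
theorem mainTheorem1 (L R : RingExpr) (hLR : RingIdentity L R)
    (hL : L.degree ≤ 2) (hR : R.degree ≤ 2) :
    ∃ A d : ℕ, ∀ n : ℕ, 1 ≤ n →
      ∃ P : Refutation (arrayInstance L R n), P.IsRegular ∧ P.size ≤ A * n ^ d := by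
  let A : Finset Addr := L.addrs [false] ∪ R.addrs [true]
  let S : Finset ℕ := L.varSet ∪ R.varSet
  let c := max L.constBits R.constBits
  let E := L.errorBound c + R.errorBound c
  let B := (S.card + A.card) * (24 * c + 64)
  let Q := S.card + A.card
  let M := max L.lengthBound R.lengthBound
  refine ⟨(3 * (4 ^ (B * (c + 2)) * (2 * E) ^ (2 * B)) + 257 * (5 * Q + 1) + 2) *
    M ^ (2 * B + 3), 2 * B + 3, fun n hn => ?_⟩
  set N := max (L.output n [false]).length (R.output n [true]).length with hNdef
  have hN1 : 1 ≤ N := hn.trans ((L.le_length n [false]).trans (le_max_left _ _))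
  have hNM : N ≤ M * n := max_le
    ((L.length_le hn _).trans (Nat.mul_le_mul_right n (le_max_left _ _)))
    ((R.length_le hn _).trans (Nat.mul_le_mul_right n (le_max_right _ _)))
  have hE1 : 1 ≤ E := (L.one_le_errorBound c).trans (Nat.le_add_right _ _)
  -- The width of the strip: `2 ^ δ` must exceed `E * k` for every `k < N` so that the errors are
  -- harmless, and it must stay `O(N)` so that the bags are small enough.
  let δ := Nat.log 2 (E * N) + 1
  have hδ : E * N < 2 ^ δ := Nat.lt_pow_succ_log_self (by norm_num) _
  have hδ' : 2 ^ δ ≤ 2 * (E * N) := by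
    rw [pow_succ, mul_comm]
    exact Nat.mul_le_mul_left _ (Nat.pow_log_le_self 2 (Nat.mul_pos hE1 hN1).ne')
  have hcard : (allVars A S N).card ≤ Q * (2 * N + 3 * (N * N)) := by
    simpa [allVars] using card_varBox_le A S (Finset.range N) (Finset.range N ×ˢ Finset.range N)
  have key := derives_empty_of_forall_first (φ := arrayInstance L R n) (e := BVar.neq)
    (fun i j h => BVar.neq.inj h) (m := N) (H := allVars A S N)
    (s := ((N + 1) * N + 1) * 4 ^ (B * (δ + c + 2)) + ((allVars A S N).card + 1) * (4 ^ 4 + 1))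
    (fun i => neq_notMem_varBox) (someNeq_mem_arrayInstance L R n) fun k hk => by
      refine (derives_firstDifference hLR hL hR hn (A := A) (S := S) (N := N) subset_rfl subset_rfl
        (le_max_left _ _) (le_max_right _ _)
        (Λ := ⟨k, δ, c, fun p => (nodeAt L R p).degree⟩) rfl hk (le_max_left _ _)
        (le_max_right _ _) ?_).mono subset_rfl ?_ subset_rfl
      · exact (Nat.mul_le_mul_left E hk.le).trans_lt hδ
      -- The horizon is `(k + 2) * (k + 1)`, which is at most `(N + 1) * N` because `k < N`.
      · refine Nat.add_le_add_right (Nat.mul_le_mul (Nat.succ_le_succ ?_) le_rfl) _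
        exact Nat.mul_le_mul (Nat.succ_le_succ hk) hk
  obtain ⟨P, hreg, hsize⟩ := key.exists_refutation
  refine ⟨P, hreg, hsize.trans ((refutation_size_le hN1 hδ' hcard).trans ?_)⟩
  calc _ ≤ (3 * (4 ^ (B * (c + 2)) * (2 * E) ^ (2 * B)) + 257 * (5 * Q + 1) + 2) *
        (M * n) ^ (2 * B + 3) := by gcongr
    _ = _ := by rw [mul_pow M n, mul_assoc _ (M ^ (2 * B + 3))]
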